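/- Let $\mathbb D$ be the open unit disc and $dA=\frac{dx\,dy}{\pi}$. Let $\omega$ be a radial weight in the class $\widehat{\mathcal D}$: $\omega\ge0$ on $\mathbb D$, $\omega(z)=\omega(|z|)$, $\omega\in L^1(\mathbb D,dA)$, $\widehat\omega(r)=\int_r^1\omega(s)\,ds>0$ for $0\le r<1$, and there is a constant $K$ with $\widehat\omega(r)\le K\,\widehat\omega\big(\frac{1+r}2\big)$ for all $0\le r<1$. Write $\omega(E)=\int_E\omega\,dA$. Let $\nu$ be a positive Borel measure on $\mathbb D$, finite on compact subsets of $\mathbb D$. For $\zeta=re^{i\theta}\in\mathbb D\setminus\{0\}$ let $\Gamma(\zeta)=\{z\in\mathbb D:|\theta-\arg z|<\frac12(1-\frac{|z|}r)\}$ (arguments modulo $2\pi$), where the origin, whose argument is arbitrary, belongs to every $\Gamma(\zeta)$; put $\Gamma(0)=\{0\}$. Let $T(z)=\{\zeta\in\mathbb D:z\in\Gamma(\zeta)\}$. The symbol $\omega(T(z))$ has its usual meaning for $z\ne0$, and $\omega(T(0))$ stands for $\lim_{r\to0^+}\omega(T(r))$. For a $\nu$-measurable $f:\mathbb D\to\mathbb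 C$ and $0<q<\infty$ let $$A_{q,\nu}(f)(\zeta)=\Big(\int_{\Gamma(\zeta)}|f|^q\,d\nu\Big)^{1/q},\qquad A_{\infty,\nu}(f)(\zeta)=\nu\text{-}\operatorname*{ess\,sup}_{z\in\Gamma(\zeta)}|f(z)|,$$ $$C_{q,\nu}(f)(\zeta)=\Big(\sup_{a\in\Gamma(\zeta)}\frac1{\omega(T(a))}\int_{T(a)}|f(z)|^q\,\omega(T(z))\,d\nu(z)\Big)^{1/q}.$$ The tent space $T^p_q(\nu,\omega)$ consists of the $\nu$-equivalence classes of $\nu$-measurable functions $f$ with finite norm, where $\|f\|_{T^p_q(\nu,\omega)}=\|A_{q,\nu}(f)\|_{L^p(\omega\,dA)}$ if $p<\infty$, $0<q\le\infty$, and $\|f\|_{T^\infty_q(\nu,\omega)}=\|C_{q,\nu}(f)\|_{L^\infty(\mathbb D)}$ if $0<q<\infty$. Theorem. Let $1\le p,q<\infty$ with $p+q\ne2$, and let $p',q'\in(1,\infty]$ be the conjugate exponents. Then the dual of $T^p_q(\nu,\omega)$ is identified with $T^{p'}_{q'}(\nu,\omega)$, up to an equivalence of norms, under the pairing $$\langle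 f,g\rangle=\int_{\mathbb D}f(z)\overline{g(z)}\,\omega(T(z))\,d\nu(z).$$ That is, the integral converges absolutely for all $f\in T^p_q(\nu,\omega)$ and $g\in T^{p'}_{q'}(\nu,\omega)$; the map $g\mapsto\langle\,\cdot\,,g\rangle$ is a conjugate-linear bijection of $T^{p'}_{q'}(\nu,\omega)$ onto the space of continuous linear functionals on $T^p_q(\nu,\omega)$; and there are constants $0<c\le C<\infty$ such that $c\,\|g\|_{T^{p'}_{q'}(\nu,\omega)}\le\|\langle\,\cdot\,,g\rangle\|\le C\,\|g\|_{T^{p'}_{q'}(\nu,\omega)}$ for all $g\in T^{p'}_{q'}(\nu,\omega)$. -/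

import Mathlib

open MeasureTheory Filter Topology
open scoped ENNReal NNReal ComplexConjugate

namespace TentDuality

noncomputable section

/-- The open unit disc of the complex plane, as a measure space (area) and a metric space. -/
abbrev Disc : Type := Metric.ball (0 : ℂ) 1

instance : LocallyCompactSpace Disc := Metric.isOpen_ball.locallyCompactSpace

/-- The origin of the disc. -/
def origin : Disc := ⟨0, by simp⟩

open Classical in
/-- The point `r ∈ [0, 1)` of the disc (the value for other `r` is irrelevant). -/
def realPoint (r : ℝ) : Disc :=
  if h : (r : ℂ) ∈ Metric.ball (0 : ℂ) 1 then ⟨(r : ℂ), h⟩ else origin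

/-- The normalized area measure `dA = dx dy / π` on the disc. -/
def area : Measure Disc :=
  (ENNReal.ofReal Real.pi)⁻¹ • Measure.comap ((↑) : Disc → ℂ) volume

/-- The measure `ω dA` on the disc. -/
def weightMeasure (ω : ℂ → ℝ) : Measure Disc :=
  area.withDensity (fun z => ENNReal.ofReal (ω z))

/-- The tail integral `∫_r^1 ω(s) ds`. -/
def tail (ω : ℂ → ℝ) (r : ℝ) : ℝ≥0∞ :=
  ∫⁻ s in Set.Ioo r 1, ENNReal.ofReal (ω (s : ℂ))

/-- The class of radial weights (nonnegative, integrable over the disc, depending only on the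
modulus) whose tail integral has the doubling property: the quotient
`tail ω r / tail ω ((1 + r) / 2)` makes sense and is bounded for `0 ≤ r < 1`.
Only the values of `ω` in the disc matter. -/
structure DoublingRadialWeight (ω : ℂ → ℝ) : Prop where
  nonneg : ∀ z : ℂ, ‖z‖ < 1 → 0 ≤ ω z
  integrable : Integrable (fun z : Disc => ω z) area
  radial : ∀ z : ℂ, ‖z‖ < 1 → ω z = ω ((‖z‖ : ℝ) : ℂ)
  tail_pos : ∀ r : ℝ, 0 ≤ r → r < 1 → 0 < tail ω r
  doubling : ∃ C : ℝ≥0, ∀ r : ℝ, 0 ≤ r → r < 1 → tail ω r ≤ C * tail ω ((1 + r) / 2)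

/-- The lens `Γ(ζ) = {z : |arg ζ - arg z| < (1 - |z| / |ζ|) / 2}`, for `ζ ≠ 0`; the difference of
arguments is taken modulo `2π`, so its absolute value is `|arg (z / ζ)|`. The origin, whose
argument is arbitrary, belongs to every lens, and `Γ(0) = {0}`. -/
def lens (ζ : Disc) : Set Disc :=
  {z | (ζ = origin ∧ z = origin) ∨
    (ζ ≠ origin ∧ |Complex.arg ((z : ℂ) / ζ)| < (1 - ‖(z : ℂ)‖ / ‖(ζ : ℂ)‖) / 2)}

/-- The tent `T(z) = {ζ : z ∈ Γ(ζ)}`. -/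
def tent (z : Disc) : Set Disc := {ζ | z ∈ lens ζ}

/-- `ω(T(z)) = ∫_{T(z)} ω dA` for `z ≠ 0`, and its limit along `z = r → 0+` at the origin. -/
def tentMass (ω : ℂ → ℝ) (z : Disc) : ℝ≥0∞ :=
  if z = origin then
    limUnder (𝓝[>] (0 : ℝ)) (fun r : ℝ => weightMeasure ω (tent (realPoint r)))
  else weightMeasure ω (tent z)

/-- `A_{q,ν}(f)(ζ)`: it is `(∫_{Γ(ζ)} |f|^q dν)^{1/q}` for `0 < q < ∞` and the `ν`-essential
supremum of `|f|` over `Γ(ζ)` for `q = ∞`. -/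
def areaFunction (ν : Measure Disc) (q : ℝ≥0∞) (f : Disc → ℂ) (ζ : Disc) : ℝ≥0∞ :=
  eLpNorm f q (ν.restrict (lens ζ))

/-- `C_{q,ν}(f)(ζ)`, for `0 < q < ∞`: its `q`-th power is the supremum over `a ∈ Γ(ζ)` of
`ω(T(a))⁻¹ ∫_{T(a)} |f(z)|^q ω(T(z)) dν(z)`. -/
def carlesonFunction (ν : Measure Disc) (ω : ℂ → ℝ) (q : ℝ≥0∞) (f : Disc → ℂ) (ζ : Disc) : ℝ≥0∞ :=
  (⨆ a ∈ lens ζ, (tentMass ω a)⁻¹ *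
    ∫⁻ z in tent a, ‖f z‖ₑ ^ q.toReal * tentMass ω z ∂ν) ^ (1 / q.toReal)

/-- The (quasi-)norm of `T^p_q(ν, ω)`: it is `‖A_{q,ν}(f)‖_{L^p_ω}` for `p < ∞` and
`‖C_{q,ν}(f)‖_{L^∞}` for `p = ∞`, `q < ∞`. The remaining case `p = q = ∞` is not used; it is
filled by `‖A_{∞,ν}(f)‖_{L^∞}`. -/
def tentENorm (ν : Measure Disc) (ω : ℂ → ℝ) (p q : ℝ≥0∞) (f : Disc → ℂ) : ℝ≥0∞ :=
  if p = ∞ ∧ q ≠ ∞ then eLpNorm (carlesonFunction ν ω q f) ∞ area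
  else eLpNorm (areaFunction ν q f) p (weightMeasure ω)

/-! ### Measurability and the triangle inequality -/

lemma measurableSet_lens_prod : MeasurableSet {x : Disc × Disc | x.2 ∈ lens x.1} := by
  have h1 : Measurable (fun x : Disc × Disc => (x.1 : ℂ)) := by fun_prop
  have h2 : Measurable (fun x : Disc × Disc => (x.2 : ℂ)) := by fun_prop
  have e1 : MeasurableSet {x : Disc × Disc | x.1 = origin} :=
    measurable_fst (measurableSet_singleton origin)
  have e2 : MeasurableSet {x : Disc × Disc | x.2 = origin} :=
    measurable_snd (measurableSet_singleton origin)
  have e3 : MeasurableSet {x : Disc × Disc |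
      |Complex.arg ((x.2 : ℂ) / x.1)| < (1 - ‖(x.2 : ℂ)‖ / ‖(x.1 : ℂ)‖) / 2} := by
    refine measurableSet_lt ?_ ?_
    · exact continuous_abs.measurable.comp (Complex.measurable_arg.comp (h2.div h1))
    · exact ((measurable_const.sub (h2.norm.div h1.norm)).div_const 2)
  exact (e1.inter e2).union (e1.compl.inter e3)

lemma measurableSet_lens (ζ : Disc) : MeasurableSet (lens ζ) :=
  measurable_prodMk_left (x := ζ) measurableSet_lens_prod

lemma measurableSet_tent (z : Disc) : MeasurableSet (tent z) :=
  measurable_prodMk_right (y := z) measurableSet_lens_prod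

instance : IsFiniteMeasure area := by
  have h0 : (ENNReal.ofReal Real.pi)⁻¹ ≠ ∞ := by simpa using Real.pi_pos
  constructor
  rw [area, Measure.smul_apply,
    (MeasurableEmbedding.subtype_coe Metric.isOpen_ball.measurableSet).comap_apply,
    Set.image_univ, Subtype.range_coe, smul_eq_mul]
  exact ENNReal.mul_lt_top h0.lt_top measure_ball_lt_top

instance (ω : ℂ → ℝ) : SigmaFinite (weightMeasure ω) := by
  unfold weightMeasure; infer_instance

lemma measurable_tentMass (ω : ℂ → ℝ) : Measurable (tentMass ω) := by
  unfold tentMass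
  refine Measurable.ite (measurableSet_singleton origin) measurable_const ?_
  have h : ∀ z, tent z = (fun ζ => (ζ, z)) ⁻¹' {x : Disc × Disc | x.2 ∈ lens x.1} := fun _ => rfl
  simp only [h]
  exact measurable_measure_prodMk_right measurableSet_lens_prod

lemma measurable_areaFunction (ν : Measure Disc) [SFinite ν] {q : ℝ≥0∞} (hq : 1 ≤ q)
    {f : Disc → ℂ} (hf : Measurable f) : Measurable (areaFunction ν q f) := by
  by_cases hq' : q = ∞
  · subst hq'
    refine measurable_of_Ioi fun c => ?_
    have hs : MeasurableSet {x : Disc × Disc | x.2 ∈ lens x.1 ∧ c < ‖f x.2‖ₑ} :=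
      measurableSet_lens_prod.inter
        (measurableSet_lt measurable_const (hf.comp measurable_snd).enorm)
    have hm := measurable_measure_prodMk_left (ν := ν) hs
    have : areaFunction ν ∞ f ⁻¹' Set.Ioi c
        = {ζ | 0 < ν (Prod.mk ζ ⁻¹' {x : Disc × Disc | x.2 ∈ lens x.1 ∧ c < ‖f x.2‖ₑ})} := by
      ext ζ
      simp only [Set.mem_preimage, Set.mem_Ioi, areaFunction, eLpNorm_exponent_top,
        Set.mem_ofPred_eq, pos_iff_ne_zero]
      rw [← not_le, not_iff_comm, not_not]
      have hset : (Prod.mk ζ ⁻¹' {x : Disc × Disc | x.2 ∈ lens x.1 ∧ c < ‖f x.2‖ₑ})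
          = {z | ¬ ‖f z‖ₑ ≤ c} ∩ lens ζ := by
        ext z; simp [and_comm]
      rw [hset, ← Measure.restrict_apply' (measurableSet_lens ζ)]
      constructor
      · intro h
        exact essSup_le_of_ae_le c h
      · intro h
        filter_upwards [enorm_ae_le_eLpNormEssSup f (ν.restrict (lens ζ))] with z hz
        exact hz.trans h
    rw [this]
    exact measurableSet_lt measurable_const hm
  · have h0 : q ≠ 0 := (zero_lt_one.trans_le hq).ne'
    have : areaFunction ν q f = fun ζ => (∫⁻ z, {x : Disc × Disc | x.2 ∈ lens x.1}.indicator
        (fun x => ‖f x.2‖ₑ ^ q.toReal) (ζ, z) ∂ν) ^ (1 / q.toReal) := by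
      funext ζ
      rw [areaFunction, eLpNorm_eq_lintegral_rpow_enorm_toReal h0 hq',
        ← lintegral_indicator (measurableSet_lens ζ)]
      rfl
    rw [this]
    refine Measurable.pow_const ?_ _
    refine Measurable.lintegral_prod_right' (f := {x : Disc × Disc | x.2 ∈ lens x.1}.indicator
        (fun x => ‖f x.2‖ₑ ^ q.toReal)) ?_
    exact (((hf.comp measurable_snd).enorm).pow_const _).indicator measurableSet_lens_prod

lemma areaFunction_add_le (ν : Measure Disc) {q : ℝ≥0∞} (hq : 1 ≤ q) {f g : Disc → ℂ}
    (hf : Measurable f) (hg : Measurable g) (ζ : Disc) :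
    areaFunction ν q (f + g) ζ ≤ areaFunction ν q f ζ + areaFunction ν q g ζ :=
  eLpNorm_add_le hf.aestronglyMeasurable hg.aestronglyMeasurable hq

/-- One term of the supremum defining `carlesonFunction`, as an `L^q` norm. -/
lemma carleson_term_eq (ν : Measure Disc) (ω : ℂ → ℝ) {q : ℝ≥0∞} (hq : 1 ≤ q) (hq' : q ≠ ∞)
    (f : Disc → ℂ) (a : Disc) :
    (∫⁻ z in tent a, ‖f z‖ₑ ^ q.toReal * tentMass ω z ∂ν) ^ (1 / q.toReal)
      = eLpNorm (fun z => ‖f z‖ₑ * tentMass ω z ^ (1 / q.toReal)) q (ν.restrict (tent a)) := by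
  have h0 : q ≠ 0 := (zero_lt_one.trans_le hq).ne'
  have hr : 0 < q.toReal := ENNReal.toReal_pos h0 hq'
  rw [eLpNorm_eq_lintegral_rpow_enorm_toReal h0 hq']
  congr 1
  refine lintegral_congr fun z => ?_
  rw [enorm_eq_self, ENNReal.mul_rpow_of_nonneg _ _ hr.le, ← ENNReal.rpow_mul,
    one_div_mul_cancel hr.ne', ENNReal.rpow_one]

lemma carlesonFunction_eq (ν : Measure Disc) (ω : ℂ → ℝ) {q : ℝ≥0∞} (hq : 1 ≤ q) (hq' : q ≠ ∞)
    (f : Disc → ℂ) (ζ : Disc) :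
    carlesonFunction ν ω q f ζ = ⨆ a ∈ lens ζ, ((tentMass ω a)⁻¹) ^ (1 / q.toReal) *
      eLpNorm (fun z => ‖f z‖ₑ * tentMass ω z ^ (1 / q.toReal)) q (ν.restrict (tent a)) := by
  have h0 : q ≠ 0 := (zero_lt_one.trans_le hq).ne'
  have hr : 0 < q.toReal := ENNReal.toReal_pos h0 hq'
  have hr' : 0 < 1 / q.toReal := by positivity
  unfold carlesonFunction
  have e := (ENNReal.orderIsoRpow (1 / q.toReal) hr').map_iSup₂
    (fun (a : Disc) (_ : a ∈ lens ζ) => (tentMass ω a)⁻¹ *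
      ∫⁻ z in tent a, ‖f z‖ₑ ^ q.toReal * tentMass ω z ∂ν)
  simp only [ENNReal.orderIsoRpow_apply] at e
  rw [e]
  refine iSup_congr fun a => iSup_congr fun _ => ?_
  rw [ENNReal.mul_rpow_of_nonneg _ _ hr'.le, carleson_term_eq ν ω hq hq']

lemma carlesonFunction_add_le (ν : Measure Disc) (ω : ℂ → ℝ) {q : ℝ≥0∞} (hq : 1 ≤ q)
    (hq' : q ≠ ∞) {f g : Disc → ℂ} (hf : Measurable f) (hg : Measurable g) (ζ : Disc) :
    carlesonFunction ν ω q (f + g) ζ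
      ≤ carlesonFunction ν ω q f ζ + carlesonFunction ν ω q g ζ := by
  simp only [carlesonFunction_eq ν ω hq hq']
  refine iSup₂_le fun a ha => ?_
  set w : Disc → ℝ≥0∞ := fun z => tentMass ω z ^ (1 / q.toReal) with hw
  have hwm : Measurable w := (measurable_tentMass ω).pow_const _
  have key : eLpNorm (fun z => ‖(f + g) z‖ₑ * w z) q (ν.restrict (tent a))
      ≤ eLpNorm (fun z => ‖f z‖ₑ * w z) q (ν.restrict (tent a))
        + eLpNorm (fun z => ‖g z‖ₑ * w z) q (ν.restrict (tent a)) := by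
    refine le_trans (eLpNorm_mono_enorm (g := (fun z => ‖f z‖ₑ * w z) + fun z => ‖g z‖ₑ * w z)
      fun z => ?_) (eLpNorm_add_le ?_ ?_ hq)
    · simp only [enorm_eq_self, Pi.add_apply, ← add_mul]
      gcongr
      exact enorm_add_le _ _
    · exact (hf.enorm.mul hwm).aestronglyMeasurable
    · exact (hg.enorm.mul hwm).aestronglyMeasurable
  refine (mul_le_mul_right key _).trans ?_
  rw [mul_add]
  exact add_le_add
    (le_iSup₂ (f := fun a (_ : a ∈ lens ζ) => ((tentMass ω a)⁻¹) ^ (1 / q.toReal) *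
      eLpNorm (fun z => ‖f z‖ₑ * w z) q (ν.restrict (tent a))) a ha)
    (le_iSup₂ (f := fun a (_ : a ∈ lens ζ) => ((tentMass ω a)⁻¹) ^ (1 / q.toReal) *
      eLpNorm (fun z => ‖g z‖ₑ * w z) q (ν.restrict (tent a))) a ha)

lemma areaFunction_congr {ν : Measure Disc} (q : ℝ≥0∞) {f g : Disc → ℂ} (h : f =ᵐ[ν] g) :
    areaFunction ν q f = areaFunction ν q g := by
  funext ζ
  exact eLpNorm_congr_ae (ae_restrict_of_ae h)

lemma carlesonFunction_congr {ν : Measure Disc} (ω : ℂ → ℝ) (q : ℝ≥0∞) {f g : Disc → ℂ}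
    (h : f =ᵐ[ν] g) : carlesonFunction ν ω q f = carlesonFunction ν ω q g := by
  funext ζ
  unfold carlesonFunction
  congr 1
  refine iSup_congr fun a => iSup_congr fun _ => ?_
  congr 1
  refine lintegral_congr_ae (ae_restrict_of_ae ?_)
  filter_upwards [h] with z hz
  rw [hz]

lemma tentENorm_congr {ν : Measure Disc} (ω : ℂ → ℝ) (p q : ℝ≥0∞) {f g : Disc → ℂ}
    (h : f =ᵐ[ν] g) : tentENorm ν ω p q f = tentENorm ν ω p q g := by
  unfold tentENorm
  rw [areaFunction_congr q h, carlesonFunction_congr ω q h]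

lemma tentENorm_add_le (ν : Measure Disc) [SFinite ν] (ω : ℂ → ℝ) {p q : ℝ≥0∞} (hp : 1 ≤ p)
    (hq : 1 ≤ q) {f g : Disc → ℂ} (hf : Measurable f) (hg : Measurable g) :
    tentENorm ν ω p q (f + g) ≤ tentENorm ν ω p q f + tentENorm ν ω p q g := by
  unfold tentENorm
  split_ifs with h
  · refine le_trans (eLpNorm_mono_enorm
      (g := carlesonFunction ν ω q f + carlesonFunction ν ω q g) fun ζ => ?_) ?_
    · simpa using carlesonFunction_add_le ν ω hq h.2 hf hg ζ
    · simpa only [eLpNorm_exponent_top] using eLpNormEssSup_add_le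
  · refine le_trans (eLpNorm_mono_enorm
      (g := areaFunction ν q f + areaFunction ν q g) fun ζ => ?_) (eLpNorm_add_le ?_ ?_ hp)
    · simpa using areaFunction_add_le ν hq hf hg ζ
    · exact (measurable_areaFunction ν hq hf).aestronglyMeasurable
    · exact (measurable_areaFunction ν hq hg).aestronglyMeasurable

lemma tentENorm_smul_le (ν : Measure Disc) (ω : ℂ → ℝ) (p : ℝ≥0∞) {q : ℝ≥0∞} (hq : 1 ≤ q)
    (c : ℂ) (f : Disc → ℂ) : tentENorm ν ω p q (c • f) ≤ ‖c‖ₑ * tentENorm ν ω p q f := by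
  unfold tentENorm
  split_ifs with h
  · refine eLpNorm_le_nnreal_smul_eLpNorm_of_ae_le_mul' (c := ‖c‖₊) (Eventually.of_forall
      fun ζ => ?_) _
    simp only [enorm_eq_self]
    rw [carlesonFunction_eq ν ω hq h.2, carlesonFunction_eq ν ω hq h.2]
    refine iSup₂_le fun a ha => ?_
    have e : eLpNorm (fun z => ‖(c • f) z‖ₑ * tentMass ω z ^ (1 / q.toReal)) q
        (ν.restrict (tent a)) ≤ ‖c‖ₑ * eLpNorm (fun z => ‖f z‖ₑ * tentMass ω z ^ (1 / q.toReal)) q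
        (ν.restrict (tent a)) := by
      refine eLpNorm_le_nnreal_smul_eLpNorm_of_ae_le_mul' (c := ‖c‖₊) (Eventually.of_forall
        fun z => ?_) _
      simp [mul_assoc, enorm_eq_nnnorm]
    refine (mul_le_mul_right e _).trans ?_
    rw [mul_left_comm]
    refine mul_le_mul_right ?_ _
    exact le_iSup₂ (f := fun a (_ : a ∈ lens ζ) => ((tentMass ω a)⁻¹) ^ (1 / q.toReal) *
      eLpNorm (fun z => ‖f z‖ₑ * tentMass ω z ^ (1 / q.toReal)) q (ν.restrict (tent a))) a ha
  · refine eLpNorm_le_nnreal_smul_eLpNorm_of_ae_le_mul' (c := ‖c‖₊) (Eventually.of_forall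
      fun ζ => ?_) _
    simpa only [enorm_eq_self] using! eLpNorm_const_smul_le (c := c) (f := f) (p := q) (μ := ν.restrict (lens ζ))

lemma tentENorm_zero (ν : Measure Disc) (ω : ℂ → ℝ) (p : ℝ≥0∞) {q : ℝ≥0∞} (hq : 1 ≤ q) :
    tentENorm ν ω p q 0 = 0 := by
  have := tentENorm_smul_le ν ω p hq 0 0
  simpa using this

/-! ### The tent spaces -/

/-- The tent space `T^p_q(ν, ω)` (`1 ≤ p, q ≤ ∞`): the `ν`-equivalence classes of `ν`-measurable
functions on the disc with finite norm. -/
def TentSpace (ν : Measure Disc) [SFinite ν] (ω : ℂ → ℝ) (p q : ℝ≥0∞)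
    [hp : Fact (1 ≤ p)] [hq : Fact (1 ≤ q)] : Submodule ℂ (Disc →ₘ[ν] ℂ) where
  carrier := {f | tentENorm ν ω p q f < ∞}
  zero_mem' := by
    simp only [Set.mem_ofPred_eq]
    rw [tentENorm_congr ω p q (AEEqFun.coeFn_zero (β := ℂ)), tentENorm_zero ν ω p hq.out]
    exact ENNReal.zero_lt_top
  add_mem' := by
    intro f g hf hg
    simp only [Set.mem_ofPred_eq] at *
    rw [tentENorm_congr ω p q (AEEqFun.coeFn_add f g)]
    exact (tentENorm_add_le ν ω hp.out hq.out (AEEqFun.measurable f)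
      (AEEqFun.measurable g)).trans_lt (ENNReal.add_lt_top.2 ⟨hf, hg⟩)
  smul_mem' := by
    intro c f hf
    simp only [Set.mem_ofPred_eq] at *
    rw [tentENorm_congr ω p q (AEEqFun.coeFn_smul c f)]
    exact (tentENorm_smul_le ν ω p hq.out c f).trans_lt (ENNReal.mul_lt_top enorm_lt_top hf)

variable (ν : Measure Disc) [SFinite ν] (ω : ℂ → ℝ) (p q : ℝ≥0∞)
  [hp : Fact (1 ≤ p)] [hq : Fact (1 ≤ q)]

/-- The norm of the tent space as a seminorm on the space of classes of finite norm
(it vanishes only at `0` for the weights considered here). -/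
def tentSeminorm : Seminorm ℂ (TentSpace ν ω p q) :=
  Seminorm.ofSMulLE (fun f => (tentENorm ν ω p q (f : Disc →ₘ[ν] ℂ)).toReal)
    (by
      show (tentENorm ν ω p q ((0 : Disc →ₘ[ν] ℂ) : Disc → ℂ)).toReal = 0
      rw [tentENorm_congr ω p q (AEEqFun.coeFn_zero (β := ℂ)), tentENorm_zero ν ω p hq.out]
      rfl)
    (by
      intro f g
      have hf : tentENorm ν ω p q (f : Disc →ₘ[ν] ℂ) < ∞ := f.2
      have hg : tentENorm ν ω p q (g : Disc →ₘ[ν] ℂ) < ∞ := g.2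
      rw [← ENNReal.toReal_add hf.ne hg.ne]
      refine ENNReal.toReal_mono (ENNReal.add_lt_top.2 ⟨hf, hg⟩).ne ?_
      rw [Submodule.coe_add, tentENorm_congr ω p q (AEEqFun.coeFn_add _ _)]
      exact tentENorm_add_le ν ω hp.out hq.out (AEEqFun.measurable _) (AEEqFun.measurable _))
    (by
      intro c f
      have hf : tentENorm ν ω p q (f : Disc →ₘ[ν] ℂ) < ∞ := f.2
      rw [← toReal_enorm c, ← ENNReal.toReal_mul]
      refine ENNReal.toReal_mono (ENNReal.mul_lt_top enorm_lt_top hf).ne ?_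
      rw [Submodule.coe_smul, tentENorm_congr ω p q (AEEqFun.coeFn_smul _ _)]
      exact tentENorm_smul_le ν ω p hq.out c _)

instance : SeminormedAddCommGroup (TentSpace ν ω p q) :=
  (tentSeminorm ν ω p q).toAddGroupSeminorm.toSeminormedAddCommGroup

instance : NormedSpace ℂ (TentSpace ν ω p q) where
  norm_smul_le c f := (map_smul_eq_mul (tentSeminorm ν ω p q) c f).le

lemma TentSpace.norm_def (f : TentSpace ν ω p q) :
    ‖f‖ = (tentENorm ν ω p q (f : Disc →ₘ[ν] ℂ)).toReal := rfl

end

end TentDuality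

/-! ### Radial weights in polar coordinates -/

namespace TentDuality

/-! The geometry enters only through `TentControl`. If `w` lies in the tent of `a`, then the tent of
`w` lies in a tent of doubled aperture over `a`, of mass comparable with ω(T(a)). Every `z` has a
parent `a` of comparable tent mass such that T(a) contains all `w` with 1 - |w| ≤ 2(1 - |z|) whose
tents meet T(z). Both come from the triangle inequality for angles; doubling controls the masses,
because ω(T(z)) is a radial integral comparable with (1 - |z|) times the tail integral.

By Tonelli (`lintegral_lens_swap`), integrating h(z) ω(T(z)) against ν is comparable with
integrating h over the lenses and then over the disc. For p < ∞ the tent space thus sits in the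
mixed space L^p(ω; L^q(ν)) as the functions f(z) on {z ∈ Γ(ζ)}, and averaging over tents
(`tentAverage`) leads back to functions of `z`.

The pairing is bounded for p > 1 by two applications of Hölder. For p = 1 the second factor has only
a Carleson bound, and a stopping argument replaces Hölder: by the Carleson bound over the parent and
Chebyshev's inequality, for at least half of the mass of T(z) the integral of |g|^{q'} over the part
of Γ(ζ) with modulus at least |z| is at most a constant times the q'-th power of the norm
(`tentMass_le_two_mul`). Restricting to such pairs (ζ, z) costs a factor 2 and bounds the L^{q'}
norm of `g` on each lens (`pairing_le_of_eq_one`).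

Conversely, let `g` satisfy `TestBound`. Testing on the tent average of a function F(ζ, z) bounds
the mixed pairing of F with `g` (`TestBound.lintegral_mul_le`); F is chosen extremal for the norm of
`g`. The averages of F are controlled by the maximal function over tents, which is bounded on L^s
for s > 1 by Vitali covering and interpolation (`TentControl.strong_type`). For q = 1 the extremal
function is replaced by a normalized indicator of the set where |g| is nearly its supremum over the
lens. For p = 1 the test function is g^{q'-1} restricted to one tent. Truncation and monotone
convergence remove the finiteness assumptions (`TentControl.exists_tentENorm_le`).

Finally, a continuous functional is represented by Radon–Nikodym, after multiplication by a positive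
function of finite tent norm (`exists_density`). The density satisfies the test bound
(`testBound_of_representation`), so it gives an element of the dual tent space. The same test bound
yields the lower norm estimate and injectivity. -/

lemma measurableEmbedding_disc : MeasurableEmbedding ((↑) : Disc → ℂ) :=
  MeasurableEmbedding.subtype_coe Metric.isOpen_ball.measurableSet

/-- A null set for the area of the plane is null in polar coordinates. -/
lemma ae_polarCoord_symm_notMem {N : Set ℂ} (hN : MeasurableSet N) (h0 : volume N = 0) :
    ∀ᵐ p ∂((volume.restrict (Set.Ioi (0 : ℝ))).prod
      (volume.restrict (Set.Ioo (-Real.pi) Real.pi))), Complex.polarCoord.symm p ∉ N := by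
  have hm : Measurable fun p : ℝ × ℝ => (Complex.polarCoord.symm p : ℂ) := by
    simp only [Complex.polarCoord_symm_apply]
    fun_prop
  have h := Complex.lintegral_comp_polarCoord_symm (N.indicator 1)
  rw [lintegral_indicator_one hN, h0, lintegral_eq_zero_iff] at h
  · rw [polarCoord_target] at h
    have ht : ∀ᵐ p ∂((volume : Measure (ℝ × ℝ)).restrict
        (Set.Ioi (0 : ℝ) ×ˢ Set.Ioo (-Real.pi) Real.pi)),
        p ∈ (Set.Ioi (0 : ℝ) ×ˢ Set.Ioo (-Real.pi) Real.pi) :=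
      ae_restrict_mem (measurableSet_Ioi.prod measurableSet_Ioo)
    rw [Measure.prod_restrict, ← Measure.volume_eq_prod]
    filter_upwards [h, ht] with p hp hpt hpN
    have h1 : (0 : ℝ) < p.1 := hpt.1
    simp only [Set.indicator_of_mem hpN, Pi.one_apply, smul_eq_mul, mul_one, Pi.zero_apply,
      ENNReal.ofReal_eq_zero, not_le.2 h1] at hp
  · simp only [smul_eq_mul]
    exact (measurable_fst.ennreal_ofReal).mul ((measurable_one.indicator hN).comp hm)

/-- The weight is measurable only up to an area-null set, which might contain a given ray. By Fubini
in polar coordinates almost every ray meets the exceptional set in a null set of radii; restricting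
a Borel version to one such ray and using radiality gives the profile. -/
lemma DoublingRadialWeight.exists_profile {ω : ℂ → ℝ} (hω : DoublingRadialWeight ω) :
    ∃ ρ : ℝ → ℝ≥0∞, Measurable ρ ∧
      ∀ᵐ s : ℝ, s ∈ Set.Ioo (0 : ℝ) 1 → ENNReal.ofReal (ω (s : ℂ)) = ρ s := by
  obtain ⟨g, hg, hωg⟩ := hω.integrable.aestronglyMeasurable
  obtain ⟨G, hG, hGg⟩ := measurableEmbedding_disc.exists_measurable_extend hg.measurable
    (fun _ => ⟨0⟩)
  have hN : area {z : Disc | ¬ ω z = g z} = 0 := hωg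
  set N := toMeasurable area {z : Disc | ¬ ω z = g z} with hNdef
  have hNm : MeasurableSet ((↑) '' N : Set ℂ) :=
    measurableEmbedding_disc.measurableSet_image.2 (measurableSet_toMeasurable _ _)
  have hN0 : volume ((↑) '' N : Set ℂ) = 0 := by
    have : area N = 0 := by rw [hNdef, measure_toMeasurable, hN]
    rw [area, Measure.smul_apply, measurableEmbedding_disc.comap_apply, smul_eq_mul] at this
    simpa using this
  have key := ae_polarCoord_symm_notMem hNm hN0
  have hm : Measurable fun p : ℝ × ℝ => (Complex.polarCoord.symm p : ℂ) := by
    simp only [Complex.polarCoord_symm_apply]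
    fun_prop
  have key2 := Measure.ae_ae_of_ae_prod key
  rw [Measure.ae_ae_comm (p := fun r θ => (Complex.polarCoord.symm (r, θ) : ℂ) ∉ ((↑) '' N : Set ℂ))
    (hm hNm).compl] at key2
  have hne : (ae (volume.restrict (Set.Ioo (-Real.pi) Real.pi))).NeBot := by
    rw [ae_neBot, Ne, Measure.restrict_eq_zero, Real.volume_Ioo]
    simp [Real.pi_pos]
  obtain ⟨θ, hθ⟩ := key2.exists
  refine ⟨fun s => ENNReal.ofReal (G (Complex.polarCoord.symm (s, θ))), ?_, ?_⟩
  · exact (hG.comp (hm.comp measurable_prodMk_right)).ennreal_ofReal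
  · rw [ae_restrict_iff' measurableSet_Ioi] at hθ
    filter_upwards [hθ] with s hs hs01
    have hn : ‖(Complex.polarCoord.symm (s, θ) : ℂ)‖ = s := by
      rw [Complex.norm_polarCoord_symm]; exact abs_of_pos hs01.1
    have hlt : ‖(Complex.polarCoord.symm (s, θ) : ℂ)‖ < 1 := hn.trans_lt hs01.2
    set z : Disc := ⟨Complex.polarCoord.symm (s, θ), by simpa using hlt⟩ with hz
    have hzN : z ∉ N := fun h => hs hs01.1 ⟨z, h, rfl⟩
    have h1 : ω z = g z := by
      by_contra h
      exact hzN (subset_toMeasurable _ _ h)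
    have h2 : G (z : ℂ) = g z := congrFun hGg z
    have h3 : ω z = ω (s : ℂ) := by
      rw [hω.radial z hlt]; congr 2
    rw [← h3, h1, ← h2]

/-- A rotation brings the axis `u` to the positive real axis, and polar coordinates do the rest. The
aperture is an arbitrary function of the modulus, so that tents, wide tents and the whole disc are
all covered. -/
lemma weightMeasure_sector {ω : ℂ → ℝ} (hω : DoublingRadialWeight ω) {ρ : ℝ → ℝ≥0∞}
    (hρ : Measurable ρ)
    (hωρ : ∀ᵐ s : ℝ, s ∈ Set.Ioo (0 : ℝ) 1 → ENNReal.ofReal (ω (s : ℂ)) = ρ s)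
    {φ : ℝ → ℝ} (hφ : Measurable φ) {u : ℂ} (hu : ‖u‖ = 1) :
    weightMeasure ω {ζ : Disc | (ζ : ℂ) ≠ 0 ∧ |Complex.arg (ζ / u)| < φ ‖(ζ : ℂ)‖}
      = (ENNReal.ofReal Real.pi)⁻¹ * ∫⁻ r in Set.Ioo (0 : ℝ) 1,
        ENNReal.ofReal r * ρ r * volume (Set.Ioo (-Real.pi) Real.pi ∩ Set.Ioo (-φ r) (φ r)) := by
  have hu0 : u ≠ 0 := by rintro rfl; simp at hu
  set S : Set ℂ := {ζ : ℂ | ζ ≠ 0 ∧ |Complex.arg (ζ / u)| < φ ‖ζ‖} with hS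
  have hSm : MeasurableSet S := by
    refine (measurableSet_singleton (0 : ℂ)).compl.inter
      (s₂ := {ζ : ℂ | |Complex.arg (ζ / u)| < φ ‖ζ‖}) (measurableSet_lt ?_ ?_)
    · exact continuous_abs.measurable.comp (Complex.measurable_arg.comp (measurable_id.div_const u))
    · exact hφ.comp measurable_norm
  have hpre : {ζ : Disc | (ζ : ℂ) ≠ 0 ∧ |Complex.arg (ζ / u)| < φ ‖(ζ : ℂ)‖}
      = (↑) ⁻¹' S := rfl
  set F : ℂ → ℝ≥0∞ := (Metric.ball 0 1 ∩ S).indicator (fun z => ENNReal.ofReal (ω z)) with hF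
  have e1 : weightMeasure ω ((↑) ⁻¹' S) = (ENNReal.ofReal Real.pi)⁻¹ * ∫⁻ z, F z := by
    rw [weightMeasure, withDensity_apply _ (measurable_subtype_coe hSm), area,
      Measure.restrict_smul, lintegral_smul_measure, smul_eq_mul]
    congr 1
    rw [hF, ← lintegral_indicator (measurable_subtype_coe hSm), ← Set.indicator_indicator,
      lintegral_indicator Metric.isOpen_ball.measurableSet,
      ← lintegral_subtype_comap Metric.isOpen_ball.measurableSet]
    rfl
  have e2 : ∫⁻ z, F z = ∫⁻ z, F (u * z) := by
    let R := rotation (⟨u, by simp [Submonoid.unitSphere, hu]⟩ : Circle)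
    rw [← R.measurePreserving.lintegral_comp_emb R.toHomeomorph.measurableEmbedding F]
    rfl
  rw [hpre, e1, e2, ← Complex.lintegral_comp_polarCoord_symm]
  congr 1
  have hprod : (volume : Measure (ℝ × ℝ)).restrict polarCoord.target
      = (volume.restrict (Set.Ioi (0 : ℝ))).prod
      (volume.restrict (Set.Ioo (-Real.pi) Real.pi)) := by
    rw [polarCoord_target, Measure.prod_restrict, Measure.volume_eq_prod]
  set V : Set (ℝ × ℝ) := {p | p.1 < 1 ∧ |p.2| < φ p.1} with hV
  have hVm : MeasurableSet V :=
    (measurableSet_lt measurable_fst measurable_const).inter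
      (measurableSet_lt measurable_snd.abs (hφ.comp measurable_fst))
  have e3 : ∫⁻ p in polarCoord.target,
      ENNReal.ofReal p.1 • F (u * Complex.polarCoord.symm p)
      = ∫⁻ p in polarCoord.target,
        V.indicator (fun p => ENNReal.ofReal p.1 * ρ p.1) p := by
    refine lintegral_congr_ae ?_
    have h1 : ∀ᵐ p : ℝ × ℝ, p.1 ∈ Set.Ioo (0 : ℝ) 1 → ENNReal.ofReal (ω (p.1 : ℂ)) = ρ p.1 :=
      Measure.quasiMeasurePreserving_fst.ae hωρ
    filter_upwards [ae_restrict_of_ae h1, ae_restrict_mem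
      polarCoord.open_target.measurableSet] with p hp hpt
    rw [polarCoord_target] at hpt
    have hp1 : (0 : ℝ) < p.1 := hpt.1
    have hn : ‖(Complex.polarCoord.symm p : ℂ)‖ = p.1 := by
      rw [Complex.norm_polarCoord_symm]; exact abs_of_pos hp1
    have hn' : ‖u * (Complex.polarCoord.symm p : ℂ)‖ = p.1 := by
      rw [norm_mul, hu, one_mul, hn]
    have harg : Complex.arg (u * Complex.polarCoord.symm p / u) = p.2 := by
      rw [mul_div_cancel_left₀ _ hu0, Complex.polarCoord_symm_apply]
      simpa using Complex.arg_mul_cos_add_sin_mul_I hp1 ⟨hpt.2.1, hpt.2.2.le⟩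
    have hne : u * (Complex.polarCoord.symm p : ℂ) ≠ 0 := by
      rw [← norm_pos_iff, hn']; exact hp1
    have hiff : u * (Complex.polarCoord.symm p : ℂ) ∈ Metric.ball 0 1 ∩ S ↔ p ∈ V := by
      simp only [hS, hV, Set.mem_inter_iff, Set.mem_ofPred_eq, mem_ball_zero_iff, hn', harg]
      tauto
    by_cases hpV : p ∈ V
    · rw [Set.indicator_of_mem hpV, hF, Set.indicator_of_mem (hiff.2 hpV), smul_eq_mul,
        ← hp ⟨hp1, hpV.1⟩, hω.radial _ (hn'.trans_lt hpV.1), hn']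
    · rw [Set.indicator_of_notMem hpV, hF, Set.indicator_of_notMem (mt hiff.1 hpV), smul_zero]
  rw [e3, hprod, lintegral_prod]
  · rw [← lintegral_indicator measurableSet_Ioi, ← lintegral_indicator measurableSet_Ioo]
    refine lintegral_congr fun r => ?_
    by_cases h0 : 0 < r
    · by_cases h1 : r < 1
      · rw [Set.indicator_of_mem (show r ∈ Set.Ioi (0 : ℝ) from h0),
          Set.indicator_of_mem (show r ∈ Set.Ioo (0 : ℝ) 1 from ⟨h0, h1⟩)]
        have : ∀ θ : ℝ, V.indicator (fun p => ENNReal.ofReal p.1 * ρ p.1) (r, θ)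
            = (Set.Ioo (-φ r) (φ r)).indicator (fun _ => ENNReal.ofReal r * ρ r) θ := by
          intro θ
          have : (r, θ) ∈ V ↔ θ ∈ Set.Ioo (-φ r) (φ r) := by
            simp [hV, h1, abs_lt]
          by_cases h : (r, θ) ∈ V
          · rw [Set.indicator_of_mem h, Set.indicator_of_mem (this.1 h)]
          · rw [Set.indicator_of_notMem h, Set.indicator_of_notMem (mt this.2 h)]
        simp only [this]
        rw [lintegral_indicator_const measurableSet_Ioo, Measure.restrict_apply measurableSet_Ioo,
          Set.inter_comm]
      · rw [Set.indicator_of_mem (show r ∈ Set.Ioi (0 : ℝ) from h0),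
          Set.indicator_of_notMem (fun h => h1 h.2)]
        have : ∀ θ : ℝ, V.indicator (fun p => ENNReal.ofReal p.1 * ρ p.1) (r, θ) = 0 :=
          fun θ => Set.indicator_of_notMem (fun h => h1 h.1) _
        simp [this]
    · rw [Set.indicator_of_notMem (show r ∉ Set.Ioi (0 : ℝ) from h0),
        Set.indicator_of_notMem (fun h => h0 h.1)]
  · exact ((measurable_fst.ennreal_ofReal.mul (hρ.comp measurable_fst)).indicator hVm).aemeasurable

end TentDuality

/-! ### Angles, tents and their masses -/

namespace TentDuality
open InnerProductGeometry (angle)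

lemma coe_eq_zero_iff {z : Disc} : (z : ℂ) = 0 ↔ z = origin :=
  ⟨fun h => Subtype.ext h, fun h => by rw [h]; rfl⟩

lemma norm_lt_one (z : Disc) : ‖(z : ℂ)‖ < 1 := mem_ball_zero_iff.1 z.2

lemma tent_origin : tent origin = Set.univ := by
  ext ζ
  simp only [tent, lens, Set.mem_ofPred_eq, Set.mem_univ, iff_true]
  by_cases h : ζ = origin
  · exact Or.inl (by simpa using h)
  · refine Or.inr ⟨h, ?_⟩
    simp [show ((origin : Disc) : ℂ) = 0 from rfl]

lemma mem_tent_iff {z : Disc} (hz : z ≠ origin) {ζ : Disc} :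
    ζ ∈ tent z ↔ (ζ : ℂ) ≠ 0 ∧ angle (ζ : ℂ) z < (1 - ‖(z : ℂ)‖ / ‖(ζ : ℂ)‖) / 2 := by
  have hz0 : (z : ℂ) ≠ 0 := fun h => hz (coe_eq_zero_iff.1 h)
  simp only [tent, lens, Set.mem_ofPred_eq, Ne, ← coe_eq_zero_iff, hz0, and_false, false_or]
  refine and_congr_right fun hζ => ?_
  rw [InnerProductGeometry.angle_comm, Complex.angle_eq_abs_arg hz0 hζ]

lemma norm_lt_of_mem_tent {z ζ : Disc} (h : ζ ∈ tent z) (hz : z ≠ origin) :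
    ‖(z : ℂ)‖ < ‖(ζ : ℂ)‖ := by
  obtain ⟨h0, h1⟩ := (mem_tent_iff hz).1 h
  have h2 := InnerProductGeometry.angle_nonneg (ζ : ℂ) (z : ℂ)
  have h3 : ‖(z : ℂ)‖ / ‖(ζ : ℂ)‖ < 1 := by linarith
  exact (div_lt_one (norm_pos_iff.2 h0)).1 h3

/-- Openness makes the maximal function measurable, its superlevel sets being unions of tents, and
makes disjoint families of tents countable. -/
lemma isOpen_tent (z : Disc) : IsOpen (tent z) := by
  by_cases hz : z = origin
  · rw [hz, tent_origin]; exact isOpen_univ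
  have hz0 : (z : ℂ) ≠ 0 := fun h => hz (coe_eq_zero_iff.1 h)
  have : tent z = {ζ : Disc | (ζ : ℂ) ≠ 0} ∩
      {ζ | angle (ζ : ℂ) z < (1 - ‖(z : ℂ)‖ / ‖(ζ : ℂ)‖) / 2} := by
    ext ζ; exact mem_tent_iff hz
  rw [this, isOpen_iff_mem_nhds]
  rintro ζ ⟨h0, h1⟩
  refine inter_mem ((isOpen_ne.preimage continuous_subtype_val).mem_nhds h0) ?_
  have c1 : ContinuousAt (fun ζ : Disc => angle (ζ : ℂ) z) ζ :=
    (InnerProductGeometry.continuousAt_angle (x := ((ζ : ℂ), (z : ℂ))) h0 hz0).comp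
      (f := fun ζ : Disc => ((ζ : ℂ), (z : ℂ))) (by fun_prop)
  have c2 : ContinuousAt (fun ζ : Disc => (1 - ‖(z : ℂ)‖ / ‖(ζ : ℂ)‖) / 2) ζ := by
    have : ContinuousAt (fun ζ : Disc => ‖(ζ : ℂ)‖) ζ := by fun_prop
    exact (continuousAt_const.sub (continuousAt_const.div this (norm_ne_zero_iff.2 h0))).div_const 2
  exact c1.eventually_lt c2 h1

/-- The double of the tent `T(a)`: twice the angular aperture at each radius. -/
def wideTent (a : Disc) : Set Disc :=
  if a = origin then Set.univ
  else {ζ | (ζ : ℂ) ≠ 0 ∧ |Complex.arg (ζ / (a / ‖(a : ℂ)‖))| < 1 - ‖(a : ℂ)‖ / ‖(ζ : ℂ)‖}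

lemma abs_arg_div_normalize {ζ a : ℂ} (hζ : ζ ≠ 0) (ha : a ≠ 0) :
    |Complex.arg (ζ / (a / ‖a‖))| = angle ζ a := by
  rw [Complex.angle_eq_abs_arg hζ ha, ← Complex.arg_real_mul (ζ / a) (norm_pos_iff.2 ha)]
  congr 2
  field_simp

/-- The two half apertures (1 - |w|/|ζ|)/2 and (1 - |a|/|w|)/2 add up by the triangle inequality for
angles. Since |a| ≤ |w| ≤ |ζ|, each is at most (1 - |a|/|ζ|)/2, so doubling the aperture suffices.
-/
lemma tent_subset_wideTent {a w : Disc} (hw : w ∈ tent a) : tent w ⊆ wideTent a := by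
  by_cases ha : a = origin
  · simp [wideTent, ha]
  have ha0 : (a : ℂ) ≠ 0 := fun h => ha (coe_eq_zero_iff.1 h)
  intro ζ hζ
  have hw0 := ((mem_tent_iff ha).1 hw).1
  have hw' : w ≠ origin := fun h => hw0 (coe_eq_zero_iff.2 h)
  obtain ⟨hζ0, h1⟩ := (mem_tent_iff hw').1 hζ
  have h2 := ((mem_tent_iff ha).1 hw).2
  rw [wideTent, if_neg ha]
  refine ⟨hζ0, ?_⟩
  rw [abs_arg_div_normalize hζ0 ha0]
  have h3 := InnerProductGeometry.angle_le_angle_add_angle (ζ : ℂ) w a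
  have hwζ := norm_lt_of_mem_tent hζ hw'
  have pa := norm_pos_iff.2 ha0
  have pw := norm_pos_iff.2 hw0
  have pζ := norm_pos_iff.2 hζ0
  have haw := norm_lt_of_mem_tent hw ha
  have h4 : ‖(a : ℂ)‖ / ‖(ζ : ℂ)‖ ≤ ‖(w : ℂ)‖ / ‖(ζ : ℂ)‖ := by gcongr
  have h5 : ‖(a : ℂ)‖ / ‖(ζ : ℂ)‖ ≤ ‖(a : ℂ)‖ / ‖(w : ℂ)‖ := by gcongr
  linarith

lemma measurableSet_wideTent (a : Disc) : MeasurableSet (wideTent a) := by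
  unfold wideTent
  split_ifs with h
  · exact MeasurableSet.univ
  · refine MeasurableSet.inter (s₁ := {ζ : Disc | (ζ : ℂ) ≠ 0})
      (s₂ := {ζ : Disc | |Complex.arg (ζ / (a / ‖(a : ℂ)‖))| < 1 - ‖(a : ℂ)‖ / ‖(ζ : ℂ)‖})
      (measurable_subtype_coe (measurableSet_singleton (0 : ℂ)).compl) (measurableSet_lt ?_ ?_)
    · exact continuous_abs.measurable.comp
        (Complex.measurable_arg.comp (measurable_subtype_coe.div_const _))
    · exact measurable_const.sub (measurable_const.div measurable_subtype_coe.norm)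

/-- The mass of a tent whose vertex has modulus `r`, in terms of the radial profile. -/
noncomputable def radialMass (ρ : ℝ → ℝ≥0∞) (r : ℝ) : ℝ≥0∞ :=
  (ENNReal.ofReal Real.pi)⁻¹ * ∫⁻ s in Set.Ioo (0 : ℝ) 1, ENNReal.ofReal (s - r) * ρ s

/-- At radius s the arc has angular length 2c(1 - r/s), and the Jacobian s turns this into 2c(s -
r). The bound c ≤ π prevents the arc from wrapping around; `ENNReal.ofReal` discards the radii s <
r. -/
lemma weightMeasure_sector_of_le_pi {ω : ℂ → ℝ} (hω : DoublingRadialWeight ω) {ρ : ℝ → ℝ≥0∞} (hρ : Measurable ρ)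
    (hωρ : ∀ᵐ s : ℝ, s ∈ Set.Ioo (0 : ℝ) 1 → ENNReal.ofReal (ω (s : ℂ)) = ρ s)
    {c r : ℝ} (hc : 0 ≤ c) (hcπ : c ≤ Real.pi) (hr : 0 ≤ r)
    {u : ℂ} (hu : ‖u‖ = 1) :
    weightMeasure ω {ζ : Disc | (ζ : ℂ) ≠ 0 ∧ |Complex.arg (ζ / u)| < c * (1 - r / ‖(ζ : ℂ)‖)}
      = ENNReal.ofReal (2 * c) * radialMass ρ r := by
  have hφ : Measurable fun s : ℝ => c * (1 - r / s) := by fun_prop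
  rw [weightMeasure_sector hω hρ hωρ hφ hu, radialMass, mul_left_comm,
    ← lintegral_const_mul' _ _ ENNReal.ofReal_ne_top]
  congr 1
  refine setLIntegral_congr_fun measurableSet_Ioo fun s hs => ?_
  have h1 : c * (1 - r / s) ≤ Real.pi := by
    have : r / s ≥ 0 := div_nonneg hr hs.1.le
    nlinarith
  rw [Set.inter_eq_right.2 (Set.Ioo_subset_Ioo (neg_le_neg h1) h1), Real.volume_Ioo, mul_right_comm,
    ← ENNReal.ofReal_mul hs.1.le, ← mul_assoc, ← ENNReal.ofReal_mul (by positivity)]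
  congr 2
  have := hs.1.ne'
  field_simp
  ring

lemma norm_normalize {a : Disc} (ha : a ≠ origin) : ‖(a : ℂ) / ‖(a : ℂ)‖‖ = 1 := by
  have ha0 : ‖(a : ℂ)‖ ≠ 0 := norm_ne_zero_iff.2 fun h => ha (coe_eq_zero_iff.1 h)
  simp [ha0]

lemma weightMeasure_tent {ω : ℂ → ℝ} (hω : DoublingRadialWeight ω) {ρ : ℝ → ℝ≥0∞} (hρ : Measurable ρ)
    (hωρ : ∀ᵐ s : ℝ, s ∈ Set.Ioo (0 : ℝ) 1 → ENNReal.ofReal (ω (s : ℂ)) = ρ s)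
    {a : Disc} (ha : a ≠ origin) :
    weightMeasure ω (tent a) = radialMass ρ ‖(a : ℂ)‖ := by
  have ha0 : (a : ℂ) ≠ 0 := fun h => ha (coe_eq_zero_iff.1 h)
  have h := weightMeasure_sector_of_le_pi hω hρ hωρ (c := 1 / 2) (by norm_num)
    (by linarith [Real.pi_gt_three]) (norm_nonneg (a : ℂ)) (norm_normalize ha)
  rw [show (2 * (1 / 2) : ℝ) = 1 by norm_num, ENNReal.ofReal_one, one_mul] at h
  rw [← h]
  congr 1
  ext ζ
  rw [mem_tent_iff ha]
  refine and_congr_right fun hζ => ?_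
  rw [abs_arg_div_normalize hζ ha0, one_div, ← div_eq_inv_mul]

lemma weightMeasure_wideTent {ω : ℂ → ℝ} (hω : DoublingRadialWeight ω) {ρ : ℝ → ℝ≥0∞} (hρ : Measurable ρ)
    (hωρ : ∀ᵐ s : ℝ, s ∈ Set.Ioo (0 : ℝ) 1 → ENNReal.ofReal (ω (s : ℂ)) = ρ s)
    {a : Disc} (ha : a ≠ origin) :
    weightMeasure ω (wideTent a) = 2 * radialMass ρ ‖(a : ℂ)‖ := by
  have h := weightMeasure_sector_of_le_pi hω hρ hωρ (c := 1) (by norm_num)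
    (by linarith [Real.pi_gt_three]) (norm_nonneg (a : ℂ)) (norm_normalize ha)
  simpa [wideTent, ha] using h

/-- Up to the origin, the disc is a sector of constant aperture 4 > π. The estimate serves as the
wide-tent bound at the origin, where `wideTent` is everything but `tentMass` is only a limit of
masses of proper tents. -/
lemma weightMeasure_univ_le {ω : ℂ → ℝ} (hω : DoublingRadialWeight ω) {ρ : ℝ → ℝ≥0∞} (hρ : Measurable ρ)
    (hωρ : ∀ᵐ s : ℝ, s ∈ Set.Ioo (0 : ℝ) 1 → ENNReal.ofReal (ω (s : ℂ)) = ρ s) :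
    weightMeasure ω Set.univ ≤ ENNReal.ofReal (2 * Real.pi) * radialMass ρ 0 := by
  have h0 : area {origin} = 0 := by
    rw [area, Measure.smul_apply, measurableEmbedding_disc.comap_apply, Set.image_singleton]
    simp
  have hne : ∀ᵐ ζ ∂weightMeasure ω, ζ ≠ origin :=
    (withDensity_absolutelyContinuous area _).ae_le (compl_mem_ae_iff.2 h0)
  have h := weightMeasure_sector hω hρ hωρ (measurable_const (a := (4 : ℝ))) (norm_one (α := ℂ))
  calc weightMeasure ω Set.univ
      ≤ weightMeasure ω {ζ : Disc | (ζ : ℂ) ≠ 0 ∧ |Complex.arg (ζ / 1)| < 4} := by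
        refine measure_mono_ae ?_
        filter_upwards [hne] with ζ hζ _
        exact ⟨fun h => hζ (coe_eq_zero_iff.1 h),
          (Complex.abs_arg_le_pi _).trans_lt Real.pi_lt_four⟩
    _ ≤ _ := by
        rw [h, radialMass, mul_left_comm, ← lintegral_const_mul' _ _ ENNReal.ofReal_ne_top]
        refine mul_le_mul_right (lintegral_mono fun s => ?_) _
        rw [sub_zero, mul_comm]
        refine mul_le_mul_left ?_ _
        refine (measure_mono Set.inter_subset_left).trans ?_
        rw [Real.volume_Ioo]
        exact ENNReal.ofReal_le_ofReal (by linarith)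

end TentDuality

/-! ### Doubling of tent masses and the parent of a point -/

namespace TentDuality
open InnerProductGeometry (angle)

lemma DoublingRadialWeight.isFiniteMeasure {ω : ℂ → ℝ} (hω : DoublingRadialWeight ω) :
    IsFiniteMeasure (weightMeasure ω) := by
  constructor
  rw [weightMeasure, withDensity_apply _ MeasurableSet.univ, Measure.restrict_univ]
  exact (lintegral_mono fun z => Real.ofReal_le_enorm _).trans_lt hω.integrable.2

lemma radialMass_anti (ρ : ℝ → ℝ≥0∞) : Antitone (radialMass ρ) := fun r r' h =>
  mul_le_mul_right (lintegral_mono fun s =>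
    mul_le_mul_left (ENNReal.ofReal_le_ofReal (by linarith)) _) _

lemma exists_mem_disc_norm_eq {r : ℝ} (h0 : 0 ≤ r) (h1 : r < 1) : ‖(realPoint r : ℂ)‖ = r := by
  have : (r : ℂ) ∈ Metric.ball (0 : ℂ) 1 := by simpa [abs_of_nonneg h0] using h1
  simp [realPoint, abs_of_nonneg h0, h1]

lemma tail_eq_profile {ω : ℂ → ℝ} {ρ : ℝ → ℝ≥0∞}
    (hωρ : ∀ᵐ s : ℝ, s ∈ Set.Ioo (0 : ℝ) 1 → ENNReal.ofReal (ω (s : ℂ)) = ρ s) {r : ℝ}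
    (hr : 0 ≤ r) : tail ω r = ∫⁻ s in Set.Ioo r 1, ρ s :=
  setLIntegral_congr_fun_ae measurableSet_Ioo (by
    filter_upwards [hωρ] with s hs h using hs ⟨hr.trans_lt h.1, h.2⟩)

/-- On s > t the factor s - r is at least t - r. Together with `radialMass_le` this transfers
positivity and doubling from the tail integral to the masses of tents. -/
lemma le_radialMass (ρ : ℝ → ℝ≥0∞) {r t : ℝ} (hr : 0 ≤ t) :
    (ENNReal.ofReal Real.pi)⁻¹ * (ENNReal.ofReal (t - r) * ∫⁻ s in Set.Ioo t 1, ρ s)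
      ≤ radialMass ρ r := by
  refine mul_le_mul_right ?_ _
  rw [← lintegral_const_mul' _ _ ENNReal.ofReal_ne_top]
  refine le_trans (setLIntegral_mono' measurableSet_Ioo fun s hs => ?_)
    (lintegral_mono_set (Set.Ioo_subset_Ioo_left hr))
  exact mul_le_mul_left (ENNReal.ofReal_le_ofReal (by linarith [hs.1])) _

lemma radialMass_le (ρ : ℝ → ℝ≥0∞) {r : ℝ} (hr : 0 ≤ r) :
    radialMass ρ r ≤ (ENNReal.ofReal Real.pi)⁻¹ *
      (ENNReal.ofReal (1 - r) * ∫⁻ s in Set.Ioo r 1, ρ s) := by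
  refine mul_le_mul_right ?_ _
  rw [← lintegral_const_mul' _ _ ENNReal.ofReal_ne_top, ← lintegral_indicator measurableSet_Ioo,
    ← lintegral_indicator measurableSet_Ioo]
  refine lintegral_mono fun s => ?_
  by_cases hs : s ∈ Set.Ioo r 1
  · rw [Set.indicator_of_mem hs, Set.indicator_of_mem (show s ∈ Set.Ioo (0 : ℝ) 1 from
      ⟨hr.trans_lt hs.1, hs.2⟩)]
    exact mul_le_mul_left (ENNReal.ofReal_le_ofReal (by linarith [hs.2])) _
  · by_cases h0 : s ∈ Set.Ioo (0 : ℝ) 1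
    · have : s ≤ r := by
        by_contra h; exact hs ⟨not_le.1 h, h0.2⟩
      rw [Set.indicator_of_mem h0, ENNReal.ofReal_of_nonpos (by linarith), zero_mul]
      exact zero_le
    · rw [Set.indicator_of_notMem h0]
      exact zero_le

lemma DoublingRadialWeight.radialMass_pos {ω : ℂ → ℝ} (hω : DoublingRadialWeight ω)
    {ρ : ℝ → ℝ≥0∞}
    (hωρ : ∀ᵐ s : ℝ, s ∈ Set.Ioo (0 : ℝ) 1 → ENNReal.ofReal (ω (s : ℂ)) = ρ s) {r : ℝ}
    (h0 : 0 ≤ r) (h1 : r < 1) : 0 < radialMass ρ r := by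
  refine lt_of_lt_of_le ?_ (le_radialMass ρ (r := r) (t := (1 + r) / 2) (by linarith))
  rw [← tail_eq_profile hωρ (by linarith)]
  have h2 := hω.tail_pos ((1 + r) / 2) (by linarith) (by linarith)
  refine ENNReal.mul_pos (by simp) (mul_ne_zero ?_ h2.ne')
  rw [Ne, ENNReal.ofReal_eq_zero]
  linarith

/-- The lower bound is taken at the next dyadic radius t = (1 + r')/2 with r' = (1 + r)/2. There t -
r' = (1 - r)/4 produces the 4, and going from r to t in the tail uses doubling twice. -/
lemma DoublingRadialWeight.exists_radialMass_le {ω : ℂ → ℝ} (hω : DoublingRadialWeight ω)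
    {ρ : ℝ → ℝ≥0∞}
    (hωρ : ∀ᵐ s : ℝ, s ∈ Set.Ioo (0 : ℝ) 1 → ENNReal.ofReal (ω (s : ℂ)) = ρ s) :
    ∃ C : ℝ≥0, ∀ r : ℝ, 0 ≤ r → r < 1 → radialMass ρ r ≤ C * radialMass ρ ((1 + r) / 2) := by
  obtain ⟨K, hK⟩ := hω.doubling
  refine ⟨4 * K * K, fun r h0 h1 => ?_⟩
  have e1 := hK r h0 h1
  have e2 := hK ((1 + r) / 2) (by linarith) (by linarith)
  have e3 := le_radialMass ρ (r := (1 + r) / 2) (t := (1 + (1 + r) / 2) / 2) (by linarith)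
  have e4 := radialMass_le ρ h0
  rw [← tail_eq_profile hωρ h0] at e4
  rw [← tail_eq_profile hωρ (by linarith)] at e3
  refine e4.trans ?_
  refine le_trans ?_ (mul_le_mul_right e3 _)
  have e5 : ENNReal.ofReal (1 - r)
      = 4 * ENNReal.ofReal ((1 + (1 + r) / 2) / 2 - (1 + r) / 2) := by
    rw [show (4 : ℝ≥0∞) = ENNReal.ofReal 4 by simp, ← ENNReal.ofReal_mul (by norm_num)]
    congr 1; ring
  calc (ENNReal.ofReal Real.pi)⁻¹ * (ENNReal.ofReal (1 - r) * tail ω r)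
      ≤ (ENNReal.ofReal Real.pi)⁻¹ * (ENNReal.ofReal (1 - r) *
        (K * (K * tail ω ((1 + (1 + r) / 2) / 2)))) := by gcongr; exact e1.trans (by gcongr)
    _ = _ := by
        rw [e5]; push_cast; ring

/-- Three dyadic steps divide the distance to the circle by 8, the factor by which the parent of a
point is moved inwards. -/
lemma DoublingRadialWeight.exists_radialMass_le_iterate {ω : ℂ → ℝ} (hω : DoublingRadialWeight ω)
    {ρ : ℝ → ℝ≥0∞}
    (hωρ : ∀ᵐ s : ℝ, s ∈ Set.Ioo (0 : ℝ) 1 → ENNReal.ofReal (ω (s : ℂ)) = ρ s) :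
    ∃ C : ℝ≥0, ∀ r : ℝ, r < 1 →
      radialMass ρ (max 0 (1 - 8 * (1 - r))) ≤ C * radialMass ρ r := by
  obtain ⟨C, hC⟩ := hω.exists_radialMass_le hωρ
  refine ⟨C * C * C, fun r h1 => ?_⟩
  set a := max 0 (1 - 8 * (1 - r)) with ha
  have ha0 : 0 ≤ a := le_max_left _ _
  have ha1 : a < 1 := max_lt one_pos (by linarith)
  have e1 := hC a ha0 ha1
  have e2 := hC ((1 + a) / 2) (by linarith) (by linarith)
  have e3 := hC ((1 + (1 + a) / 2) / 2) (by linarith) (by linarith)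
  have e4 : radialMass ρ ((1 + (1 + (1 + a) / 2) / 2) / 2) ≤ radialMass ρ r := by
    refine radialMass_anti ρ ?_
    have := le_max_right 0 (1 - 8 * (1 - r))
    linarith
  calc radialMass ρ a ≤ C * (C * (C * radialMass ρ r)) := by
        refine e1.trans ?_
        gcongr
        refine e2.trans ?_
        gcongr
        exact e3.trans (by gcongr)
    _ = _ := by push_cast; ring

lemma tentMass_of_ne {ω : ℂ → ℝ} {z : Disc} (hz : z ≠ origin) :
    tentMass ω z = weightMeasure ω (tent z) := by simp [tentMass, hz]

lemma DoublingRadialWeight.radialMass_zero_le {ω : ℂ → ℝ} (hω : DoublingRadialWeight ω)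
    {ρ : ℝ → ℝ≥0∞} (hρ : Measurable ρ)
    (hωρ : ∀ᵐ s : ℝ, s ∈ Set.Ioo (0 : ℝ) 1 → ENNReal.ofReal (ω (s : ℂ)) = ρ s) :
    radialMass ρ 0 ≤ weightMeasure ω Set.univ := by
  have h := weightMeasure_sector_of_le_pi hω hρ hωρ (c := 1 / 2) (by norm_num)
    (by linarith [Real.pi_gt_three]) le_rfl (norm_one (α := ℂ))
  rw [show (2 * (1 / 2) : ℝ) = 1 by norm_num, ENNReal.ofReal_one, one_mul] at h
  rw [← h]
  exact measure_mono (Set.subset_univ _)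

/-- At the origin the limit is computed by dominated convergence in the radial integral. It need not
be the mass of `tent origin`, which is the whole disc; hence `TentControl.mass_le` is only an
inequality. -/
lemma DoublingRadialWeight.tentMass_eq {ω : ℂ → ℝ} (hω : DoublingRadialWeight ω)
    {ρ : ℝ → ℝ≥0∞} (hρ : Measurable ρ)
    (hωρ : ∀ᵐ s : ℝ, s ∈ Set.Ioo (0 : ℝ) 1 → ENNReal.ofReal (ω (s : ℂ)) = ρ s) (z : Disc) :
    tentMass ω z = radialMass ρ ‖(z : ℂ)‖ := by
  by_cases hz : z = origin
  swap
  · rw [tentMass_of_ne hz, weightMeasure_tent hω hρ hωρ hz]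
  have hfin := hω.isFiniteMeasure
  rw [tentMass, if_pos hz, show ‖(z : ℂ)‖ = 0 by rw [hz]; exact norm_zero]
  refine Tendsto.limUnder_eq ?_
  have h1 : ∀ᶠ r in 𝓝[>] (0 : ℝ),
      radialMass ρ r = weightMeasure ω (tent (realPoint r)) := by
    filter_upwards [Ioo_mem_nhdsGT (zero_lt_one' ℝ)] with r hr
    have hn := exists_mem_disc_norm_eq hr.1.le hr.2
    have hne : realPoint r ≠ origin := by
      intro h
      rw [h] at hn
      exact hr.1.ne' (hn.symm.trans norm_zero)
    rw [weightMeasure_tent hω hρ hωρ hne, hn]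
  refine Tendsto.congr' h1 ?_
  have hfin0 : radialMass ρ 0 ≠ ∞ := by
    refine ne_top_of_le_ne_top ?_ (hω.radialMass_zero_le hρ hωρ)
    exact measure_ne_top _ _
  refine ENNReal.Tendsto.const_mul ?_ (Or.inr (by simp [Real.pi_pos]))
  refine tendsto_lintegral_filter_of_dominated_convergence
    (fun s => ENNReal.ofReal (s - 0) * ρ s) ?_ ?_ ?_ ?_
  · exact Eventually.of_forall fun r => by fun_prop
  · filter_upwards [self_mem_nhdsWithin] with r hr
    refine Eventually.of_forall fun s => ?_
    exact mul_le_mul_left (ENNReal.ofReal_le_ofReal (by linarith [show (0 : ℝ) < r from hr])) _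
  · intro htop
    refine hfin0 ?_
    rw [radialMass, htop, ENNReal.mul_top (by simp)]
  · filter_upwards [ae_restrict_mem measurableSet_Ioo] with s hs
    refine ENNReal.Tendsto.mul_const ?_ (Or.inl ?_)
    · refine (ENNReal.continuous_ofReal.tendsto _).comp ?_
      exact (tendsto_const_nhds.sub tendsto_id).mono_left nhdsWithin_le_nhds
    · simpa using hs.1

/-- The geometric properties of the tents on which the duality rests. -/
structure TentControl (ω : ℂ → ℝ) (C : ℝ≥0) : Prop where
  finite : IsFiniteMeasure (weightMeasure ω)
  mass_pos : ∀ z, 0 < tentMass ω z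
  mass_le : ∀ z, tentMass ω z ≤ weightMeasure ω (tent z)
  wide : ∀ a, weightMeasure ω (wideTent a) ≤ C * tentMass ω a
  parent : ∀ z : Disc, ∃ a, tentMass ω a ≤ C * tentMass ω z ∧ ∀ w : Disc,
    1 - ‖(w : ℂ)‖ ≤ 2 * (1 - ‖(z : ℂ)‖) → (tent w ∩ tent z).Nonempty → w ∈ tent a

/-- The point `a` lies on the ray of `z` at 8 times the distance to the circle, or at the origin if
that distance is too large. Through a common point of the two tents the angle between `w` and `z` is
below (1 - |w|)/2 + (1 - |z|)/2, hence below 3(1 - |z|)/2, and the aperture of T(a) at `w` exceeds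
this. -/
lemma mem_tent_of_inter_nonempty {z w a : Disc}
    (ha : (a : ℂ) = ((max 0 (1 - 8 * (1 - ‖(z : ℂ)‖)) / ‖(z : ℂ)‖ : ℝ) : ℂ) * z)
    (hwz : 1 - ‖(w : ℂ)‖ ≤ 2 * (1 - ‖(z : ℂ)‖)) (h : (tent w ∩ tent z).Nonempty) :
    w ∈ tent a := by
  by_cases ha0 : a = origin
  · rw [ha0, tent_origin]; trivial
  have ha0' : (a : ℂ) ≠ 0 := fun h => ha0 (coe_eq_zero_iff.1 h)
  have hz0' : (z : ℂ) ≠ 0 := fun h => ha0' (by rw [ha, h, mul_zero])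
  have hz0 : z ≠ origin := fun h => hz0' (coe_eq_zero_iff.2 h)
  have pz := norm_pos_iff.2 hz0'
  have hpos : 0 < max 0 (1 - 8 * (1 - ‖(z : ℂ)‖)) / ‖(z : ℂ)‖ := by
    refine lt_of_le_of_ne (by positivity) fun h => ha0' ?_
    rw [ha, ← h]; simp
  have hna : ‖(a : ℂ)‖ = max 0 (1 - 8 * (1 - ‖(z : ℂ)‖)) := by
    rw [ha, norm_mul, Complex.norm_real, Real.norm_of_nonneg hpos.le, div_mul_cancel₀ _ pz.ne']
  have hm : 0 < 1 - 8 * (1 - ‖(z : ℂ)‖) := by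
    by_contra hcon
    rw [max_eq_left (not_lt.1 hcon), zero_div] at hpos
    exact lt_irrefl _ hpos
  rw [max_eq_right hm.le] at hna
  have hw0 : (w : ℂ) ≠ 0 := by
    intro h
    rw [h, norm_zero] at hwz
    linarith
  have hw0' : w ≠ origin := fun h => hw0 (coe_eq_zero_iff.2 h)
  rw [mem_tent_iff ha0]
  refine ⟨hw0, ?_⟩
  obtain ⟨ζ, h1, h2⟩ := h
  obtain ⟨hζ0, h1⟩ := (mem_tent_iff hw0').1 h1
  obtain ⟨-, h2⟩ := (mem_tent_iff hz0).1 h2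
  have pζ := norm_pos_iff.2 hζ0
  have pw := norm_pos_iff.2 hw0
  have lz : ‖(z : ℂ)‖ ≤ ‖(z : ℂ)‖ / ‖(ζ : ℂ)‖ := le_div_self (norm_nonneg _) pζ (norm_lt_one ζ).le
  have lw : ‖(w : ℂ)‖ ≤ ‖(w : ℂ)‖ / ‖(ζ : ℂ)‖ := le_div_self (norm_nonneg _) pζ (norm_lt_one ζ).le
  have h3 := InnerProductGeometry.angle_le_angle_add_angle (w : ℂ) ζ z
  rw [InnerProductGeometry.angle_comm (w : ℂ) ζ] at h3
  have h4 : angle (w : ℂ) a = angle (w : ℂ) z := by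
    rw [ha, ← Complex.real_smul, InnerProductGeometry.angle_smul_right_of_pos _ _ hpos]
  -- With x = 1 - |z| one has |w| ≥ 1 - 2x, and (1 - 3x)(1 - 2x) ≥ 1 - 5x ≥ 1 - 8x = |a|.
  have h5 : ‖(a : ℂ)‖ / ‖(w : ℂ)‖ ≤ 1 - 3 * (1 - ‖(z : ℂ)‖) := by
    rw [hna, div_le_iff₀ pw]
    nlinarith [norm_lt_one z, norm_lt_one w]
  rw [h4]
  linarith

theorem DoublingRadialWeight.exists_tentControl {ω : ℂ → ℝ} (hω : DoublingRadialWeight ω) :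
    ∃ C : ℝ≥0, TentControl ω C := by
  obtain ⟨ρ, hρ, hωρ⟩ := hω.exists_profile
  obtain ⟨K, hK⟩ := hω.exists_radialMass_le_iterate hωρ
  have hm := hω.tentMass_eq hρ hωρ
  have hpos : ∀ z, 0 < tentMass ω z := fun z => by
    rw [hm]; exact hω.radialMass_pos hωρ (norm_nonneg _) (norm_lt_one z)
  -- K serves the parents. The wide tents need the factor 2 away from the origin and 2π at the
  -- origin.
  refine ⟨max K (Real.toNNReal (2 * Real.pi)), hω.isFiniteMeasure, hpos, fun z => ?_, fun a => ?_,
    fun z => ?_⟩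
  · by_cases hz : z = origin
    · rw [hm, show ‖(z : ℂ)‖ = 0 by rw [hz]; exact norm_zero, hz, tent_origin]
      exact hω.radialMass_zero_le hρ hωρ
    · exact (tentMass_of_ne hz).le
  · rw [hm]
    by_cases ha : a = origin
    · have : ‖(a : ℂ)‖ = 0 := by rw [ha]; exact norm_zero
      rw [this, wideTent, if_pos ha]
      refine (weightMeasure_univ_le hω hρ hωρ).trans ?_
      gcongr
      exact ENNReal.coe_le_coe.2 (le_max_right _ _)
    · rw [weightMeasure_wideTent hω hρ hωρ ha]
      gcongr
      rw [ENNReal.coe_max]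
      refine le_max_of_le_right ?_
      rw [← ENNReal.ofReal, show (2 : ℝ≥0∞) = ENNReal.ofReal 2 by simp]
      exact ENNReal.ofReal_le_ofReal (by linarith [Real.pi_gt_three])
  · set r := max 0 (1 - 8 * (1 - ‖(z : ℂ)‖)) with hr
    have hr0 : 0 ≤ r := le_max_left _ _
    have hr1 : r < 1 := max_lt one_pos (by linarith [norm_lt_one z])
    have hmem : ((r / ‖(z : ℂ)‖ : ℝ) : ℂ) * z ∈ Metric.ball (0 : ℂ) 1 := by
      rw [mem_ball_zero_iff, norm_mul, Complex.norm_real, Real.norm_of_nonneg (by positivity)]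
      refine lt_of_le_of_lt ?_ hr1
      rw [div_mul_eq_mul_div]
      exact div_le_of_le_mul₀ (norm_nonneg _) hr0 le_rfl
    refine ⟨⟨_, hmem⟩, ?_, fun w hw h => mem_tent_of_inter_nonempty rfl hw h⟩
    rw [hm, hm]
    have hn : ‖((r / ‖(z : ℂ)‖ : ℝ) : ℂ) * z‖ = r := by
      rw [norm_mul, Complex.norm_real, Real.norm_of_nonneg (by positivity)]
      -- For z = 0 the quotient r / 0 is 0 by convention, which agrees with r = max 0 (-7) = 0.
      by_cases hz : ‖(z : ℂ)‖ = 0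
      · rw [hz, mul_zero, hr, hz]; norm_num
      · exact div_mul_cancel₀ _ hz
    rw [show ‖((⟨_, hmem⟩ : Disc) : ℂ)‖ = r from hn]
    refine (hK _ (norm_lt_one z)).trans ?_
    gcongr
    exact le_max_left _ _

end TentDuality

/-! ### The maximal function over tents -/

namespace TentDuality

lemma mem_lens_iff_mem_tent {z ζ : Disc} : z ∈ lens ζ ↔ ζ ∈ tent z := Iff.rfl

lemma tent_subset_wideTent_self (a : Disc) : tent a ⊆ wideTent a := by
  by_cases ha : a = origin
  · simp [wideTent, ha]
  have ha0 : (a : ℂ) ≠ 0 := fun h => ha (coe_eq_zero_iff.1 h)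
  intro ζ hζ
  obtain ⟨h0, h1⟩ := (mem_tent_iff ha).1 hζ
  rw [wideTent, if_neg ha]
  refine ⟨h0, ?_⟩
  rw [abs_arg_div_normalize h0 ha0]
  have h2 := InnerProductGeometry.angle_nonneg (ζ : ℂ) (a : ℂ)
  linarith

namespace TentControl

variable {ω : ℂ → ℝ} {C : ℝ≥0}

lemma measure_tent_le (H : TentControl ω C) (z : Disc) :
    weightMeasure ω (tent z) ≤ C * tentMass ω z :=
  (measure_mono (tent_subset_wideTent_self z)).trans (H.wide z)

lemma mass_ne_zero (H : TentControl ω C) (z : Disc) : tentMass ω z ≠ 0 := (H.mass_pos z).ne'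

lemma mass_le_univ (H : TentControl ω C) (z : Disc) :
    tentMass ω z ≤ weightMeasure ω Set.univ :=
  (H.mass_le z).trans (measure_mono (Set.subset_univ _))

lemma mass_ne_top (H : TentControl ω C) (z : Disc) : tentMass ω z ≠ ∞ := by
  have := H.finite
  exact ne_top_of_le_ne_top (measure_ne_top _ _) (H.mass_le z)

lemma tent_nonempty (H : TentControl ω C) (z : Disc) : (tent z).Nonempty :=
  nonempty_of_measure_ne_zero ((H.mass_pos z).trans_le (H.mass_le z)).ne'

lemma one_le (H : TentControl ω C) : (1 : ℝ≥0∞) ≤ C := by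
  have h := (H.mass_le origin).trans (H.measure_tent_le origin)
  by_contra hC
  have := ENNReal.mul_lt_mul_left (H.mass_ne_zero origin) (H.mass_ne_top origin) (not_le.1 hC)
  rw [one_mul] at this
  exact absurd h this.not_ge

lemma coe_ne_zero (H : TentControl ω C) : (C : ℝ≥0∞) ≠ 0 :=
  (zero_lt_one.trans_le H.one_le).ne'

end TentControl

/-- The maximal function associated with the averages over tents. -/
noncomputable def tentMaximal (ω : ℂ → ℝ) (h : Disc → ℝ≥0∞) (ζ : Disc) : ℝ≥0∞ :=
  ⨆ z ∈ lens ζ, (tentMass ω z)⁻¹ * ∫⁻ x in tent z, h x ∂weightMeasure ω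

lemma le_tentMaximal (ω : ℂ → ℝ) (h : Disc → ℝ≥0∞) {z ζ : Disc} (hz : z ∈ lens ζ) :
    (tentMass ω z)⁻¹ * ∫⁻ x in tent z, h x ∂weightMeasure ω ≤ tentMaximal ω h ζ :=
  le_iSup₂ (f := fun z (_ : z ∈ lens ζ) =>
    (tentMass ω z)⁻¹ * ∫⁻ x in tent z, h x ∂weightMeasure ω) z hz

lemma setOf_lt_tentMaximal (ω : ℂ → ℝ) (h : Disc → ℝ≥0∞) (c : ℝ≥0∞) :
    {ζ | c < tentMaximal ω h ζ} =
      ⋃ z ∈ {z | c < (tentMass ω z)⁻¹ * ∫⁻ x in tent z, h x ∂weightMeasure ω}, tent z := by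
  ext ζ
  simp only [tentMaximal, Set.mem_ofPred_eq, lt_iSup_iff, Set.mem_iUnion, mem_lens_iff_mem_tent,
    exists_prop]
  exact exists_congr fun z => and_comm

lemma measurable_tentMaximal (ω : ℂ → ℝ) (h : Disc → ℝ≥0∞) : Measurable (tentMaximal ω h) := by
  refine measurable_of_Ioi fun c => ?_
  have := setOf_lt_tentMaximal ω h c
  rw [show tentMaximal ω h ⁻¹' Set.Ioi c = {ζ | c < tentMaximal ω h ζ} from rfl, this]
  exact (isOpen_biUnion fun z _ => isOpen_tent z).measurableSet

/-- A Vitali selection among the tents with large average leaves a disjoint family. A discarded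
vertex `z` lies in the tent of the parent of a selected `b`, so T(z) is covered by the wide tent
over that parent. One factor `C` pays for widening and one for passing to the parent. -/
lemma TentControl.weak_type {ω : ℂ → ℝ} {C : ℝ≥0} (H : TentControl ω C) (h : Disc → ℝ≥0∞)
    (c : ℝ≥0∞) :
    c * weightMeasure ω {ζ | c < tentMaximal ω h ζ} ≤ C * C * ∫⁻ x, h x ∂weightMeasure ω := by
  set t := {z | c < (tentMass ω z)⁻¹ * ∫⁻ x in tent z, h x ∂weightMeasure ω} with ht
  -- The size of a tent is measured by 1 - |z|; the ratio 2 is the one allowed in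
  -- `TentControl.parent`.
  obtain ⟨u, hut, hdisj, hcov⟩ := Vitali.exists_disjoint_subfamily_covering_enlargement
    tent t (fun z => 1 - ‖(z : ℂ)‖) 2 one_lt_two (fun z _ => by linarith [norm_lt_one z]) 1
    (fun z _ => by linarith [norm_nonneg (z : ℂ)]) (fun z _ => H.tent_nonempty z)
  have hu : u.Countable :=
    hdisj.countable_of_isOpen (fun z _ => isOpen_tent z) (fun z _ => H.tent_nonempty z)
  choose a ha1 ha2 using H.parent
  have hsub : {ζ | c < tentMaximal ω h ζ} ⊆ ⋃ b ∈ u, wideTent (a b) := by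
    rw [setOf_lt_tentMaximal]
    refine Set.iUnion₂_subset fun z hz => ?_
    obtain ⟨b, hb, hzb, hδ⟩ := hcov z hz
    exact (tent_subset_wideTent (ha2 b z hδ hzb)).trans
      (Set.subset_biUnion_of_mem (u := fun b => wideTent (a b)) hb)
  have hb : ∀ b ∈ u, c * tentMass ω b ≤ ∫⁻ x in tent b, h x ∂weightMeasure ω := by
    intro b hb
    have h1 : c ≤ (tentMass ω b)⁻¹ * ∫⁻ x in tent b, h x ∂weightMeasure ω := (hut hb).le
    calc c * tentMass ω b ≤ (tentMass ω b)⁻¹ * (∫⁻ x in tent b, h x ∂weightMeasure ω)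
          * tentMass ω b := by gcongr
      _ = _ := by
          rw [mul_right_comm, ENNReal.inv_mul_cancel (H.mass_ne_zero b) (H.mass_ne_top b), one_mul]
  have : Countable u := hu.to_subtype
  calc c * weightMeasure ω {ζ | c < tentMaximal ω h ζ}
      ≤ c * ∑' b : u, weightMeasure ω (wideTent (a b)) := by
        gcongr
        refine (measure_mono hsub).trans ?_
        rw [Set.biUnion_eq_iUnion]
        exact measure_iUnion_le _
    _ ≤ c * ∑' b : u, C * (C * tentMass ω b) := by
        gcongr with b
        exact (H.wide _).trans (by gcongr; exact ha1 b)
    _ = C * C * ∑' b : u, c * tentMass ω b := by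
        rw [← ENNReal.tsum_mul_left, ← ENNReal.tsum_mul_left]
        refine tsum_congr fun b => ?_
        ring
    _ ≤ C * C * ∑' b : u, ∫⁻ x in tent b, h x ∂weightMeasure ω := by
        gcongr with b
        exact hb b b.2
    _ = C * C * ∫⁻ x in ⋃ b ∈ u, tent b, h x ∂weightMeasure ω := by
        rw [lintegral_biUnion hu (fun b _ => measurableSet_tent b) hdisj]
    _ ≤ _ := by
        gcongr
        exact Measure.restrict_le_self

/-- Split h into a part bounded by c and the part where h > c. The first contributes at most C c to
the maximal function. Above the level 2 C c at least C c ≥ c must then come from the second, to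
which the weak type estimate applies. -/
lemma TentControl.weak_type_truncated {ω : ℂ → ℝ} {C : ℝ≥0} (H : TentControl ω C)
    {h : Disc → ℝ≥0∞} (hh : Measurable h) (c : ℝ≥0∞) :
    c * weightMeasure ω {ζ | 2 * C * c < tentMaximal ω h ζ}
      ≤ C * C * ∫⁻ x in {x | c < h x}, h x ∂weightMeasure ω := by
  have hs : MeasurableSet {x | c < h x} := measurableSet_lt measurable_const hh
  have key : ∀ ζ, tentMaximal ω h ζ ≤ C * c + tentMaximal ω ({x | c < h x}.indicator h) ζ := by
    intro ζ
    refine iSup₂_le fun z hz => ?_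
    have h1 : ∫⁻ x in tent z, h x ∂weightMeasure ω
        ≤ c * (C * tentMass ω z) + ∫⁻ x in tent z, {x | c < h x}.indicator h x ∂weightMeasure ω := by
      calc ∫⁻ x in tent z, h x ∂weightMeasure ω
          ≤ ∫⁻ x in tent z, (c + {x | c < h x}.indicator h x) ∂weightMeasure ω := by
            refine lintegral_mono fun x => ?_
            by_cases hx : c < h x
            · rw [Set.indicator_of_mem (show x ∈ {x | c < h x} from hx)]; exact le_add_self
            · exact (not_lt.1 hx).trans le_self_add
        _ = c * weightMeasure ω (tent z)
            + ∫⁻ x in tent z, {x | c < h x}.indicator h x ∂weightMeasure ω := by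
            rw [lintegral_add_left measurable_const, setLIntegral_const]
        _ ≤ _ := by gcongr; exact H.measure_tent_le z
    calc _ ≤ (tentMass ω z)⁻¹ * (c * (C * tentMass ω z)
          + ∫⁻ x in tent z, {x | c < h x}.indicator h x ∂weightMeasure ω) := by gcongr
      _ = (tentMass ω z)⁻¹ * tentMass ω z * (C * c) + (tentMass ω z)⁻¹ *
          ∫⁻ x in tent z, {x | c < h x}.indicator h x ∂weightMeasure ω := by ring
      _ ≤ _ := by
          rw [ENNReal.inv_mul_cancel (H.mass_ne_zero z) (H.mass_ne_top z), one_mul]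
          gcongr
          exact le_tentMaximal ω _ hz
  have hsub : {ζ | 2 * C * c < tentMaximal ω h ζ}
      ⊆ {ζ | c < tentMaximal ω ({x | c < h x}.indicator h) ζ} := by
    intro ζ hζ
    have h1 : 2 * C * c < C * c + tentMaximal ω ({x | c < h x}.indicator h) ζ := hζ.trans_le (key ζ)
    rw [show 2 * (C : ℝ≥0∞) * c = C * c + C * c by ring] at h1
    have h2 := lt_of_add_lt_add_left h1
    refine lt_of_le_of_lt ?_ h2
    calc c = 1 * c := (one_mul c).symm
      _ ≤ _ := by gcongr; exact H.one_le
  calc _ ≤ _ := mul_le_mul_right (measure_mono hsub) _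
    _ ≤ _ := H.weak_type _ c
    _ = _ := by rw [lintegral_indicator hs]

/-- This is the inner integral after Fubini in the layer-cake formula; s > 1 makes t^(s-2)
integrable at 0. -/
lemma lintegral_rpow_indicator_le {s : ℝ} (hs : 1 < s) (y : ℝ≥0∞) :
    ∫⁻ t in Set.Ioi (0 : ℝ), {t : ℝ | ENNReal.ofReal t < y}.indicator
      (fun t => ENNReal.ofReal (t ^ (s - 2))) t ≤ (ENNReal.ofReal (s - 1))⁻¹ * y ^ (s - 1) := by
  have hs1 : 0 < s - 1 := by linarith
  by_cases hy : y = ∞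
  · rw [hy, ENNReal.top_rpow_of_pos hs1, ENNReal.mul_top (by simp)]
    exact le_top
  lift y to ℝ≥0 using hy
  have hset : ∀ t ∈ Set.Ioi (0 : ℝ), {t : ℝ | ENNReal.ofReal t < y}.indicator
      (fun t => ENNReal.ofReal (t ^ (s - 2))) t
      = (Set.Ioo (0 : ℝ) y).indicator (fun t => ENNReal.ofReal (t ^ (s - 2))) t := by
    intro t ht
    have hiff : t ∈ {t : ℝ | ENNReal.ofReal t < y} ↔ t ∈ Set.Ioo (0 : ℝ) y := by
      simp only [Set.mem_ofPred_eq, Set.mem_Ioo, show 0 < t from ht, true_and]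
      rw [← ENNReal.ofReal_coe_nnreal, ENNReal.ofReal_lt_ofReal_iff_of_nonneg (le_of_lt ht)]
    by_cases h : t ∈ Set.Ioo (0 : ℝ) y
    · rw [Set.indicator_of_mem h, Set.indicator_of_mem (hiff.2 h)]
    · rw [Set.indicator_of_notMem h, Set.indicator_of_notMem (mt hiff.1 h)]
  rw [setLIntegral_congr_fun measurableSet_Ioi hset]
  refine (lintegral_mono' Measure.restrict_le_self le_rfl).trans ?_
  rw [lintegral_indicator measurableSet_Ioo, restrict_Ioo_eq_restrict_Ioc]
  have hint : IntervalIntegrable (fun t : ℝ => t ^ (s - 2)) volume 0 y :=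
    intervalIntegral.intervalIntegrable_rpow' (by linarith)
  rw [← ofReal_integral_eq_lintegral_ofReal
    ((intervalIntegrable_iff_integrableOn_Ioc_of_le y.coe_nonneg).1 hint)
    ((ae_restrict_mem measurableSet_Ioc).mono fun t ht => Real.rpow_nonneg ht.1.le _),
    ← intervalIntegral.integral_of_le y.coe_nonneg, integral_rpow (Or.inl (by linarith)),
    show s - 2 + 1 = s - 1 by ring, Real.zero_rpow hs1.ne', sub_zero,
    ENNReal.ofReal_div_of_pos hs1, ← ENNReal.ofReal_rpow_of_nonneg y.coe_nonneg hs1.le,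
    ENNReal.ofReal_coe_nnreal, ENNReal.div_eq_inv_mul]

/-- The maximal function over tents is bounded on `L^s(ω dA)` for `1 < s`. -/
theorem TentControl.strong_type {ω : ℂ → ℝ} {C : ℝ≥0} (H : TentControl ω C) {s : ℝ} (hs : 1 < s) :
    ∃ K : ℝ≥0, ∀ h : Disc → ℝ≥0∞, Measurable h →
      ∫⁻ ζ, tentMaximal ω h ζ ^ s ∂weightMeasure ω ≤ K * ∫⁻ ζ, h ζ ^ s ∂weightMeasure ω := by
  have hs0 : 0 < s := by linarith
  have hs1 : 0 < s - 1 := by linarith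
  have hfin := H.finite
  set D : ℝ≥0∞ := 2 * C with hD
  have hD0 : D ≠ 0 := mul_ne_zero two_ne_zero H.coe_ne_zero
  have hDt : D ≠ ∞ := ENNReal.mul_ne_top (by simp) (by simp)
  set K : ℝ≥0∞ := D ^ s * (ENNReal.ofReal s * (C * C * (ENNReal.ofReal (s - 1))⁻¹)) with hK
  have hKt : K ≠ ∞ := by
    refine ENNReal.mul_ne_top (ENNReal.rpow_ne_top_of_nonneg hs0.le hDt)
      (ENNReal.mul_ne_top (by simp) (ENNReal.mul_ne_top
        (ENNReal.mul_ne_top (by simp) (by simp)) (ENNReal.inv_ne_top.2 ?_)))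
    rw [Ne, ENNReal.ofReal_eq_zero]; linarith
  refine ⟨K.toNNReal, fun h hh => ?_⟩
  rw [ENNReal.coe_toNNReal hKt]
  have hM := measurable_tentMaximal ω h
  -- After division by D = 2C, the level t of g is the level 2 C t of the maximal function in
  -- `TentControl.weak_type_truncated`.
  set g : Disc → ℝ≥0∞ := fun ζ => D⁻¹ * tentMaximal ω h ζ with hg
  have hgm : Measurable g := hM.const_mul _
  have hlevel : ∀ t : ℝ, 0 < t → weightMeasure ω {ζ | ENNReal.ofReal t < g ζ} *
      ENNReal.ofReal (t ^ (s - 1)) ≤ C * C * ∫⁻ x, h x * {t : ℝ | ENNReal.ofReal t < h x}.indicator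
        (fun t => ENNReal.ofReal (t ^ (s - 2))) t ∂weightMeasure ω := by
    intro t ht
    have e1 := H.weak_type_truncated hh (ENNReal.ofReal t)
    have e2 : {ζ | ENNReal.ofReal t < g ζ} ⊆ {ζ | 2 * C * ENNReal.ofReal t < tentMaximal ω h ζ} := by
      intro ζ hζ
      have := ENNReal.mul_lt_mul_right hD0 hDt hζ
      rwa [hg, ← mul_assoc, ENNReal.mul_inv_cancel hD0 hDt, one_mul] at this
    have e3 : ENNReal.ofReal (t ^ (s - 1)) = ENNReal.ofReal t * ENNReal.ofReal (t ^ (s - 2)) := by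
      rw [← ENNReal.ofReal_mul ht.le]
      congr 1
      rw [← Real.rpow_one_add' ht.le (by linarith)]
      congr 1; ring
    calc _ = (ENNReal.ofReal t * weightMeasure ω {ζ | ENNReal.ofReal t < g ζ}) *
          ENNReal.ofReal (t ^ (s - 2)) := by rw [e3]; ring
      _ ≤ (C * C * ∫⁻ x in {x | ENNReal.ofReal t < h x}, h x ∂weightMeasure ω) *
          ENNReal.ofReal (t ^ (s - 2)) := by
          exact mul_le_mul_left ((mul_le_mul_right (measure_mono e2) _).trans e1) _
      _ = _ := by
          rw [mul_assoc, ← lintegral_mul_const' _ _ ENNReal.ofReal_ne_top,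
            ← lintegral_indicator (measurableSet_lt measurable_const hh)]
          congr 1
          refine lintegral_congr fun x => ?_
          by_cases hx : ENNReal.ofReal t < h x
          · rw [Set.indicator_of_mem (show x ∈ {x | ENNReal.ofReal t < h x} from hx),
              Set.indicator_of_mem (show t ∈ {t : ℝ | ENNReal.ofReal t < h x} from hx)]
          · rw [Set.indicator_of_notMem (show x ∉ {x | ENNReal.ofReal t < h x} from hx),
              Set.indicator_of_notMem (show t ∉ {t : ℝ | ENNReal.ofReal t < h x} from hx), mul_zero]
  have hmeas : Measurable (fun p : Disc × ℝ => h p.1 *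
      {t : ℝ | ENNReal.ofReal t < h p.1}.indicator (fun t => ENNReal.ofReal (t ^ (s - 2))) p.2) := by
    refine (hh.comp measurable_fst).mul ?_
    have : (fun p : Disc × ℝ => {t : ℝ | ENNReal.ofReal t < h p.1}.indicator
        (fun t => ENNReal.ofReal (t ^ (s - 2))) p.2)
        = {p : Disc × ℝ | ENNReal.ofReal p.2 < h p.1}.indicator
          (fun p => ENNReal.ofReal (p.2 ^ (s - 2))) := rfl
    rw [this]
    refine Measurable.indicator (by fun_prop) (measurableSet_lt (by fun_prop) (by fun_prop))
  -- The layer-cake formula is for real-valued functions, so g is first capped at n.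
  have htrunc : ∀ n : ℕ, ∫⁻ ζ, (min (g ζ) n) ^ s ∂weightMeasure ω ≤
      ENNReal.ofReal s * (C * C * (ENNReal.ofReal (s - 1))⁻¹) *
        ∫⁻ ζ, h ζ ^ s ∂weightMeasure ω := by
    intro n
    have hnt : ∀ ζ, min (g ζ) n ≠ ∞ := fun ζ => ne_top_of_le_ne_top (by simp) (min_le_right _ _)
    have e := lintegral_rpow_eq_lintegral_meas_lt_mul (weightMeasure ω)
      (f := fun ζ => (min (g ζ) n).toReal) (Eventually.of_forall fun ζ => ENNReal.toReal_nonneg)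
      (hgm.min measurable_const).ennreal_toReal.aemeasurable hs0
    calc ∫⁻ ζ, (min (g ζ) n) ^ s ∂weightMeasure ω
        = ∫⁻ ζ, ENNReal.ofReal ((min (g ζ) n).toReal ^ s) ∂weightMeasure ω := by
          refine lintegral_congr fun ζ => ?_
          rw [← ENNReal.ofReal_rpow_of_nonneg ENNReal.toReal_nonneg hs0.le,
            ENNReal.ofReal_toReal (hnt ζ)]
      _ ≤ ENNReal.ofReal s * ∫⁻ t in Set.Ioi (0 : ℝ), C * C * ∫⁻ x, h x *
          {t : ℝ | ENNReal.ofReal t < h x}.indicator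
            (fun t => ENNReal.ofReal (t ^ (s - 2))) t ∂weightMeasure ω := by
          rw [e]
          refine mul_le_mul_right (setLIntegral_mono' measurableSet_Ioi fun t ht => ?_) _
          refine le_trans (mul_le_mul_left (measure_mono fun ζ hζ => ?_) _) (hlevel t ht)
          exact ((ENNReal.ofReal_lt_iff_lt_toReal (le_of_lt ht) (hnt ζ)).2 hζ).trans_le
            (min_le_left _ _)
      _ = ENNReal.ofReal s * (C * C * ∫⁻ x, h x * (∫⁻ t in Set.Ioi (0 : ℝ),
          {t : ℝ | ENNReal.ofReal t < h x}.indicator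
            (fun t => ENNReal.ofReal (t ^ (s - 2))) t) ∂weightMeasure ω) := by
          rw [lintegral_const_mul' _ _ (ENNReal.mul_ne_top (by simp) (by simp)),
            lintegral_lintegral_swap (f := fun t x => h x * {t : ℝ | ENNReal.ofReal t < h x}.indicator
            (fun t => ENNReal.ofReal (t ^ (s - 2))) t) (hmeas.comp measurable_swap).aemeasurable]
          congr 2
          refine lintegral_congr fun x => ?_
          rw [lintegral_const_mul]
          exact Measurable.indicator (by fun_prop) (measurableSet_lt (by fun_prop) measurable_const)
      _ ≤ ENNReal.ofReal s * (C * C * ∫⁻ x, (ENNReal.ofReal (s - 1))⁻¹ * h x ^ s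
            ∂weightMeasure ω) := by
          refine mul_le_mul_right (mul_le_mul_right (lintegral_mono fun x => ?_) _) _
          calc _ ≤ h x * ((ENNReal.ofReal (s - 1))⁻¹ * h x ^ (s - 1)) := by
                exact mul_le_mul_right (lintegral_rpow_indicator_le hs _) _
            _ = (ENNReal.ofReal (s - 1))⁻¹ * (h x ^ (1 : ℝ) * h x ^ (s - 1)) := by
                rw [ENNReal.rpow_one]; ring
            _ = _ := by
                rw [← ENNReal.rpow_add_of_nonneg _ _ zero_le_one hs1.le, add_sub_cancel]
      _ = _ := by
          rw [lintegral_const_mul _ (hh.pow_const s)]; ring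
  have hlim : Tendsto (fun n : ℕ => ∫⁻ ζ, (min (g ζ) n) ^ s ∂weightMeasure ω) atTop
      (𝓝 (∫⁻ ζ, g ζ ^ s ∂weightMeasure ω)) := by
    refine lintegral_tendsto_of_tendsto_of_monotone
      (fun n => ((hgm.min measurable_const).pow_const s).aemeasurable)
      (Eventually.of_forall fun ζ m n hmn => ?_) (Eventually.of_forall fun ζ => ?_)
    · refine ENNReal.rpow_le_rpow (min_le_min_left _ ?_) hs0.le
      exact_mod_cast hmn
    · refine (ENNReal.continuous_rpow_const.tendsto _).comp ?_
      have := (tendsto_const_nhds (x := g ζ)).min ENNReal.tendsto_nat_nhds_top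
      rwa [min_eq_left le_top] at this
  calc ∫⁻ ζ, tentMaximal ω h ζ ^ s ∂weightMeasure ω
      = ∫⁻ ζ, D ^ s * g ζ ^ s ∂weightMeasure ω := by
        refine lintegral_congr fun ζ => ?_
        rw [← ENNReal.mul_rpow_of_nonneg _ _ hs0.le, hg, ← mul_assoc,
          ENNReal.mul_inv_cancel hD0 hDt, one_mul]
    _ = D ^ s * ∫⁻ ζ, g ζ ^ s ∂weightMeasure ω := lintegral_const_mul _ (hgm.pow_const s)
    _ ≤ _ := by
        rw [hK, mul_assoc]
        gcongr
        exact le_of_tendsto' hlim htrunc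

end TentDuality

namespace TentDuality

/-! ### Auxiliary facts on extended nonnegative functions -/

/-- Absorption of a power of `I` into the left side. Finiteness of `I` is indispensable: for I = ∞
the hypothesis says nothing as soon as A > 0. This is why `g` is truncated later. -/
lemma ennreal_le_rpow_of_le_mul_rpow {I A : ℝ≥0∞} {t t' : ℝ} (h : t.HolderConjugate t')
    (hI : I ≠ ∞) (hle : I ≤ A * I ^ (1 / t')) : I ≤ A ^ t := by
  by_cases h0 : I = 0
  · rw [h0]; exact zero_le
  have h1 : I = I ^ (1 / t) * I ^ (1 / t') := by
    rw [← ENNReal.rpow_add _ _ h0 hI, one_div, one_div, h.inv_add_inv_eq_one, ENNReal.rpow_one]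
  have h2 : I ^ (1 / t') ≠ 0 := by simp [h0, hI]
  have h3 : I ^ (1 / t') ≠ ∞ := ENNReal.rpow_ne_top_of_nonneg h.symm.one_div_nonneg hI
  have h4 : I ^ (1 / t) ≤ A := by
    rw [← ENNReal.mul_le_mul_iff_left h2 h3, ← h1]; exact hle
  calc I = (I ^ (1 / t)) ^ t := by
        rw [← ENNReal.rpow_mul, one_div_mul_cancel h.ne_zero, ENNReal.rpow_one]
    _ ≤ _ := ENNReal.rpow_le_rpow h4 h.nonneg

section General

variable {α : Type*} [MeasurableSpace α] {μ : Measure α}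

lemma tendsto_lintegral_min_rpow {b : α → ℝ≥0∞} (hb : Measurable b) {t : ℝ} (ht : 0 < t) :
    Tendsto (fun n : ℕ => ∫⁻ x, (min (b x) n) ^ t ∂μ) atTop (𝓝 (∫⁻ x, b x ^ t ∂μ)) := by
  refine lintegral_tendsto_of_tendsto_of_monotone
    (fun n => ((hb.min measurable_const).pow_const t).aemeasurable)
    (Eventually.of_forall fun ζ m n hmn => ?_) (Eventually.of_forall fun ζ => ?_)
  · refine ENNReal.rpow_le_rpow (min_le_min_left _ ?_) ht.le
    exact_mod_cast hmn
  · refine (ENNReal.continuous_rpow_const.tendsto _).comp ?_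
    have := (tendsto_const_nhds (x := b ζ)).min ENNReal.tendsto_nat_nhds_top
    rwa [min_eq_left le_top] at this

/-- The converse of Hölder's inequality, for a finite measure. -/
lemma lintegral_rpow_le_of_forall_mul_le [IsFiniteMeasure μ] {b : α → ℝ≥0∞} (hb : Measurable b)
    {t t' : ℝ} (h : t.HolderConjugate t') {A : ℝ≥0∞}
    (hA : ∀ ψ : α → ℝ≥0∞, Measurable ψ →
      ∫⁻ x, ψ x * b x ∂μ ≤ A * (∫⁻ x, ψ x ^ t' ∂μ) ^ (1 / t')) :
    ∫⁻ x, b x ^ t ∂μ ≤ A ^ t := by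
  refine le_of_tendsto' (tendsto_lintegral_min_rpow hb h.pos) fun n => ?_
  have ht1 : 0 ≤ t - 1 := h.sub_one_pos.le
  refine ennreal_le_rpow_of_le_mul_rpow h ?_ ?_
  · refine ne_top_of_le_ne_top (b := ∫⁻ _, (n : ℝ≥0∞) ^ t ∂μ) ?_
      (lintegral_mono fun x => ENNReal.rpow_le_rpow (min_le_right _ _) h.nonneg)
    rw [lintegral_const]
    exact ENNReal.mul_ne_top (ENNReal.rpow_ne_top_of_nonneg h.nonneg (by simp)) (measure_ne_top _ _)
  · have e := hA (fun x => (min (b x) n) ^ (t - 1)) ((hb.min measurable_const).pow_const _)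
    simp only [← ENNReal.rpow_mul, h.sub_one_mul_conj] at e
    refine le_trans (lintegral_mono fun x => ?_) e
    calc (min (b x) n) ^ t = (min (b x) n) ^ (t - 1) * (min (b x) n) ^ (1 : ℝ) := by
          rw [← ENNReal.rpow_add_of_nonneg _ _ ht1 zero_le_one, sub_add_cancel]
      _ ≤ _ := by
          rw [ENNReal.rpow_one]
          exact mul_le_mul_right (min_le_left _ _) _

/-- Hölder against the constant 1, with weights 1/q and 1 - 1/q, so that q = 1 is included. -/
lemma lintegral_rpow_le_measure_univ_rpow_mul {f : α → ℝ≥0∞} (hf : Measurable f) {q : ℝ}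
    (hq : 1 ≤ q) :
    (∫⁻ x, f x ∂μ) ^ q ≤ μ Set.univ ^ (q - 1) * ∫⁻ x, f x ^ q ∂μ := by
  have hq0 : 0 < q := by linarith
  have e := ENNReal.lintegral_mul_norm_pow_le (μ := μ) (f := fun x => f x ^ q) (g := fun _ => 1)
    (hf.pow_const q).aemeasurable aemeasurable_const (p := 1 / q) (q := 1 - 1 / q)
    (by positivity) (by rw [sub_nonneg, div_le_one hq0]; exact hq) (by ring)
  simp only [← ENNReal.rpow_mul, mul_one_div_cancel hq0.ne', ENNReal.rpow_one, ENNReal.one_rpow,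
    mul_one, lintegral_const, one_mul] at e
  calc _ ≤ ((∫⁻ x, f x ^ q ∂μ) ^ (1 / q) * μ Set.univ ^ (1 - 1 / q)) ^ q :=
        ENNReal.rpow_le_rpow e hq0.le
    _ = _ := by
        rw [ENNReal.mul_rpow_of_nonneg _ _ hq0.le, ← ENNReal.rpow_mul, ← ENNReal.rpow_mul,
          one_div_mul_cancel hq0.ne', ENNReal.rpow_one, mul_comm]
        congr 2
        field_simp

end General

/-! ### Averages over tents -/

section Fubini

variable {ω : ℂ → ℝ} {ν : Measure Disc} [SFinite ν]

lemma measurable_lintegral_lens {F : Disc × Disc → ℝ≥0∞} (hF : Measurable F) :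
    Measurable fun ζ => ∫⁻ z in lens ζ, F (ζ, z) ∂ν := by
  have : (fun ζ => ∫⁻ z in lens ζ, F (ζ, z) ∂ν)
      = fun ζ => ∫⁻ z, {x : Disc × Disc | x.2 ∈ lens x.1}.indicator F (ζ, z) ∂ν := by
    funext ζ
    rw [← lintegral_indicator (measurableSet_lens ζ)]
    rfl
  rw [this]
  exact Measurable.lintegral_prod_right' (hF.indicator measurableSet_lens_prod)

lemma measurable_lintegral_tent {F : Disc × Disc → ℝ≥0∞} (hF : Measurable F) :
    Measurable fun z => ∫⁻ ζ in tent z, F (ζ, z) ∂weightMeasure ω := by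
  have : (fun z => ∫⁻ ζ in tent z, F (ζ, z) ∂weightMeasure ω)
      = fun z => ∫⁻ ζ, {x : Disc × Disc | x.2 ∈ lens x.1}.indicator F (ζ, z) ∂weightMeasure ω := by
    funext z
    rw [← lintegral_indicator (measurableSet_tent z)]
    rfl
  rw [this]
  exact Measurable.lintegral_prod_left' (hF.indicator measurableSet_lens_prod)

/-- Tonelli for the relation z ∈ Γ(ζ): its sections in one variable are the lenses, in the other the
tents. -/
lemma lintegral_lens_swap {F : Disc × Disc → ℝ≥0∞} (hF : Measurable F) :
    ∫⁻ ζ, ∫⁻ z in lens ζ, F (ζ, z) ∂ν ∂weightMeasure ω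
      = ∫⁻ z, ∫⁻ ζ in tent z, F (ζ, z) ∂weightMeasure ω ∂ν := by
  have e1 : ∀ ζ, ∫⁻ z in lens ζ, F (ζ, z) ∂ν
      = ∫⁻ z, {x : Disc × Disc | x.2 ∈ lens x.1}.indicator F (ζ, z) ∂ν := fun ζ => by
    rw [← lintegral_indicator (measurableSet_lens ζ)]; rfl
  have e2 : ∀ z, ∫⁻ ζ in tent z, F (ζ, z) ∂weightMeasure ω
      = ∫⁻ ζ, {x : Disc × Disc | x.2 ∈ lens x.1}.indicator F (ζ, z) ∂weightMeasure ω := fun z => by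
    rw [← lintegral_indicator (measurableSet_tent z)]; rfl
  simp only [e1, e2]
  exact lintegral_lintegral_swap (hF.indicator measurableSet_lens_prod).aemeasurable

/-- The average over the tent `T(z)`, normalized by `tentMass`. -/
noncomputable def tentAverage (ω : ℂ → ℝ) (F : Disc × Disc → ℝ≥0∞) (z : Disc) : ℝ≥0∞ :=
  (tentMass ω z)⁻¹ * ∫⁻ ζ in tent z, F (ζ, z) ∂weightMeasure ω

lemma measurable_tentAverage {F : Disc × Disc → ℝ≥0∞} (hF : Measurable F) :
    Measurable (tentAverage ω F) :=
  (measurable_tentMass ω).inv.mul (measurable_lintegral_tent hF)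

lemma TentControl.tentAverage_rpow_le {C : ℝ≥0} (H : TentControl ω C) {F : Disc × Disc → ℝ≥0∞}
    (hF : Measurable F) {q : ℝ} (hq : 1 ≤ q) (z : Disc) :
    tentAverage ω F z ^ q ≤ C ^ (q - 1) * tentAverage ω (fun x => F x ^ q) z := by
  have hq0 : 0 ≤ q := by linarith
  have hq1 : 0 ≤ q - 1 := by linarith
  have h0 := H.mass_ne_zero z
  have ht := H.mass_ne_top z
  rw [tentAverage, tentAverage, ENNReal.mul_rpow_of_nonneg _ _ hq0]
  have e := lintegral_rpow_le_measure_univ_rpow_mul (μ := (weightMeasure ω).restrict (tent z))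
    (hF.comp (measurable_prodMk_right (y := z))) hq
  rw [Measure.restrict_apply_univ] at e
  calc _ ≤ (tentMass ω z)⁻¹ ^ q * ((C * tentMass ω z) ^ (q - 1) *
        ∫⁻ ζ in tent z, F (ζ, z) ^ q ∂weightMeasure ω) := by
        refine mul_le_mul_right (e.trans (mul_le_mul_left ?_ _)) _
        exact ENNReal.rpow_le_rpow (H.measure_tent_le z) hq1
    _ = C ^ (q - 1) * ((tentMass ω z) ^ (-q) * tentMass ω z ^ (q - 1) *
        ∫⁻ ζ in tent z, F (ζ, z) ^ q ∂weightMeasure ω) := by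
        rw [ENNReal.mul_rpow_of_nonneg _ _ hq1, ENNReal.inv_rpow, ← ENNReal.rpow_neg]; ring
    _ = _ := by
        rw [← ENNReal.rpow_add _ _ h0 ht, show -q + (q - 1) = -1 by ring, ENNReal.rpow_neg_one]

/-- Averaging over tents is bounded on the mixed norm space `L^p(L^q)` for `1 ≤ q < p`. -/
theorem TentControl.exists_tentAverage_bound {C : ℝ≥0} (H : TentControl ω C) {p q : ℝ}
    (hq : 1 ≤ q) (hqp : q < p) :
    ∃ K : ℝ≥0, ∀ (ν : Measure Disc) [SFinite ν] (F : Disc × Disc → ℝ≥0∞), Measurable F →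
      ∫⁻ ζ, (∫⁻ z in lens ζ, tentAverage ω F z ^ q ∂ν) ^ (p / q) ∂weightMeasure ω
        ≤ K * ∫⁻ ζ, (∫⁻ z in lens ζ, F (ζ, z) ^ q ∂ν) ^ (p / q) ∂weightMeasure ω := by
  have hq0 : 0 < q := by linarith
  have hq1 : 0 ≤ q - 1 := by linarith
  have hfin := H.finite
  have ht : 1 < p / q := (one_lt_div hq0).2 hqp
  set t := p / q with htdef
  have hc := Real.HolderConjugate.conjExponent ht
  set t' := Real.conjExponent t
  obtain ⟨K, hK⟩ := H.strong_type hc.symm.lt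
  set D : ℝ≥0∞ := C ^ (q - 1) * K ^ (1 / t') with hD
  have hDt : D ≠ ∞ := ENNReal.mul_ne_top (ENNReal.rpow_ne_top_of_nonneg hq1 (by simp))
    (ENNReal.rpow_ne_top_of_nonneg hc.symm.one_div_nonneg (by simp))
  refine ⟨(D ^ t).toNNReal, fun ν _ F hF => ?_⟩
  rw [ENNReal.coe_toNNReal (ENNReal.rpow_ne_top_of_nonneg hc.nonneg hDt)]
  have hfm := measurable_tentAverage (ω := ω) hF
  set G : Disc → ℝ≥0∞ := fun ζ => ∫⁻ z in lens ζ, F (ζ, z) ^ q ∂ν with hG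
  have hGm : Measurable G := measurable_lintegral_lens (F := fun x => F x ^ q) (hF.pow_const q)
  have hbm : Measurable fun ζ => ∫⁻ z in lens ζ, tentAverage ω F z ^ q ∂ν :=
    measurable_lintegral_lens (F := fun x => tentAverage ω F x.2 ^ q)
      ((hfm.comp measurable_snd).pow_const q)
  -- Duality in L^{p/q}. Jensen replaces the q-th power of the average by the average of F^q; two
  -- swaps move the averaging from F^q to ψ, and the average of ψ over T(z) is at most its maximal
  -- function at every ζ with z ∈ Γ(ζ). The maximal function is bounded on L^{t'} since t' > 1.
  have key : ∀ ψ : Disc → ℝ≥0∞, Measurable ψ →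
      ∫⁻ ζ, ψ ζ * ∫⁻ z in lens ζ, tentAverage ω F z ^ q ∂ν ∂weightMeasure ω
        ≤ (D * (∫⁻ ζ, G ζ ^ t ∂weightMeasure ω) ^ (1 / t)) *
          (∫⁻ ζ, ψ ζ ^ t' ∂weightMeasure ω) ^ (1 / t') := by
    intro ψ hψ
    have hFq : Measurable fun x => F x ^ q := hF.pow_const q
    have hFl : ∀ z, Measurable fun ζ => F (ζ, z) ^ q := fun z => hFq.comp measurable_prodMk_right
    have hFr : ∀ ζ, Measurable fun z => F (ζ, z) ^ q := fun ζ => hFq.comp measurable_prodMk_left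
    have hψ1 : Measurable fun x : Disc × Disc => ψ x.1 := hψ.comp measurable_fst
    calc ∫⁻ ζ, ψ ζ * ∫⁻ z in lens ζ, tentAverage ω F z ^ q ∂ν ∂weightMeasure ω
        = ∫⁻ ζ, ∫⁻ z in lens ζ, ψ ζ * tentAverage ω F z ^ q ∂ν ∂weightMeasure ω := by
          refine lintegral_congr fun ζ => ?_
          rw [lintegral_const_mul _ (hfm.pow_const q)]
      _ = ∫⁻ z, ∫⁻ ζ in tent z, ψ ζ * tentAverage ω F z ^ q ∂weightMeasure ω ∂ν :=
          lintegral_lens_swap (F := fun x => ψ x.1 * tentAverage ω F x.2 ^ q)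
            (hψ1.mul ((hfm.comp measurable_snd).pow_const q))
      _ ≤ ∫⁻ z, ∫⁻ ζ in tent z, C ^ (q - 1) * tentAverage ω (fun x => ψ x.1) z * F (ζ, z) ^ q
            ∂weightMeasure ω ∂ν := by
          refine lintegral_mono fun z => ?_
          rw [lintegral_mul_const _ hψ, lintegral_const_mul _ (hFl z)]
          refine (mul_le_mul_right (H.tentAverage_rpow_le hF hq z) _).trans (le_of_eq ?_)
          rw [tentAverage, tentAverage]
          ring
      _ = ∫⁻ ζ, ∫⁻ z in lens ζ, C ^ (q - 1) * tentAverage ω (fun x => ψ x.1) z * F (ζ, z) ^ q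
            ∂ν ∂weightMeasure ω :=
          (lintegral_lens_swap (F := fun x => C ^ (q - 1) * tentAverage ω (fun x => ψ x.1) x.2 *
            F x ^ q) ((((measurable_tentAverage hψ1).comp measurable_snd).const_mul _).mul
              hFq)).symm
      _ ≤ ∫⁻ ζ, C ^ (q - 1) * (tentMaximal ω ψ ζ * G ζ) ∂weightMeasure ω := by
          refine lintegral_mono fun ζ => ?_
          rw [← mul_assoc, ← lintegral_const_mul _ (hFr ζ)]
          refine setLIntegral_mono' (measurableSet_lens ζ) fun z hz => ?_
          exact mul_le_mul_left (mul_le_mul_right (le_tentMaximal ω ψ hz) _) _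
      _ = C ^ (q - 1) * ∫⁻ ζ, (tentMaximal ω ψ * G) ζ ∂weightMeasure ω :=
          lintegral_const_mul _ ((measurable_tentMaximal ω ψ).mul hGm)
      _ ≤ C ^ (q - 1) * ((∫⁻ ζ, tentMaximal ω ψ ζ ^ t' ∂weightMeasure ω) ^ (1 / t') *
            (∫⁻ ζ, G ζ ^ t ∂weightMeasure ω) ^ (1 / t)) :=
          mul_le_mul_right (ENNReal.lintegral_mul_le_Lp_mul_Lq _ hc.symm
            (measurable_tentMaximal ω ψ).aemeasurable hGm.aemeasurable) _
      _ ≤ C ^ (q - 1) * ((K * ∫⁻ ζ, ψ ζ ^ t' ∂weightMeasure ω) ^ (1 / t') *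
            (∫⁻ ζ, G ζ ^ t ∂weightMeasure ω) ^ (1 / t)) := by
          gcongr
          · exact hc.symm.one_div_nonneg
          · exact hK ψ hψ
      _ = _ := by
          rw [ENNReal.mul_rpow_of_nonneg _ _ hc.symm.one_div_nonneg, hD]; ring
  refine (lintegral_rpow_le_of_forall_mul_le hbm hc key).trans (le_of_eq ?_)
  rw [ENNReal.mul_rpow_of_nonneg _ _ hc.nonneg, ← ENNReal.rpow_mul, one_div_mul_cancel hc.ne_zero,
    ENNReal.rpow_one]

end Fubini

end TentDuality

/-! ### Test functions and the converse estimate for 1 < p, q < ∞ -/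

namespace TentDuality

/-- `g` pairs with every nonnegative `f` with constant `N` times the `T^p_q` norm of `f`. -/
def TestBound (ν : Measure Disc) (ω : ℂ → ℝ) (p q : ℝ) (N : ℝ≥0∞) (g : Disc → ℝ≥0∞) : Prop :=
  ∀ f : Disc → ℝ≥0∞, Measurable f → ∫⁻ z, f z * g z * tentMass ω z ∂ν
    ≤ N * (∫⁻ ζ, (∫⁻ z in lens ζ, f z ^ q ∂ν) ^ (p / q) ∂weightMeasure ω) ^ (1 / p)

variable {ω : ℂ → ℝ} {C : ℝ≥0}

lemma TestBound.mono {ν : Measure Disc} {p q : ℝ} {N : ℝ≥0∞} {g g' : Disc → ℝ≥0∞}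
    (h : TestBound ν ω p q N g) (hg : ∀ z, g' z ≤ g z) : TestBound ν ω p q N g' := fun f hf =>
  (lintegral_mono fun z => mul_le_mul_left (mul_le_mul_right (hg z) _) _).trans (h f hf)

/-- After swapping, the factor tentMass in the pairing cancels the normalization of the average. So
the tent average of F pairs with `g` exactly as F does on the product, and the test bound extends to
functions of two variables. -/
lemma TestBound.lintegral_mul_le (H : TentControl ω C) {ν : Measure Disc} [SFinite ν] {p q : ℝ}
    {N : ℝ≥0∞} {g : Disc → ℝ≥0∞} (h : TestBound ν ω p q N g) (hg : Measurable g)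
    {F : Disc × Disc → ℝ≥0∞} (hF : Measurable F) :
    ∫⁻ ζ, ∫⁻ z in lens ζ, F (ζ, z) * g z ∂ν ∂weightMeasure ω
      ≤ N * (∫⁻ ζ, (∫⁻ z in lens ζ, tentAverage ω F z ^ q ∂ν) ^ (p / q) ∂weightMeasure ω)
        ^ (1 / p) := by
  refine le_trans (le_of_eq ?_) (h _ (measurable_tentAverage hF))
  rw [lintegral_lens_swap (F := fun x => F x * g x.2) (hF.mul (hg.comp measurable_snd))]
  refine lintegral_congr fun z => ?_
  have hFl : Measurable fun ζ => F (ζ, z) := hF.comp measurable_prodMk_right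
  dsimp only
  rw [lintegral_mul_const _ hFl, tentAverage]
  calc _ = ((tentMass ω z)⁻¹ * tentMass ω z) *
        ((∫⁻ ζ in tent z, F (ζ, z) ∂weightMeasure ω) * g z) := by
        rw [ENNReal.inv_mul_cancel (H.mass_ne_zero z) (H.mass_ne_top z), one_mul]
    _ = _ := by ring

lemma rpow_sub_one_mul_self {x : ℝ≥0∞} {r : ℝ} (hr : 1 ≤ r) : x ^ (r - 1) * x = x ^ r := by
  conv_lhs => rw [← ENNReal.rpow_one x, ← ENNReal.rpow_mul, one_mul]
  rw [← ENNReal.rpow_add_of_nonneg _ _ (by linarith) zero_le_one, sub_add_cancel]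

/-- For r < 1 the exponent r - 1 is negative and x = ∞ would give 0 · ∞ = 0. This case occurs with r
= p'/q'. -/
lemma rpow_sub_one_mul_self' {x : ℝ≥0∞} (hx : x ≠ ∞) {r : ℝ} (hr : 0 < r) :
    x ^ (r - 1) * x = x ^ r := by
  by_cases h0 : x = 0
  · rw [h0, mul_zero, ENNReal.zero_rpow_of_pos hr]
  · conv_lhs => rw [← ENNReal.rpow_one x, ← ENNReal.rpow_mul, one_mul]
    rw [← ENNReal.rpow_add _ _ h0 hx, sub_add_cancel]

lemma tentMaximal_const_le (H : TentControl ω C) (ζ : Disc) :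
    tentMaximal ω (fun _ => 1) ζ ≤ C := by
  refine iSup₂_le fun z _ => ?_
  rw [setLIntegral_const, one_mul]
  refine (mul_le_mul_right (H.measure_tent_le z) _).trans (le_of_eq ?_)
  rw [mul_left_comm, ENNReal.inv_mul_cancel (H.mass_ne_zero z) (H.mass_ne_top z), mul_one]

/-- The bound for the averages of the extremal function of the pairing. -/
lemma TentControl.exists_extremal_bound (H : TentControl ω C) {p q p' q' : ℝ}
    (hp : p.HolderConjugate p') (hq : q.HolderConjugate q') :
    ∃ K : ℝ≥0, ∀ (ν : Measure Disc) [SFinite ν] (g : Disc → ℝ≥0∞), Measurable g →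
      (∀ ζ, ∫⁻ z in lens ζ, g z ^ q' ∂ν ≠ ∞) →
      ∫⁻ ζ, (∫⁻ z in lens ζ, tentAverage ω
        (fun x => (∫⁻ w in lens x.1, g w ^ q' ∂ν) ^ (p' / q' - 1) * g x.2 ^ (q' - 1)) z ^ q ∂ν)
          ^ (p / q) ∂weightMeasure ω
        ≤ K * ∫⁻ ζ, (∫⁻ z in lens ζ, g z ^ q' ∂ν) ^ (p' / q') ∂weightMeasure ω := by
  have hp0 := hp.pos
  have hq0 := hq.pos
  have hp'0 := hp.symm.pos
  have hq'0 := hq.symm.pos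
  have ep := hp.mul_eq_add
  have eq := hq.mul_eq_add
  -- For q < p averaging is bounded on the mixed norm space, and only the norm of the extremal
  -- function remains to be computed. For p ≤ q the exponent p'/q' - 1 is nonnegative, and the
  -- average factors into an average of G^e times g^(q'-1), which the maximal function dominates
  -- pointwise.
  rcases lt_or_ge q p with hqp | hpq
  · obtain ⟨K, hK⟩ := H.exists_tentAverage_bound hq.lt.le hqp
    refine ⟨K, fun ν _ g hg hfin => ?_⟩
    have hG : Measurable fun ζ => ∫⁻ z in lens ζ, g z ^ q' ∂ν :=
      measurable_lintegral_lens (F := fun x => g x.2 ^ q') ((hg.comp measurable_snd).pow_const q')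
    refine (hK ν _ (((hG.comp measurable_fst).pow_const _).mul
      ((hg.comp measurable_snd).pow_const _))).trans (le_of_eq ?_)
    congr 1
    refine lintegral_congr fun ζ => ?_
    set x := ∫⁻ w in lens ζ, g w ^ q' ∂ν with hx
    have e1 : ∫⁻ z in lens ζ, (x ^ (p' / q' - 1) * g z ^ (q' - 1)) ^ q ∂ν
        = x ^ ((p' / q' - 1) * q) * x := by
      simp only [ENNReal.mul_rpow_of_nonneg _ _ hq0.le, ← ENNReal.rpow_mul,
        hq.symm.sub_one_mul_conj]
      rw [lintegral_const_mul _ (hg.pow_const _)]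
    change (∫⁻ z in lens ζ, (x ^ (p' / q' - 1) * g z ^ (q' - 1)) ^ q ∂ν) ^ (p / q) = _
    rw [e1]
    -- Here p' < q', so a negative power of x occurs; at x = 0 the product is ∞ · 0 = 0.
    by_cases h0 : x = 0
    · rw [h0, mul_zero, ENNReal.zero_rpow_of_pos (by positivity),
        ENNReal.zero_rpow_of_pos (by positivity)]
    · have e2 : x ^ ((p' / q' - 1) * q) * x = x ^ ((p' / q' - 1) * q + 1) := by
        rw [ENNReal.rpow_add _ _ h0 (hfin ζ), ENNReal.rpow_one]
      rw [e2, ← ENNReal.rpow_mul]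
      congr 1
      field_simp
      linear_combination (q) * ep - p * eq
  · have he : 0 ≤ p' / q' - 1 := by
      rw [sub_nonneg, one_le_div hq'0]
      have h1 := hp.one_sub_inv
      have h2 := hq.one_sub_inv
      have h3 : q⁻¹ ≤ p⁻¹ := inv_anti₀ hp0 hpq
      exact (inv_le_inv₀ hp'0 hq'0).1 (by linarith)
    set e := p' / q' - 1 with hedef
    have key : ∃ K : ℝ≥0, ∀ G : Disc → ℝ≥0∞, Measurable G →
        ∫⁻ ζ, tentMaximal ω (fun x => G x ^ e) ζ ^ p * G ζ ^ (p / q) ∂weightMeasure ω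
          ≤ K * ∫⁻ ζ, G ζ ^ (p' / q') ∂weightMeasure ω := by
      -- For e = 0 one has p = q, and only the maximal function of the constant 1 enters, so no L^s
      -- bound is needed.
      rcases he.eq_or_lt with he0 | he0
      · refine ⟨C ^ p, fun G hG => ?_⟩
        have h1 : p' = q' := by
          rw [hedef, eq_comm, sub_eq_zero, div_eq_one_iff_eq hq'0.ne'] at he0
          exact he0
        have h2 : p = q := by
          have h3 := hp.symm.conjugate_eq
          rw [h1, ← hq.symm.conjugate_eq] at h3
          exact h3
        simp only [← he0, ENNReal.rpow_zero]
        rw [← lintegral_const_mul' _ _ (by simp)]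
        refine lintegral_mono fun ζ => ?_
        rw [h1, h2, div_self hq0.ne', div_self hq'0.ne', ENNReal.coe_rpow_of_nonneg _ hq0.le]
        exact mul_le_mul_left (ENNReal.rpow_le_rpow (tentMaximal_const_le H ζ) hq0.le) _
      · set s := (p' / q') / e with hs
        have hs1 : 1 < s := by
          rw [hs, one_lt_div he0, hedef]; linarith
        have hs0 : 0 < s := by linarith
        obtain ⟨K, hK⟩ := H.strong_type hs1
        -- The exponent s is chosen so that (G^e)^s = G^(p'/q'). The powers p/s and b of the two
        -- integrals then add up to 1, by conjugacy of both pairs.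
        set b := (p / q) / (p' / q') with hb
        have hsum : p / s + b = 1 := by
          rw [hs, hb, hedef]
          field_simp
          linear_combination (q) * ep - p * eq
        refine ⟨K ^ (p / s), fun G hG => ?_⟩
        have hps : 0 ≤ p / s := by positivity
        calc ∫⁻ ζ, tentMaximal ω (fun x => G x ^ e) ζ ^ p * G ζ ^ (p / q) ∂weightMeasure ω
            = ∫⁻ ζ, (tentMaximal ω (fun x => G x ^ e) ζ ^ s) ^ (p / s) *
              (G ζ ^ (p' / q')) ^ b ∂weightMeasure ω := by
              refine lintegral_congr fun ζ => ?_
              rw [← ENNReal.rpow_mul, ← ENNReal.rpow_mul, mul_div_cancel₀ _ hs0.ne', hb,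
                mul_div_cancel₀ _ (by positivity)]
          _ ≤ (∫⁻ ζ, tentMaximal ω (fun x => G x ^ e) ζ ^ s ∂weightMeasure ω) ^ (p / s) *
              (∫⁻ ζ, G ζ ^ (p' / q') ∂weightMeasure ω) ^ b :=
              ENNReal.lintegral_mul_norm_pow_le
                ((measurable_tentMaximal _ _).pow_const _).aemeasurable
                (hG.pow_const _).aemeasurable hps (by positivity) hsum
          _ ≤ (K * ∫⁻ ζ, G ζ ^ (p' / q') ∂weightMeasure ω) ^ (p / s) *
              (∫⁻ ζ, G ζ ^ (p' / q') ∂weightMeasure ω) ^ b := by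
              refine mul_le_mul_left (ENNReal.rpow_le_rpow ((hK _ (hG.pow_const _)).trans
                (le_of_eq ?_)) hps) _
              simp only [← ENNReal.rpow_mul, hs, mul_div_cancel₀ _ he0.ne']
          _ = _ := by
              rw [ENNReal.mul_rpow_of_nonneg _ _ hps, mul_assoc,
                ← ENNReal.rpow_add_of_nonneg _ _ hps (by positivity), hsum, ENNReal.rpow_one,
                ENNReal.coe_rpow_of_nonneg _ hps]
    obtain ⟨K, hK⟩ := key
    refine ⟨K, fun ν _ g hg hfin => ?_⟩
    set G : Disc → ℝ≥0∞ := fun ζ => ∫⁻ z in lens ζ, g z ^ q' ∂ν with hGdef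
    have hG : Measurable G :=
      measurable_lintegral_lens (F := fun x => g x.2 ^ q') ((hg.comp measurable_snd).pow_const q')
    refine le_trans (lintegral_mono fun ζ => ?_) (hK G hG)
    have e1 : ∫⁻ z in lens ζ, tentAverage ω (fun x => G x.1 ^ e * g x.2 ^ (q' - 1)) z ^ q ∂ν
        ≤ tentMaximal ω (fun x => G x ^ e) ζ ^ q * G ζ := by
      rw [hGdef, ← lintegral_const_mul _ (hg.pow_const q')]
      refine setLIntegral_mono' (measurableSet_lens ζ) fun z hz => ?_
      have e2 : tentAverage ω (fun x => G x.1 ^ e * g x.2 ^ (q' - 1)) z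
          ≤ tentMaximal ω (fun x => G x ^ e) ζ * g z ^ (q' - 1) := by
        rw [tentAverage]
        dsimp only
        rw [lintegral_mul_const _ (hG.pow_const e), ← mul_assoc]
        exact mul_le_mul_left (le_tentMaximal ω _ hz) _
      refine (ENNReal.rpow_le_rpow e2 hq0.le).trans (le_of_eq ?_)
      rw [ENNReal.mul_rpow_of_nonneg _ _ hq0.le, ← ENNReal.rpow_mul, hq.symm.sub_one_mul_conj]
    refine (ENNReal.rpow_le_rpow e1 (by positivity)).trans (le_of_eq ?_)
    rw [ENNReal.mul_rpow_of_nonneg _ _ (by positivity), ← ENNReal.rpow_mul,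
      mul_div_cancel₀ _ hq0.ne']

/-- The converse estimate for `1 < p, q < ∞`, for `g` of finite norm. -/
lemma TentControl.exists_norm_le_of_testBound (H : TentControl ω C) {p q p' q' : ℝ}
    (hp : p.HolderConjugate p') (hq : q.HolderConjugate q') :
    ∃ K : ℝ≥0, ∀ (ν : Measure Disc) [SFinite ν] (N : ℝ≥0∞) (g : Disc → ℝ≥0∞), Measurable g →
      (∀ ζ, ∫⁻ z in lens ζ, g z ^ q' ∂ν ≠ ∞) →
      ∫⁻ ζ, (∫⁻ z in lens ζ, g z ^ q' ∂ν) ^ (p' / q') ∂weightMeasure ω ≠ ∞ →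
      TestBound ν ω p q N g →
      ∫⁻ ζ, (∫⁻ z in lens ζ, g z ^ q' ∂ν) ^ (p' / q') ∂weightMeasure ω ≤ (K * N) ^ p' := by
  obtain ⟨K, hK⟩ := H.exists_extremal_bound hp hq
  refine ⟨K ^ (1 / p), fun ν _ N g hg hfin hfin' h => ?_⟩
  have hG : Measurable fun ζ => ∫⁻ z in lens ζ, g z ^ q' ∂ν :=
    measurable_lintegral_lens (F := fun x => g x.2 ^ q') ((hg.comp measurable_snd).pow_const q')
  refine ennreal_le_rpow_of_le_mul_rpow hp.symm hfin' ?_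
  -- This F is the extremal function of the mixed norm: multiplied by g and integrated over the lens
  -- it gives G^(p'/q'), where G is the lens integral of g^q'. The mixed norm of its averages is at
  -- most a constant times the integral of G^(p'/q') to the power 1/p, which is absorbed.
  have h1 := h.lintegral_mul_le H hg (F := fun x => (∫⁻ w in lens x.1, g w ^ q' ∂ν) ^ (p' / q' - 1)
    * g x.2 ^ (q' - 1)) (((hG.comp measurable_fst).pow_const _).mul
      ((hg.comp measurable_snd).pow_const _))
  refine le_trans (le_of_eq ?_) (h1.trans ?_)
  · refine lintegral_congr fun ζ => ?_
    simp only [mul_assoc, rpow_sub_one_mul_self hq.symm.lt.le]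
    rw [lintegral_const_mul _ (hg.pow_const q'),
      rpow_sub_one_mul_self' (hfin ζ) (div_pos hp.symm.pos hq.symm.pos)]
  · refine (mul_le_mul_right (ENNReal.rpow_le_rpow (hK ν g hg hfin) hp.one_div_nonneg) _).trans
      (le_of_eq ?_)
    rw [ENNReal.mul_rpow_of_nonneg _ _ hp.one_div_nonneg,
      ENNReal.coe_rpow_of_nonneg _ hp.one_div_nonneg]
    ring

end TentDuality

/-! ### The converse estimate at the endpoints q = 1 and p = 1 -/

namespace TentDuality

variable {ω : ℂ → ℝ} {C : ℝ≥0}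

/-- The converse estimate for `q = 1 < p`, for `g` bounded and supported on a set of finite
measure. -/
lemma TentControl.exists_norm_le_of_testBound_one (H : TentControl ω C) {p p' : ℝ}
    (hp : p.HolderConjugate p') :
    ∃ K : ℝ≥0, ∀ (ν : Measure Disc) [SFinite ν] (N : ℝ≥0∞) (g : Disc → ℂ) (B : ℝ≥0), Measurable g →
      (∀ z, ‖g z‖ₑ ≤ B) → ν {z | g z ≠ 0} ≠ ∞ →
      TestBound ν ω p 1 N (fun z => ‖g z‖ₑ) →
      ∫⁻ ζ, areaFunction ν ∞ g ζ ^ p' ∂weightMeasure ω ≤ (K * N) ^ p' := by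
  obtain ⟨K, hK⟩ := H.exists_tentAverage_bound le_rfl hp.lt
  refine ⟨2 * K ^ (1 / p), fun ν _ N g B hg hB hν h => ?_⟩
  have hfinite := H.finite
  have hge : Measurable fun z => ‖g z‖ₑ := hg.enorm
  have hA : Measurable (areaFunction ν ∞ g) := measurable_areaFunction ν le_top hg
  have hAB : ∀ ζ, areaFunction ν ∞ g ζ ≤ B := fun ζ => by
    rw [areaFunction, eLpNorm_exponent_top]
    exact essSup_le_of_ae_le _ (Eventually.of_forall hB)
  have hAt : ∀ ζ, areaFunction ν ∞ g ζ ≠ ∞ := fun ζ => ne_top_of_le_ne_top (by simp) (hAB ζ)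
  refine ennreal_le_rpow_of_le_mul_rpow hp.symm ?_ ?_
  · refine ne_top_of_le_ne_top (b := ∫⁻ _, (B : ℝ≥0∞) ^ p' ∂weightMeasure ω) ?_
      (lintegral_mono fun ζ => ENNReal.rpow_le_rpow (hAB ζ) hp.symm.nonneg)
    rw [lintegral_const]
    exact ENNReal.mul_ne_top (ENNReal.rpow_ne_top_of_nonneg hp.symm.nonneg (by simp))
      (measure_ne_top _ _)
  set A := areaFunction ν ∞ g with hAdef
  -- The essential supremum need not be attained, so the extremal function is concentrated where |g|
  -- exceeds half of it; this costs the factor 2.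
  set E : Set (Disc × Disc) := {x | x.2 ∈ lens x.1} ∩ {x | A x.1 / 2 < ‖g x.2‖ₑ} with hE
  have hEm : MeasurableSet E := measurableSet_lens_prod.inter
    (measurableSet_lt ((hA.comp measurable_fst).div_const 2) (hge.comp measurable_snd))
  set e : Disc → ℝ≥0∞ := fun ζ => ν (Prod.mk ζ ⁻¹' E) with he
  have hem : Measurable e := measurable_measure_prodMk_left hEm
  -- Dividing by the ν-measure of the slice makes the integral of F over Γ(ζ) at most A(ζ)^(p'-1).
  set F : Disc × Disc → ℝ≥0∞ := fun x => (A x.1 ^ (p' - 1) * (e x.1)⁻¹) * E.indicator 1 x with hF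
  have hFm : Measurable F := (((hA.pow_const _).mul hem.inv).comp measurable_fst).mul
    (measurable_one.indicator hEm)
  have hslice : ∀ ζ, MeasurableSet (Prod.mk ζ ⁻¹' E) := fun ζ => measurable_prodMk_left hEm
  have hind : ∀ ζ z, E.indicator (1 : Disc × Disc → ℝ≥0∞) (ζ, z)
      = (Prod.mk ζ ⁻¹' E).indicator 1 z := fun ζ z => rfl
  have hEsub : ∀ ζ, Prod.mk ζ ⁻¹' E ∩ lens ζ = Prod.mk ζ ⁻¹' E := fun ζ =>
    Set.inter_eq_left.2 fun z hz => hz.1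
  have h1 : ∀ ζ, ∫⁻ z in lens ζ, F (ζ, z) ^ (1 : ℝ) ∂ν ≤ A ζ ^ (p' - 1) := by
    intro ζ
    simp only [ENNReal.rpow_one, hF, hind]
    rw [lintegral_const_mul _ (measurable_one.indicator (hslice ζ)),
      lintegral_indicator_one (hslice ζ), Measure.restrict_apply (hslice ζ), hEsub, mul_assoc]
    exact mul_le_of_le_one_right zero_le (ENNReal.inv_mul_le_one _)
  have h2 : ∀ ζ, A ζ ^ p' ≤ 2 * ∫⁻ z in lens ζ, F (ζ, z) * ‖g z‖ₑ ∂ν := by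
    intro ζ
    by_cases h0 : A ζ = 0
    · rw [h0, ENNReal.zero_rpow_of_pos hp.symm.pos]; exact zero_le
    have he0 : e ζ ≠ 0 := by
      intro h
      have hle : A ζ ≤ A ζ / 2 := by
        conv_lhs => rw [hAdef, areaFunction, eLpNorm_exponent_top]
        refine essSup_le_of_ae_le _ ?_
        rw [EventuallyLE, ae_iff]
        rw [Measure.restrict_apply' (measurableSet_lens ζ), ← h]
        congr 1
        ext z
        simp only [Set.mem_inter_iff, Set.mem_ofPred_eq, not_le, hE, Set.mem_preimage]
        exact and_comm
      exact absurd hle (ENNReal.half_lt_self h0 (hAt ζ)).not_ge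
    -- The finite measure of the support of g is needed here: on a slice of infinite measure, F
    -- would vanish.
    have het : e ζ ≠ ∞ := by
      refine ne_top_of_le_ne_top hν (measure_mono fun z hz h => ?_)
      have : A ζ / 2 < ‖g z‖ₑ := hz.2
      rw [h, enorm_zero] at this
      exact not_lt_zero this
    have h3 : A ζ ^ (p' - 1) * (e ζ)⁻¹ * (A ζ / 2) * e ζ
        ≤ ∫⁻ z in lens ζ, F (ζ, z) * ‖g z‖ₑ ∂ν := by
      calc A ζ ^ (p' - 1) * (e ζ)⁻¹ * (A ζ / 2) * e ζ
          = ∫⁻ z in lens ζ, (A ζ ^ (p' - 1) * (e ζ)⁻¹ * (A ζ / 2)) *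
              (Prod.mk ζ ⁻¹' E).indicator 1 z ∂ν := by
            rw [lintegral_const_mul _ (measurable_one.indicator (hslice ζ)),
              lintegral_indicator_one (hslice ζ), Measure.restrict_apply (hslice ζ), hEsub]
        _ ≤ _ := by
            refine lintegral_mono fun z => ?_
            simp only [hF, hind]
            by_cases hz : z ∈ Prod.mk ζ ⁻¹' E
            · simp only [Set.indicator_of_mem hz, Pi.one_apply, mul_one]
              exact mul_le_mul_right (le_of_lt hz.2) _
            · simp only [Set.indicator_of_notMem hz, mul_zero, zero_mul, le_refl]
    calc A ζ ^ p' = A ζ ^ (p' - 1) * A ζ := (rpow_sub_one_mul_self hp.symm.lt.le).symm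
      _ = 2 * (A ζ ^ (p' - 1) * (e ζ)⁻¹ * (A ζ / 2) * e ζ) := by
          rw [show 2 * (A ζ ^ (p' - 1) * (e ζ)⁻¹ * (A ζ / 2) * e ζ)
            = A ζ ^ (p' - 1) * (A ζ / 2 * 2) * ((e ζ)⁻¹ * e ζ) by ring,
            ENNReal.inv_mul_cancel he0 het, ENNReal.div_mul_cancel (by simp) (by simp), mul_one]
      _ ≤ _ := mul_le_mul_right h3 _
  have h4 := h.lintegral_mul_le H hge hFm
  have h5 := hK ν F hFm
  calc ∫⁻ ζ, A ζ ^ p' ∂weightMeasure ω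
      ≤ ∫⁻ ζ, 2 * ∫⁻ z in lens ζ, F (ζ, z) * ‖g z‖ₑ ∂ν ∂weightMeasure ω := lintegral_mono h2
    _ = 2 * ∫⁻ ζ, ∫⁻ z in lens ζ, F (ζ, z) * ‖g z‖ₑ ∂ν ∂weightMeasure ω :=
        lintegral_const_mul' _ _ (by simp)
    _ ≤ 2 * (N * (K * ∫⁻ ζ, (A ζ ^ (p' - 1)) ^ (p / 1) ∂weightMeasure ω) ^ (1 / p)) := by
        refine mul_le_mul_right (h4.trans (mul_le_mul_right (ENNReal.rpow_le_rpow
          (h5.trans (mul_le_mul_right (lintegral_mono fun ζ => ?_) _)) hp.one_div_nonneg) _)) _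
        exact ENNReal.rpow_le_rpow (h1 ζ) (by simpa using hp.nonneg)
    _ = _ := by
        simp only [← ENNReal.rpow_mul, div_one, hp.symm.sub_one_mul_conj]
        rw [ENNReal.mul_rpow_of_nonneg _ _ hp.one_div_nonneg, ENNReal.coe_mul,
          ENNReal.coe_rpow_of_nonneg _ hp.one_div_nonneg]
        push_cast
        ring

/-- The converse estimate for `p = 1 < q` on a tent. -/
lemma TestBound.lintegral_tent_le (H : TentControl ω C) {q q' : ℝ} (hq : q.HolderConjugate q')
    {ν : Measure Disc} [SFinite ν] {N : ℝ≥0∞} {g : Disc → ℝ≥0∞} (hg : Measurable g)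
    (h : TestBound ν ω 1 q N g) (a : Disc)
    (hfin : ∫⁻ z in tent a, g z ^ q' * tentMass ω z ∂ν ≠ ∞) :
    ∫⁻ z in tent a, g z ^ q' * tentMass ω z ∂ν ≤ (C * N) ^ q' * tentMass ω a := by
  set X := ∫⁻ z in tent a, g z ^ q' * tentMass ω z ∂ν with hX
  have hT := measurableSet_tent a
  -- With this choice f^q = g^q' and f g = g^q' on T(a), so the pairing with g is X itself.
  set f : Disc → ℝ≥0∞ := (tent a).indicator fun z => g z ^ (q' - 1) with hf
  have hfm : Measurable f := (hg.pow_const _).indicator hT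
  have hfq : ∀ z, f z ^ q = (tent a).indicator (fun z => g z ^ q') z := by
    intro z
    by_cases hz : z ∈ tent a
    · rw [hf, Set.indicator_of_mem hz, Set.indicator_of_mem hz, ← ENNReal.rpow_mul,
        hq.symm.sub_one_mul_conj]
    · rw [hf, Set.indicator_of_notMem hz, Set.indicator_of_notMem hz, ENNReal.zero_rpow_of_pos hq.pos]
  have e1 : ∫⁻ z, f z * g z * tentMass ω z ∂ν = X := by
    rw [hX, ← lintegral_indicator hT]
    refine lintegral_congr fun z => ?_
    by_cases hz : z ∈ tent a
    · rw [hf, Set.indicator_of_mem hz, Set.indicator_of_mem hz,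
        rpow_sub_one_mul_self hq.symm.lt.le]
    · rw [hf, Set.indicator_of_notMem hz, Set.indicator_of_notMem hz, zero_mul, zero_mul]
  set b : Disc → ℝ≥0∞ := fun ζ => ∫⁻ z in lens ζ, f z ^ q ∂ν with hb
  have hbm : Measurable b := measurable_lintegral_lens (F := fun x => f x.2 ^ q)
    ((hfm.comp measurable_snd).pow_const q)
  have e2 : ∫⁻ ζ, b ζ ∂weightMeasure ω ≤ C * X := by
    rw [hb, lintegral_lens_swap (F := fun x => f x.2 ^ q) ((hfm.comp measurable_snd).pow_const q),
      hX, ← lintegral_indicator hT, ← lintegral_const_mul' _ _ ENNReal.coe_ne_top]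
    refine lintegral_mono fun z => ?_
    dsimp only
    rw [setLIntegral_const, hfq]
    by_cases hz : z ∈ tent a
    · rw [Set.indicator_of_mem hz, Set.indicator_of_mem hz, mul_left_comm]
      exact mul_le_mul_right (H.measure_tent_le z) _
    · rw [Set.indicator_of_notMem hz, zero_mul]; exact zero_le
  -- A lens that meets T(a) has its vertex in the wide tent of a. Inserting that indicator lets
  -- Hölder trade the integral of b^(1/q) for the integral of b and the mass of the wide tent.
  have e3 : ∀ ζ, b ζ ^ (1 / q) = b ζ ^ (1 / q) * (wideTent a).indicator 1 ζ ^ (1 / q') := by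
    intro ζ
    by_cases hζ : ζ ∈ wideTent a
    · rw [Set.indicator_of_mem hζ, Pi.one_apply, ENNReal.one_rpow, mul_one]
    · have : b ζ = 0 := by
        rw [hb]
        refine setLIntegral_eq_zero (measurableSet_lens ζ) fun z hz => ?_
        rw [hfq, Set.indicator_of_notMem fun hza => hζ (tent_subset_wideTent hza hz)]
        rfl
      rw [this, ENNReal.zero_rpow_of_pos hq.one_div_pos, zero_mul]
  have e4 : ∫⁻ ζ, b ζ ^ (1 / q) ∂weightMeasure ω ≤
      (C * X) ^ (1 / q) * (C * tentMass ω a) ^ (1 / q') := by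
    calc _ = ∫⁻ ζ, b ζ ^ (1 / q) * (wideTent a).indicator 1 ζ ^ (1 / q') ∂weightMeasure ω :=
          lintegral_congr e3
      _ ≤ (∫⁻ ζ, b ζ ∂weightMeasure ω) ^ (1 / q) *
          (∫⁻ ζ, (wideTent a).indicator 1 ζ ∂weightMeasure ω) ^ (1 / q') :=
          ENNReal.lintegral_mul_norm_pow_le hbm.aemeasurable
            (measurable_one.indicator (measurableSet_wideTent a)).aemeasurable
            hq.one_div_nonneg hq.symm.one_div_nonneg (by
              rw [one_div, one_div, hq.inv_add_inv_eq_one])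
      _ ≤ _ := by
          rw [lintegral_indicator_one (measurableSet_wideTent a)]
          exact mul_le_mul' (ENNReal.rpow_le_rpow e2 hq.one_div_nonneg)
            (ENNReal.rpow_le_rpow (H.wide a) hq.symm.one_div_nonneg)
  have e5 := h f hfm
  rw [e1] at e5
  simp only [div_one, ENNReal.rpow_one] at e5
  have e6 : X ≤ (C * N * tentMass ω a ^ (1 / q')) * X ^ (1 / q) := by
    refine e5.trans ((mul_le_mul_right e4 _).trans (le_of_eq ?_))
    rw [ENNReal.mul_rpow_of_nonneg _ _ hq.one_div_nonneg,
      ENNReal.mul_rpow_of_nonneg _ _ hq.symm.one_div_nonneg]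
    have : (C : ℝ≥0∞) ^ (1 / q) * (C : ℝ≥0∞) ^ (1 / q') = C := by
      rw [← ENNReal.rpow_add_of_nonneg _ _ hq.one_div_nonneg hq.symm.one_div_nonneg, one_div,
        one_div, hq.inv_add_inv_eq_one, ENNReal.rpow_one]
    calc _ = ((C : ℝ≥0∞) ^ (1 / q) * (C : ℝ≥0∞) ^ (1 / q')) * N * tentMass ω a ^ (1 / q') *
          X ^ (1 / q) := by ring
      _ = _ := by rw [this]
  refine (ennreal_le_rpow_of_le_mul_rpow hq.symm hfin e6).trans (le_of_eq ?_)
  rw [ENNReal.mul_rpow_of_nonneg _ _ hq.symm.nonneg, ← ENNReal.rpow_mul,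
    one_div_mul_cancel hq.symm.ne_zero, ENNReal.rpow_one]

/-! ### Truncation -/

/-- The truncation of `g` to a compact set on which it is bounded by `n`. -/
noncomputable def truncation (g : Disc → ℂ) (n : ℕ) : Disc → ℂ :=
  (compactCovering Disc n ∩ {z | ‖g z‖ ≤ n}).indicator g

lemma measurable_truncation {g : Disc → ℂ} (hg : Measurable g) (n : ℕ) :
    Measurable (truncation g n) :=
  hg.indicator ((isCompact_compactCovering Disc n).isClosed.measurableSet.inter
    (measurableSet_le hg.norm measurable_const))

lemma enorm_truncation_le (g : Disc → ℂ) (n : ℕ) (z : Disc) : ‖truncation g n z‖ₑ ≤ ‖g z‖ₑ :=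
  enorm_indicator_le_enorm_self _ _

lemma enorm_truncation_le_indicator (g : Disc → ℂ) (n : ℕ) (z : Disc) :
    ‖truncation g n z‖ₑ ≤ (compactCovering Disc n).indicator (fun _ => (n : ℝ≥0∞)) z := by
  by_cases hz : z ∈ compactCovering Disc n ∩ {z | ‖g z‖ ≤ n}
  · rw [truncation, Set.indicator_of_mem hz, Set.indicator_of_mem hz.1, ← ofReal_norm,
      ← ENNReal.ofReal_natCast]
    exact ENNReal.ofReal_le_ofReal hz.2
  · rw [truncation, Set.indicator_of_notMem hz, enorm_zero]; exact zero_le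

lemma monotone_enorm_truncation (g : Disc → ℂ) (z : Disc) :
    Monotone fun n => ‖truncation g n z‖ₑ := by
  intro m n hmn
  by_cases hz : z ∈ compactCovering Disc m ∩ {z | ‖g z‖ ≤ m}
  · have hz' : z ∈ compactCovering Disc n ∩ {z | ‖g z‖ ≤ n} :=
      ⟨compactCovering_subset Disc hmn hz.1,
        le_trans (b := (m : ℝ)) hz.2 (by exact_mod_cast hmn)⟩
    simp only [truncation, Set.indicator_of_mem hz, Set.indicator_of_mem hz', le_refl]
  · simp only [truncation, Set.indicator_of_notMem hz, enorm_zero, zero_le]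

lemma eventually_truncation_eq (g : Disc → ℂ) (z : Disc) :
    ∀ᶠ n in atTop, truncation g n z = g z := by
  obtain ⟨k, hk⟩ := exists_mem_compactCovering z
  obtain ⟨l, hl⟩ := exists_nat_ge ‖g z‖
  filter_upwards [eventually_ge_atTop (max k l)] with n hn
  have hz : z ∈ compactCovering Disc n ∩ {z | ‖g z‖ ≤ n} :=
    ⟨compactCovering_subset Disc ((le_max_left _ _).trans hn) hk,
      le_trans (b := (l : ℝ)) hl (by exact_mod_cast (le_max_right _ _).trans hn)⟩
  exact Set.indicator_of_mem hz g

lemma tendsto_enorm_truncation_rpow (g : Disc → ℂ) (z : Disc) (r : ℝ) :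
    Tendsto (fun n => ‖truncation g n z‖ₑ ^ r) atTop (𝓝 (‖g z‖ₑ ^ r)) :=
  tendsto_const_nhds.congr' ((eventually_truncation_eq g z).mono fun n hn => by simp only [hn])

lemma lintegral_enorm_truncation_rpow_le (ν : Measure Disc) (g : Disc → ℂ) (n : ℕ) {r : ℝ}
    (hr : 0 < r) (s : Set Disc) :
    ∫⁻ z in s, ‖truncation g n z‖ₑ ^ r ∂ν ≤ (n : ℝ≥0∞) ^ r * ν (compactCovering Disc n) := by
  refine (lintegral_mono' Measure.restrict_le_self le_rfl).trans ?_
  calc ∫⁻ z, ‖truncation g n z‖ₑ ^ r ∂ν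
      ≤ ∫⁻ z, (compactCovering Disc n).indicator (fun _ => (n : ℝ≥0∞) ^ r) z ∂ν := by
        refine lintegral_mono fun z => ?_
        refine (ENNReal.rpow_le_rpow (enorm_truncation_le_indicator g n z) hr.le).trans ?_
        by_cases hz : z ∈ compactCovering Disc n
        · rw [Set.indicator_of_mem hz, Set.indicator_of_mem hz]
        · rw [Set.indicator_of_notMem hz, Set.indicator_of_notMem hz,
            ENNReal.zero_rpow_of_pos hr]
    _ = _ := lintegral_indicator_const (isCompact_compactCovering Disc n).isClosed.measurableSet _

/-! ### The converse norm estimate -/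

lemma tentENorm_eq_lintegral (ν : Measure Disc) (ω : ℂ → ℝ) {p q : ℝ≥0∞} (hp0 : p ≠ 0)
    (hp : p ≠ ∞) (hq0 : q ≠ 0) (hq : q ≠ ∞) (f : Disc → ℂ) :
    tentENorm ν ω p q f = (∫⁻ ζ, (∫⁻ z in lens ζ, ‖f z‖ₑ ^ q.toReal ∂ν) ^ (p.toReal / q.toReal)
      ∂weightMeasure ω) ^ (1 / p.toReal) := by
  rw [tentENorm, if_neg fun h => hp h.1, eLpNorm_eq_lintegral_rpow_enorm_toReal hp0 hp]
  congr 1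
  refine lintegral_congr fun ζ => ?_
  rw [enorm_eq_self, areaFunction, eLpNorm_eq_lintegral_rpow_enorm_toReal hq0 hq,
    ← ENNReal.rpow_mul, one_div_mul_eq_div]

lemma tentENorm_top_right (ν : Measure Disc) (ω : ℂ → ℝ) {p : ℝ≥0∞} (hp0 : p ≠ 0)
    (hp : p ≠ ∞) (f : Disc → ℂ) :
    tentENorm ν ω p ∞ f = (∫⁻ ζ, areaFunction ν ∞ f ζ ^ p.toReal ∂weightMeasure ω)
      ^ (1 / p.toReal) := by
  rw [tentENorm, if_neg fun h => hp h.1, eLpNorm_eq_lintegral_rpow_enorm_toReal hp0 hp]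
  rfl

/-- At each point the truncations are eventually equal to g. Countably many essential bounds hold
outside one null set, so g is bounded there by the supremum of the truncated area functions. -/
lemma tendsto_areaFunction_top_truncation (ν : Measure Disc) (g : Disc → ℂ) (ζ : Disc) :
    Monotone (fun n => areaFunction ν ∞ (truncation g n) ζ) ∧
    Tendsto (fun n => areaFunction ν ∞ (truncation g n) ζ) atTop (𝓝 (areaFunction ν ∞ g ζ)) := by
  have hmono : Monotone (fun n => areaFunction ν ∞ (truncation g n) ζ) := fun m n hmn =>
    eLpNorm_mono_enorm fun z => monotone_enorm_truncation g z hmn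
  refine ⟨hmono, ?_⟩
  have hsup : areaFunction ν ∞ g ζ = ⨆ n, areaFunction ν ∞ (truncation g n) ζ := by
    refine le_antisymm ?_ (iSup_le fun n => eLpNorm_mono_enorm fun z => enorm_truncation_le g n z)
    conv_lhs => rw [areaFunction, eLpNorm_exponent_top]
    refine essSup_le_of_ae_le _ ?_
    have : ∀ᵐ z ∂ν.restrict (lens ζ), ∀ n,
        ‖truncation g n z‖ₑ ≤ areaFunction ν ∞ (truncation g n) ζ := ae_all_iff.2 fun n => by
      rw [areaFunction, eLpNorm_exponent_top]
      exact enorm_ae_le_eLpNormEssSup _ _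
    filter_upwards [this] with z hz
    obtain ⟨n, hn⟩ := (eventually_truncation_eq g z).exists
    rw [← hn]
    exact (hz n).trans (le_iSup (fun n => areaFunction ν ∞ (truncation g n) ζ) n)
  rw [hsup]
  exact tendsto_atTop_iSup hmono

lemma one_lt_toReal {p : ℝ≥0∞} (hp : 1 ≤ p) (hp1 : p ≠ 1) (hpt : p ≠ ∞) : 1 < p.toReal := by
  have := (ENNReal.toReal_lt_toReal (by simp) hpt).2 (lt_of_le_of_ne hp (Ne.symm hp1))
  simpa using this

/-- The converse norm estimate: a function which pairs boundedly with `T^p_q` belongs to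
`T^{p'}_{q'}`. -/
theorem TentControl.exists_tentENorm_le (H : TentControl ω C) (p q p' q' : ℝ≥0∞)
    (hp1 : 1 ≤ p) (hq1 : 1 ≤ q) (hp : p ≠ ∞) (hq : q ≠ ∞) (hpq : p + q ≠ 2)
    (hpp' : p.HolderConjugate p') (hqq' : q.HolderConjugate q') :
    ∃ K : ℝ≥0, ∀ (ν : Measure Disc) [IsFiniteMeasureOnCompacts ν] (N : ℝ≥0∞) (g : Disc → ℂ),
      Measurable g → TestBound ν ω p.toReal q.toReal N (fun z => ‖g z‖ₑ) →
      tentENorm ν ω p' q' g ≤ K * N := by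
  have hcov : ∀ (ν : Measure Disc) [IsFiniteMeasureOnCompacts ν] (n : ℕ),
      ν (compactCovering Disc n) ≠ ∞ := fun ν _ n =>
    (isCompact_compactCovering Disc n).measure_lt_top.ne
  have hfinite := H.finite
  by_cases hp1' : p = 1
  · have hq1' : q ≠ 1 := by rintro rfl; rw [hp1'] at hpq; exact hpq (by norm_num)
    have hp'top : p' = ∞ := by
      have := hpp'.inv_add_inv_eq_inv
      rw [hp1'] at this
      simpa using this
    have hqr := ENNReal.HolderConjugate.toReal (q := q') (one_lt_toReal hq1 hq1' hq)
    have hq'top : q' ≠ ∞ := fun h => by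
      have := hqr.symm.pos; rw [h] at this; simp at this
    have hq'0 : q' ≠ 0 := fun h => by
      have := hqr.symm.pos; rw [h] at this; simp at this
    refine ⟨C, fun ν _ N g hg h => ?_⟩
    rw [tentENorm, if_pos ⟨hp'top, hq'top⟩]
    refine essSup_le_of_ae_le _ (Eventually.of_forall fun ζ => ?_)
    dsimp only
    rw [enorm_eq_self, carlesonFunction]
    rw [hp1', ENNReal.toReal_one] at h
    -- The estimate on a tent requires a finite integral, which the truncations have because ν is
    -- finite on compact sets; monotone convergence passes to g.
    have hX : ∀ a, ∫⁻ z in tent a, ‖g z‖ₑ ^ q'.toReal * tentMass ω z ∂ν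
        ≤ (C * N) ^ q'.toReal * tentMass ω a := by
      intro a
      have hlim : Tendsto (fun n => ∫⁻ z in tent a, ‖truncation g n z‖ₑ ^ q'.toReal *
          tentMass ω z ∂ν) atTop (𝓝 (∫⁻ z in tent a, ‖g z‖ₑ ^ q'.toReal * tentMass ω z ∂ν)) := by
        refine lintegral_tendsto_of_tendsto_of_monotone (fun n => ?_)
          (Eventually.of_forall fun z m n hmn => ?_) (Eventually.of_forall fun z => ?_)
        · exact (((measurable_truncation hg n).enorm.pow_const _).mul
            (measurable_tentMass ω)).aemeasurable
        · exact mul_le_mul_left (ENNReal.rpow_le_rpow (monotone_enorm_truncation g z hmn)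
            hqr.symm.nonneg) _
        · exact ENNReal.Tendsto.mul_const (tendsto_enorm_truncation_rpow g z _)
            (Or.inr (H.mass_ne_top z))
      refine le_of_tendsto' hlim fun n => ?_
      refine (h.mono fun z => enorm_truncation_le g n z).lintegral_tent_le H hqr
        (measurable_truncation hg n).enorm a ?_
      refine ne_top_of_le_ne_top (b := weightMeasure ω Set.univ *
        ((n : ℝ≥0∞) ^ q'.toReal * ν (compactCovering Disc n))) ?_ ?_
      · exact ENNReal.mul_ne_top (measure_ne_top _ _) (ENNReal.mul_ne_top
          (ENNReal.rpow_ne_top_of_nonneg hqr.symm.nonneg (by simp)) (hcov ν n))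
      · refine le_trans ?_ (mul_le_mul_right
          (lintegral_enorm_truncation_rpow_le ν g n hqr.symm.pos (tent a)) _)
        rw [← lintegral_const_mul' _ _ (measure_ne_top _ _)]
        refine lintegral_mono fun z => ?_
        rw [mul_comm]
        exact mul_le_mul_left (H.mass_le_univ z) _
    calc _ ≤ ((C * N) ^ q'.toReal) ^ (1 / q'.toReal) := by
          refine ENNReal.rpow_le_rpow (iSup₂_le fun a _ => ?_) hqr.symm.one_div_nonneg
          refine (mul_le_mul_right (hX a) _).trans (le_of_eq ?_)
          rw [mul_left_comm, ENNReal.inv_mul_cancel (H.mass_ne_zero a) (H.mass_ne_top a), mul_one]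
      _ = _ := by
          rw [← ENNReal.rpow_mul, mul_one_div_cancel hqr.symm.ne_zero, ENNReal.rpow_one]
  have hpr := ENNReal.HolderConjugate.toReal (q := p') (one_lt_toReal hp1 hp1' hp)
  have hp'top : p' ≠ ∞ := fun h => by have := hpr.symm.pos; rw [h] at this; simp at this
  have hp'0 : p' ≠ 0 := fun h => by have := hpr.symm.pos; rw [h] at this; simp at this
  have hroot : ∀ {I D : ℝ≥0∞}, I ≤ D ^ p'.toReal → I ^ (1 / p'.toReal) ≤ D := by
    intro I D h
    refine (ENNReal.rpow_le_rpow h hpr.symm.one_div_nonneg).trans (le_of_eq ?_)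
    rw [← ENNReal.rpow_mul, mul_one_div_cancel hpr.symm.ne_zero, ENNReal.rpow_one]
  by_cases hq1' : q = 1
  · have hq'top : q' = ∞ := by
      have := hqq'.inv_add_inv_eq_inv
      rw [hq1'] at this
      simpa using this
    obtain ⟨K, hK⟩ := H.exists_norm_le_of_testBound_one hpr
    refine ⟨K, fun ν _ N g hg h => ?_⟩
    rw [hq'top, tentENorm_top_right ν ω hp'0 hp'top]
    rw [hq1', ENNReal.toReal_one] at h
    refine hroot ?_
    have hlim : Tendsto (fun n => ∫⁻ ζ, areaFunction ν ∞ (truncation g n) ζ ^ p'.toReal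
        ∂weightMeasure ω) atTop (𝓝 (∫⁻ ζ, areaFunction ν ∞ g ζ ^ p'.toReal ∂weightMeasure ω)) := by
      refine lintegral_tendsto_of_tendsto_of_monotone (fun n => ?_)
        (Eventually.of_forall fun ζ m n hmn => ?_) (Eventually.of_forall fun ζ => ?_)
      · exact ((measurable_areaFunction ν le_top (measurable_truncation hg n)).pow_const
          _).aemeasurable
      · exact ENNReal.rpow_le_rpow ((tendsto_areaFunction_top_truncation ν g ζ).1 hmn)
          hpr.symm.nonneg
      · exact (ENNReal.continuous_rpow_const.tendsto _).comp
          (tendsto_areaFunction_top_truncation ν g ζ).2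
    refine le_of_tendsto' hlim fun n => ?_
    refine hK ν N (truncation g n) n (measurable_truncation hg n) (fun z => ?_) ?_
      (h.mono fun z => enorm_truncation_le g n z)
    · refine (enorm_truncation_le_indicator g n z).trans ?_
      exact Set.indicator_le_self' (fun _ _ => zero_le) z
    · refine ne_top_of_le_ne_top (hcov ν n) (measure_mono fun z hz => ?_)
      by_contra hzn
      exact hz (Set.indicator_of_notMem (fun h => hzn h.1) g)
  · have hqr := ENNReal.HolderConjugate.toReal (q := q') (one_lt_toReal hq1 hq1' hq)
    have hq'top : q' ≠ ∞ := fun h => by have := hqr.symm.pos; rw [h] at this; simp at this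
    have hq'0 : q' ≠ 0 := fun h => by have := hqr.symm.pos; rw [h] at this; simp at this
    obtain ⟨K, hK⟩ := H.exists_norm_le_of_testBound hpr hqr
    refine ⟨K, fun ν _ N g hg h => ?_⟩
    rw [tentENorm_eq_lintegral ν ω hp'0 hp'top hq'0 hq'top]
    refine hroot ?_
    have hr : 0 < p'.toReal / q'.toReal := div_pos hpr.symm.pos hqr.symm.pos
    have hinner : ∀ ζ, Tendsto (fun n => ∫⁻ z in lens ζ, ‖truncation g n z‖ₑ ^ q'.toReal ∂ν) atTop
        (𝓝 (∫⁻ z in lens ζ, ‖g z‖ₑ ^ q'.toReal ∂ν)) := fun ζ =>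
      lintegral_tendsto_of_tendsto_of_monotone
        (fun n => ((measurable_truncation hg n).enorm.pow_const _).aemeasurable)
        (Eventually.of_forall fun z m n hmn => ENNReal.rpow_le_rpow
          (monotone_enorm_truncation g z hmn) hqr.symm.nonneg)
        (Eventually.of_forall fun z => tendsto_enorm_truncation_rpow g z _)
    have hlim : Tendsto (fun n => ∫⁻ ζ, (∫⁻ z in lens ζ, ‖truncation g n z‖ₑ ^ q'.toReal ∂ν) ^
        (p'.toReal / q'.toReal) ∂weightMeasure ω) atTop (𝓝 (∫⁻ ζ, (∫⁻ z in lens ζ,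
          ‖g z‖ₑ ^ q'.toReal ∂ν) ^ (p'.toReal / q'.toReal) ∂weightMeasure ω)) := by
      refine lintegral_tendsto_of_tendsto_of_monotone (fun n => ?_)
        (Eventually.of_forall fun ζ m n hmn => ?_) (Eventually.of_forall fun ζ => ?_)
      · exact ((measurable_lintegral_lens (F := fun x => ‖truncation g n x.2‖ₑ ^ q'.toReal)
          (((measurable_truncation hg n).comp measurable_snd).enorm.pow_const _)).pow_const
            _).aemeasurable
      · exact ENNReal.rpow_le_rpow (lintegral_mono fun z => ENNReal.rpow_le_rpow
          (monotone_enorm_truncation g z hmn) hqr.symm.nonneg) hr.le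
      · exact (ENNReal.continuous_rpow_const.tendsto _).comp (hinner ζ)
    refine le_of_tendsto' hlim fun n => ?_
    have hb := lintegral_enorm_truncation_rpow_le ν g n hqr.symm.pos
    have hbt : (n : ℝ≥0∞) ^ q'.toReal * ν (compactCovering Disc n) ≠ ∞ := ENNReal.mul_ne_top
      (ENNReal.rpow_ne_top_of_nonneg hqr.symm.nonneg (by simp)) (hcov ν n)
    refine hK ν N (fun z => ‖truncation g n z‖ₑ) (measurable_truncation hg n).enorm (fun ζ => ?_) ?_
      (h.mono fun z => enorm_truncation_le g n z)
    · exact ne_top_of_le_ne_top hbt (hb _)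
    · refine ne_top_of_le_ne_top ?_ (lintegral_mono fun ζ => ENNReal.rpow_le_rpow (hb (lens ζ)) hr.le)
      rw [lintegral_const]
      exact ENNReal.mul_ne_top (ENNReal.rpow_ne_top_of_nonneg hr.le hbt) (measure_ne_top _ _)

end TentDuality

namespace TentDuality

variable {ω : ℂ → ℝ} {C : ℝ≥0}

/-! ### Boundedness of the pairing -/

/-- The set contains, with each x, all y with ρ y ≥ ρ x. If the infimum of ρ over it is attained, it
lies in a single superlevel set of measure at most B; otherwise it lies in an increasing union of
such sets. -/
lemma measure_setOf_measure_le_le {α : Type*} [MeasurableSpace α] (μ : Measure α) (ρ : α → ℝ)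
    (hρ : ∀ x, 0 ≤ ρ x) (B : ℝ≥0∞) : μ {x | μ {y | ρ x ≤ ρ y} ≤ B} ≤ B := by
  set S := {x | μ {y | ρ x ≤ ρ y} ≤ B} with hS
  rcases S.eq_empty_or_nonempty with h0 | hne
  · rw [h0]; simp
  have hbdd : BddBelow (ρ '' S) := ⟨0, by rintro _ ⟨x, _, rfl⟩; exact hρ x⟩
  by_cases hmem : sInf (ρ '' S) ∈ ρ '' S
  · obtain ⟨x, hx, hxi⟩ := hmem
    refine (measure_mono fun y hy => ?_).trans hx
    rw [Set.mem_ofPred_eq, hxi]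
    exact csInf_le hbdd ⟨y, hy, rfl⟩
  · obtain ⟨u, hanti, hlim, hu⟩ := exists_seq_tendsto_sInf (hne.image ρ) hbdd
    have hsub : S ⊆ ⋃ n, {y | u n ≤ ρ y} := by
      intro y hy
      have hlt : sInf (ρ '' S) < ρ y :=
        lt_of_le_of_ne (csInf_le hbdd ⟨y, hy, rfl⟩) fun h => hmem ⟨y, hy, h.symm⟩
      obtain ⟨n, hn⟩ := (hlim.eventually_lt_const hlt).exists
      exact Set.mem_iUnion.2 ⟨n, hn.le⟩
    refine (measure_mono hsub).trans ?_
    have hmono : Monotone fun n => {y | u n ≤ ρ y} := fun m n hmn y hy =>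
      le_trans (hanti hmn) hy
    rw [hmono.measure_iUnion]
    refine iSup_le fun n => ?_
    obtain ⟨x, hx, hxn⟩ := hu n
    rw [← hxn]
    exact hx

lemma lintegral_mul_tentMass_le (H : TentControl ω C) {ν : Measure Disc} [SFinite ν]
    {h : Disc → ℝ≥0∞} (hh : Measurable h) :
    ∫⁻ z, h z * tentMass ω z ∂ν ≤ ∫⁻ ζ, ∫⁻ z in lens ζ, h z ∂ν ∂weightMeasure ω := by
  rw [lintegral_lens_swap (F := fun x => h x.2) (hh.comp measurable_snd)]
  refine lintegral_mono fun z => ?_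
  dsimp only
  rw [setLIntegral_const]
  exact mul_le_mul_right (H.mass_le z) _

lemma lintegral_enorm_mul_le_areaFunction {q q' : ℝ≥0∞} (hqq' : q.HolderConjugate q')
    {ν : Measure Disc} {f g : Disc → ℂ} (hf : Measurable f) (hg : Measurable g) (ζ : Disc) :
    ∫⁻ z in lens ζ, ‖f z‖ₑ * ‖g z‖ₑ ∂ν ≤ areaFunction ν q f ζ * areaFunction ν q' g ζ := by
  have h := eLpNorm_le_eLpNorm_mul_eLpNorm_of_nnnorm (μ := ν.restrict (lens ζ)) (p := q) (q := q')
    (r := 1) hf.aestronglyMeasurable hg.aestronglyMeasurable (fun a b => a * b) 1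
    (Eventually.of_forall fun z => by simp)
  rw [eLpNorm_one_eq_lintegral_enorm] at h
  simpa [areaFunction] using h

/-- Hölder twice: over each lens with exponents q, q', then over the disc with p, p'. Here p' < ∞,
so the dual norm is an area-function norm. -/
lemma pairing_le_of_one_lt (H : TentControl ω C) {p q p' q' : ℝ≥0∞} (hp1 : 1 < p) (hp : p ≠ ∞)
    (hq1 : 1 ≤ q) (hq'1 : 1 ≤ q') (hpp' : p.HolderConjugate p') (hqq' : q.HolderConjugate q')
    {ν : Measure Disc} [SFinite ν] {f g : Disc → ℂ} (hf : Measurable f) (hg : Measurable g) :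
    ∫⁻ z, ‖f z‖ₑ * ‖g z‖ₑ * tentMass ω z ∂ν ≤ tentENorm ν ω p q f * tentENorm ν ω p' q' g := by
  have hpr := ENNReal.HolderConjugate.toReal (q := p') (one_lt_toReal hp1.le hp1.ne' hp)
  have hp'top : p' ≠ ∞ := fun h => by have := hpr.symm.pos; rw [h] at this; simp at this
  have hp'0 : p' ≠ 0 := fun h => by have := hpr.symm.pos; rw [h] at this; simp at this
  rw [tentENorm, if_neg fun h => hp h.1, tentENorm, if_neg fun h => hp'top h.1,
    eLpNorm_eq_lintegral_rpow_enorm_toReal (by positivity) hp,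
    eLpNorm_eq_lintegral_rpow_enorm_toReal hp'0 hp'top]
  simp only [enorm_eq_self]
  refine (lintegral_mul_tentMass_le H (hf.enorm.mul hg.enorm)).trans ?_
  refine (lintegral_mono fun ζ => lintegral_enorm_mul_le_areaFunction hqq' hf hg ζ).trans ?_
  exact ENNReal.lintegral_mul_le_Lp_mul_Lq _ hpr (measurable_areaFunction ν hq1 hf).aemeasurable
    (measurable_areaFunction ν hq'1 hg).aemeasurable

/-- The norm bounds the Carleson function only almost everywhere. A tent has positive area, so some
ζ in T(a) obeys the bound, and `a` is then one of the competitors in the supremum at ζ. -/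
lemma lintegral_tent_le_of_carleson (H : TentControl ω C) {q' : ℝ≥0∞} (hq'0 : q' ≠ 0)
    (hq' : q' ≠ ∞) {ν : Measure Disc} (g : Disc → ℂ) (a : Disc) :
    ∫⁻ z in tent a, ‖g z‖ₑ ^ q'.toReal * tentMass ω z ∂ν
      ≤ tentENorm ν ω ∞ q' g ^ q'.toReal * tentMass ω a := by
  have hr : 0 < q'.toReal := ENNReal.toReal_pos hq'0 hq'
  have h1 : area (tent a) ≠ 0 := fun h =>
    ((H.mass_pos a).trans_le (H.mass_le a)).ne'
      (withDensity_absolutelyContinuous area _ h)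
  have h2 : ∀ᵐ ζ ∂area, carlesonFunction ν ω q' g ζ ≤ tentENorm ν ω ∞ q' g := by
    rw [tentENorm, if_pos ⟨rfl, hq'⟩, eLpNorm_exponent_top]
    simpa using enorm_ae_le_eLpNormEssSup (carlesonFunction ν ω q' g) area
  obtain ⟨ζ, hζ, hle⟩ := Measure.exists_mem_of_measure_ne_zero_of_ae h1 (ae_restrict_of_ae h2)
  have h3 : (tentMass ω a)⁻¹ * ∫⁻ z in tent a, ‖g z‖ₑ ^ q'.toReal * tentMass ω z ∂ν
      ≤ tentENorm ν ω ∞ q' g ^ q'.toReal := by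
    refine le_trans ?_ (ENNReal.rpow_le_rpow hle hr.le)
    rw [carlesonFunction, ← ENNReal.rpow_mul, one_div_mul_cancel hr.ne', ENNReal.rpow_one]
    exact le_iSup₂ (f := fun a (_ : a ∈ lens ζ) => (tentMass ω a)⁻¹ *
      ∫⁻ z in tent a, ‖g z‖ₑ ^ q'.toReal * tentMass ω z ∂ν) a hζ
  rw [mul_comm] at h3
  exact (ENNReal.div_le_iff (H.mass_ne_zero a) (H.mass_ne_top a)).1 h3

/-- The part of the integral over the lens which lies outside the disc of radius `|z|`. -/
noncomputable def outerLensIntegral (ν : Measure Disc) (G : Disc → ℝ≥0∞) (x : Disc × Disc) :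
    ℝ≥0∞ :=
  ∫⁻ w in lens x.1, {w : Disc | ‖(x.2 : ℂ)‖ ≤ ‖(w : ℂ)‖}.indicator G w ∂ν

lemma measurable_outerLensIntegral {ν : Measure Disc} [SFinite ν] {G : Disc → ℝ≥0∞}
    (hG : Measurable G) : Measurable (outerLensIntegral ν G) := by
  set S : Set ((Disc × Disc) × Disc) :=
    {y | y.2 ∈ lens y.1.1} ∩ {y | ‖(y.1.2 : ℂ)‖ ≤ ‖(y.2 : ℂ)‖} with hS
  have hSm : MeasurableSet S := by
    refine MeasurableSet.inter ?_ (measurableSet_le (by fun_prop) (by fun_prop))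
    have : Measurable fun y : (Disc × Disc) × Disc => (y.1.1, y.2) := by fun_prop
    exact this measurableSet_lens_prod
  have : outerLensIntegral ν G = fun x => ∫⁻ w, S.indicator (fun y => G y.2) (x, w) ∂ν := by
    funext x
    rw [outerLensIntegral, ← lintegral_indicator (measurableSet_lens x.1)]
    refine lintegral_congr fun w => ?_
    rw [Set.indicator_indicator]
    rfl
  rw [this]
  exact Measurable.lintegral_prod_right' ((hG.comp measurable_snd).indicator hSm)

/-- After swapping, `w` contributes only if |w| ≥ |z| and T(w) meets T(z). All such `w` lie in the
tent of the parent of `z`, where the Carleson bound applies. -/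
lemma lintegral_outerLensIntegral_le (H : TentControl ω C) {ν : Measure Disc} [SFinite ν]
    {G : Disc → ℝ≥0∞} (hG : Measurable G) {M : ℝ≥0∞}
    (hM : ∀ a, ∫⁻ z in tent a, G z * tentMass ω z ∂ν ≤ M * tentMass ω a) (z : Disc) :
    ∫⁻ ζ in tent z, outerLensIntegral ν G (ζ, z) ∂weightMeasure ω
      ≤ C * C * M * tentMass ω z := by
  obtain ⟨a, ha1, ha2⟩ := H.parent z
  have hR : MeasurableSet {w : Disc | ‖(z : ℂ)‖ ≤ ‖(w : ℂ)‖} :=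
    measurableSet_le (by fun_prop) (by fun_prop)
  set h : Disc → ℝ≥0∞ := {w : Disc | ‖(z : ℂ)‖ ≤ ‖(w : ℂ)‖}.indicator G with hh
  have hhm : Measurable h := hG.indicator hR
  have h1 : Measurable ((tent z).indicator (1 : Disc → ℝ≥0∞)) :=
    measurable_one.indicator (measurableSet_tent z)
  calc ∫⁻ ζ in tent z, outerLensIntegral ν G (ζ, z) ∂weightMeasure ω
      = ∫⁻ ζ, ∫⁻ w in lens ζ, (tent z).indicator 1 ζ * h w ∂ν ∂weightMeasure ω := by
        rw [← lintegral_indicator (measurableSet_tent z)]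
        refine lintegral_congr fun ζ => ?_
        rw [lintegral_const_mul _ hhm]
        by_cases hζ : ζ ∈ tent z
        · rw [Set.indicator_of_mem hζ, Set.indicator_of_mem hζ, Pi.one_apply, one_mul]
          rfl
        · rw [Set.indicator_of_notMem hζ, Set.indicator_of_notMem hζ, zero_mul]
    _ = ∫⁻ w, ∫⁻ ζ in tent w, (tent z).indicator 1 ζ * h w ∂weightMeasure ω ∂ν :=
        lintegral_lens_swap (F := fun x => (tent z).indicator 1 x.1 * h x.2)
          ((h1.comp measurable_fst).mul (hhm.comp measurable_snd))
    _ ≤ ∫⁻ w, (tent a).indicator (fun w => C * (G w * tentMass ω w)) w ∂ν := by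
        refine lintegral_mono fun w => ?_
        rw [lintegral_mul_const _ h1, lintegral_indicator_one (measurableSet_tent z),
          Measure.restrict_apply (measurableSet_tent z), Set.inter_comm]
        by_cases hw : ‖(z : ℂ)‖ ≤ ‖(w : ℂ)‖
        · rcases (tent w ∩ tent z).eq_empty_or_nonempty with he | hne
          · rw [he, measure_empty, zero_mul]; exact zero_le
          · rw [Set.indicator_of_mem (ha2 w (by linarith [norm_lt_one z]) hne), hh,
              Set.indicator_of_mem (show w ∈ {w : Disc | ‖(z : ℂ)‖ ≤ ‖(w : ℂ)‖} from hw)]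
            calc _ ≤ (C * tentMass ω w) * G w := mul_le_mul_left
                  ((measure_mono Set.inter_subset_left).trans (H.measure_tent_le w)) _
              _ = _ := by ring
        · rw [hh, Set.indicator_of_notMem (show w ∉ {w : Disc | ‖(z : ℂ)‖ ≤ ‖(w : ℂ)‖} from hw),
            mul_zero]
          exact zero_le
    _ = C * ∫⁻ w in tent a, G w * tentMass ω w ∂ν := by
        rw [lintegral_indicator (measurableSet_tent a), lintegral_const_mul' _ _ ENNReal.coe_ne_top]
    _ ≤ C * (M * (C * tentMass ω z)) :=
        mul_le_mul_right ((hM a).trans (mul_le_mul_right ha1 _)) _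
    _ = _ := by ring

/-- By Chebyshev, the set where the outer integral exceeds twice its average bound has mass at most
half of tentMass, so the rest of the tent carries at least the other half. Dividing by the bound
requires 0 < M < ∞. -/
lemma tentMass_le_two_mul (H : TentControl ω C) {ν : Measure Disc} [SFinite ν]
    {G : Disc → ℝ≥0∞} (hG : Measurable G) {M : ℝ≥0∞} (hM0 : M ≠ 0) (hMt : M ≠ ∞)
    (hM : ∀ a, ∫⁻ z in tent a, G z * tentMass ω z ∂ν ≤ M * tentMass ω a) (z : Disc) :
    tentMass ω z ≤ 2 * weightMeasure ω
      (tent z ∩ {ζ | outerLensIntegral ν G (ζ, z) ≤ 2 * (C * C * M)}) := by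
  set Y : ℝ≥0∞ := C * C * M with hY
  have hY0 : Y ≠ 0 := mul_ne_zero (mul_ne_zero H.coe_ne_zero H.coe_ne_zero) hM0
  have hYt : Y ≠ ∞ := ENNReal.mul_ne_top (ENNReal.mul_ne_top (by simp) (by simp)) hMt
  set m := tentMass ω z with hm
  set E := {ζ | outerLensIntegral ν G (ζ, z) ≤ 2 * Y} with hE
  have hEm : MeasurableSet E := measurableSet_le
    ((measurable_outerLensIntegral hG).comp measurable_prodMk_right) measurable_const
  have hmark : 2 * Y * weightMeasure ω (tent z \ E) ≤ Y * m := by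
    refine le_trans ?_ (lintegral_outerLensIntegral_le H hG hM z)
    have hd : weightMeasure ω (tent z \ E) = (weightMeasure ω).restrict (tent z) Eᶜ := by
      rw [Measure.restrict_apply hEm.compl, Set.sdiff_eq, Set.inter_comm]
    rw [hd]
    refine le_trans (mul_le_mul_right (measure_mono fun ζ hζ => ?_) _)
      (mul_meas_ge_le_lintegral ((measurable_outerLensIntegral hG).comp
        (measurable_prodMk_right (y := z))) (2 * Y))
    exact (not_le.1 (show ¬ outerLensIntegral ν G (ζ, z) ≤ 2 * Y from hζ)).le
  have h2 : 2 * weightMeasure ω (tent z \ E) ≤ m := by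
    rw [mul_comm 2 Y, mul_assoc] at hmark
    exact (ENNReal.mul_le_mul_iff_right hY0 hYt).1 hmark
  have h3 : m ≤ weightMeasure ω (tent z ∩ E) + weightMeasure ω (tent z \ E) := by
    rw [measure_inter_add_sdiff _ hEm]; exact H.mass_le z
  have h4 : m + m ≤ 2 * weightMeasure ω (tent z ∩ E) + m := by
    calc m + m = 2 * m := (two_mul m).symm
      _ ≤ 2 * (weightMeasure ω (tent z ∩ E) + weightMeasure ω (tent z \ E)) :=
          mul_le_mul_right h3 _
      _ ≤ _ := by rw [mul_add]; exact add_le_add le_rfl h2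
  exact (ENNReal.add_le_add_iff_right (H.mass_ne_top z)).1 h4

/-- The outer integral at z is the measure G dν on Γ(ζ) of the points of modulus at least |z|, so
`measure_setOf_measure_le_le` applies with ρ = |z|. -/
lemma setLIntegral_outerLensIntegral_le (ν : Measure Disc) {G : Disc → ℝ≥0∞}
    (ζ : Disc) (B : ℝ≥0∞) {E : Set Disc} (hEm : MeasurableSet E)
    (hE : E = {z | outerLensIntegral ν G (ζ, z) ≤ B}) :
    ∫⁻ z in lens ζ, E.indicator G z ∂ν ≤ B := by
  set lam := (ν.restrict (lens ζ)).withDensity G with hlam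
  have hout : ∀ z, outerLensIntegral ν G (ζ, z) = lam {w : Disc | ‖(z : ℂ)‖ ≤ ‖(w : ℂ)‖} := by
    intro z
    have hm : MeasurableSet {w : Disc | ‖(z : ℂ)‖ ≤ ‖(w : ℂ)‖} :=
      measurableSet_le (by fun_prop) (by fun_prop)
    rw [hlam, withDensity_apply _ hm, outerLensIntegral, lintegral_indicator hm]
  have h := measure_setOf_measure_le_le lam (fun z : Disc => ‖(z : ℂ)‖) (fun z => norm_nonneg _) B
  simp only [← hout, ← hE] at h
  rwa [hlam, withDensity_apply _ hEm, ← lintegral_indicator hEm] at h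

lemma pairing_le_of_eq_one (H : TentControl ω C) {q q' : ℝ≥0∞} (hq1 : 1 < q) (hq : q ≠ ∞)
    (hqq' : q.HolderConjugate q') {ν : Measure Disc} [SFinite ν] {f g : Disc → ℂ}
    (hf : Measurable f) (hg : Measurable g) (hgt : tentENorm ν ω ∞ q' g ≠ ∞) :
    ∫⁻ z, ‖f z‖ₑ * ‖g z‖ₑ * tentMass ω z ∂ν
      ≤ 4 * C * C * (tentENorm ν ω 1 q f * tentENorm ν ω ∞ q' g) := by
  have hqr := ENNReal.HolderConjugate.toReal (q := q') (one_lt_toReal hq1.le hq1.ne' hq)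
  have hq'top : q' ≠ ∞ := fun h => by have := hqr.symm.pos; rw [h] at this; simp at this
  have hq'0 : q' ≠ 0 := fun h => by have := hqr.symm.pos; rw [h] at this; simp at this
  set N := tentENorm ν ω ∞ q' g with hN
  set r := q'.toReal with hr
  set G : Disc → ℝ≥0∞ := fun z => ‖g z‖ₑ ^ r with hG
  have hGm : Measurable G := hg.enorm.pow_const r
  have hM := lintegral_tent_le_of_carleson H hq'0 hq'top (ν := ν) g
  rw [← hN] at hM
  -- A zero Carleson norm forces g = 0 almost everywhere, by the bound on the tent of the origin,
  -- which is the whole disc.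
  by_cases hN0 : N = 0
  · have h0 := hM origin
    rw [hN0, ENNReal.zero_rpow_of_pos hqr.symm.pos, zero_mul, tent_origin, Measure.restrict_univ,
      nonpos_iff_eq_zero] at h0
    replace h0 := (lintegral_eq_zero_iff (hGm.mul (measurable_tentMass ω))).1 h0
    refine le_of_eq_of_le ?_ zero_le
    refine (lintegral_eq_zero_iff ((hf.enorm.mul hg.enorm).mul (measurable_tentMass ω))).2 ?_
    filter_upwards [h0] with z hz
    have hz' : ‖g z‖ₑ ^ r * tentMass ω z = 0 := hz
    rw [mul_eq_zero, or_iff_left (H.mass_ne_zero z), ENNReal.rpow_eq_zero_iff_of_pos hqr.symm.pos]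
      at hz'
    simp [hz']
  have hNr0 : N ^ r ≠ 0 := by simp [hN0, hgt]
  have hNrt : N ^ r ≠ ∞ := ENNReal.rpow_ne_top_of_nonneg hqr.symm.nonneg hgt
  set B : ℝ≥0∞ := 2 * (C * C * N ^ r) with hB
  set S : Set (Disc × Disc) := {x | outerLensIntegral ν G x ≤ B} with hS
  have hSm : MeasurableSet S := measurableSet_le (measurable_outerLensIntegral hGm) measurable_const
  have hS1 : ∀ z, MeasurableSet {ζ | (ζ, z) ∈ S} := fun z => measurable_prodMk_right hSm
  have hS2 : ∀ ζ, MeasurableSet {z | (ζ, z) ∈ S} := fun ζ => measurable_prodMk_left hSm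
  -- Only pairs whose outer lens integral is at most B are kept. For fixed z they fill at least half
  -- of tentMass; for fixed ζ the retained part of g has L^{q'} norm at most B^(1/r).
  set F : Disc × Disc → ℝ≥0∞ := S.indicator fun x => ‖f x.2‖ₑ * ‖g x.2‖ₑ with hF
  have hFm : Measurable F := ((hf.enorm.mul hg.enorm).comp measurable_snd).indicator hSm
  have h1 : ∀ z, ‖f z‖ₑ * ‖g z‖ₑ * tentMass ω z
      ≤ 2 * ∫⁻ ζ in tent z, F (ζ, z) ∂weightMeasure ω := by
    intro z
    have e : ∫⁻ ζ in tent z, F (ζ, z) ∂weightMeasure ω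
        = ‖f z‖ₑ * ‖g z‖ₑ * weightMeasure ω (tent z ∩ {ζ | (ζ, z) ∈ S}) := by
      have : ∀ ζ, F (ζ, z) = {ζ | (ζ, z) ∈ S}.indicator (fun _ => ‖f z‖ₑ * ‖g z‖ₑ) ζ := fun ζ => rfl
      simp only [this]
      rw [lintegral_indicator_const (hS1 z), Measure.restrict_apply (hS1 z), Set.inter_comm]
    rw [e, mul_left_comm]
    exact mul_le_mul_right (tentMass_le_two_mul H hGm hNr0 hNrt hM z) _
  have h2 : ∀ ζ, ∫⁻ z in lens ζ, F (ζ, z) ∂ν ≤ areaFunction ν q f ζ * B ^ (1 / r) := by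
    intro ζ
    set k : Disc → ℝ≥0∞ := {z | (ζ, z) ∈ S}.indicator fun z => ‖g z‖ₑ with hk
    have hkm : Measurable k := hg.enorm.indicator (hS2 ζ)
    have e : ∀ z, F (ζ, z) = ((fun z => ‖f z‖ₑ) * k) z := by
      intro z
      by_cases hz : (ζ, z) ∈ S
      · rw [hF, Set.indicator_of_mem hz, Pi.mul_apply, hk,
          Set.indicator_of_mem (show z ∈ {z | (ζ, z) ∈ S} from hz)]
      · rw [hF, Set.indicator_of_notMem hz, Pi.mul_apply, hk,
          Set.indicator_of_notMem (show z ∉ {z | (ζ, z) ∈ S} from hz), mul_zero]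
    simp only [e]
    refine (ENNReal.lintegral_mul_le_Lp_mul_Lq _ hqr hf.enorm.aemeasurable hkm.aemeasurable).trans ?_
    rw [areaFunction, eLpNorm_eq_lintegral_rpow_enorm_toReal (by positivity) hq]
    refine mul_le_mul_right (ENNReal.rpow_le_rpow ?_ hqr.symm.one_div_nonneg) _
    have e2 : ∀ z, k z ^ r = {z | (ζ, z) ∈ S}.indicator G z := by
      intro z
      by_cases hz : z ∈ {z | (ζ, z) ∈ S}
      · rw [hk, Set.indicator_of_mem hz, Set.indicator_of_mem hz]
      · rw [hk, Set.indicator_of_notMem hz, Set.indicator_of_notMem hz,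
          ENNReal.zero_rpow_of_pos hqr.symm.pos]
    simp only [e2]
    exact setLIntegral_outerLensIntegral_le ν ζ B (hS2 ζ) rfl
  -- Since 2 C C ≥ 1 and 1/r ≤ 1, the root of the constant is bounded by the constant.
  have hBr : B ^ (1 / r) ≤ 2 * C * C * N := by
    have hr1 : 1 / r ≤ 1 := by
      rw [div_le_one hqr.symm.pos]; exact hqr.symm.lt.le
    have hCC : (1 : ℝ≥0∞) ≤ 2 * C * C := by
      calc (1 : ℝ≥0∞) = 1 * 1 * 1 := by norm_num
        _ ≤ _ := mul_le_mul' (mul_le_mul' (by norm_num) H.one_le) H.one_le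
    rw [show B = 2 * C * C * N ^ r by rw [hB]; ring,
      ENNReal.mul_rpow_of_nonneg _ _ hqr.symm.one_div_nonneg, ← ENNReal.rpow_mul,
      mul_one_div_cancel hqr.symm.ne_zero, ENNReal.rpow_one]
    refine mul_le_mul_left ?_ _
    conv_rhs => rw [← ENNReal.rpow_one (2 * C * C : ℝ≥0∞)]
    exact ENNReal.rpow_le_rpow_of_exponent_le hCC hr1
  have hAm := measurable_areaFunction ν hq1.le hf
  calc ∫⁻ z, ‖f z‖ₑ * ‖g z‖ₑ * tentMass ω z ∂ν
      ≤ ∫⁻ z, 2 * ∫⁻ ζ in tent z, F (ζ, z) ∂weightMeasure ω ∂ν := lintegral_mono h1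
    _ = 2 * ∫⁻ ζ, ∫⁻ z in lens ζ, F (ζ, z) ∂ν ∂weightMeasure ω := by
        rw [lintegral_const_mul' _ _ (by simp), lintegral_lens_swap hFm]
    _ ≤ 2 * ∫⁻ ζ, areaFunction ν q f ζ * (2 * C * C * N) ∂weightMeasure ω :=
        mul_le_mul_right (lintegral_mono fun ζ => (h2 ζ).trans (mul_le_mul_right hBr _)) _
    _ = _ := by
        rw [lintegral_mul_const _ hAm, tentENorm, if_neg (fun h => ENNReal.one_ne_top h.1),
          eLpNorm_one_eq_lintegral_enorm]
        simp only [enorm_eq_self]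
        ring

/-- The pairing of `T^p_q` with `T^{p'}_{q'}` is bounded. -/
theorem TentControl.exists_pairing_le (H : TentControl ω C) (p q p' q' : ℝ≥0∞)
    (hp1 : 1 ≤ p) (hq1 : 1 ≤ q) (hq'1 : 1 ≤ q') (hp : p ≠ ∞) (hq : q ≠ ∞) (hpq : p + q ≠ 2)
    (hpp' : p.HolderConjugate p') (hqq' : q.HolderConjugate q') :
    ∃ K : ℝ≥0, ∀ (ν : Measure Disc) [SFinite ν] (f g : Disc → ℂ),
      Measurable f → Measurable g → tentENorm ν ω p' q' g ≠ ∞ →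
      ∫⁻ z, ‖f z‖ₑ * ‖g z‖ₑ * tentMass ω z ∂ν
        ≤ K * (tentENorm ν ω p q f * tentENorm ν ω p' q' g) := by
  by_cases hp1' : p = 1
  · have hq1' : q ≠ 1 := by rintro rfl; rw [hp1'] at hpq; exact hpq (by norm_num)
    have hp'top : p' = ∞ := by
      have := hpp'.inv_add_inv_eq_inv
      rw [hp1'] at this
      simpa using this
    refine ⟨4 * C * C, fun ν _ f g hf hg hgt => ?_⟩
    rw [hp'top] at hgt ⊢
    rw [hp1']
    have := pairing_le_of_eq_one H (lt_of_le_of_ne hq1 (Ne.symm hq1')) hq hqq' hf hg hgt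
    simpa using this
  · refine ⟨1, fun ν _ f g hf hg _ => ?_⟩
    rw [ENNReal.coe_one, one_mul]
    exact pairing_le_of_one_lt H (lt_of_le_of_ne hp1 (Ne.symm hp1')) hp hq1 hq'1 hpp' hqq' hf hg

end TentDuality

namespace TentDuality

/-! ### Representation of functionals -/

open Classical in
/-- The Radon–Nikodym theorem for a complex valued set function. -/
lemma exists_integrable_of_hasSum {α : Type*} [MeasurableSpace α] (ν : Measure α) [SigmaFinite ν]
    (m : Set α → ℂ)
    (hsum : ∀ A : ℕ → Set α, (∀ i, MeasurableSet (A i)) → Pairwise (Function.onFun Disjoint A) →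
      HasSum (fun i => m (A i)) (m (⋃ i, A i)))
    (hnull : ∀ A, MeasurableSet A → ν A = 0 → m A = 0) :
    ∃ h : α → ℂ, Measurable h ∧ Integrable h ν ∧
      ∀ A, MeasurableSet A → m A = ∫ x in A, h x ∂ν := by
  let c : ComplexMeasure α :=
    { measureOf' := fun A => if MeasurableSet A then m A else 0
      empty' := by simp [hnull ∅ MeasurableSet.empty measure_empty]
      not_measurable' := fun A hA => if_neg hA
      m_iUnion' := fun A hA hd => by
        have := hsum A hA hd
        simpa [hA, MeasurableSet.iUnion hA] using this }
  have hc : ∀ A, MeasurableSet A → c A = m A := fun A hA => if_pos hA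
  have hac : ∀ A, ν.toENNRealVectorMeasure A = 0 → c A = 0 := fun A h => by
    by_cases hA : MeasurableSet A
    · rw [Measure.toENNRealVectorMeasure_apply_measurable hA] at h
      rw [hc A hA, hnull A hA h]
    · exact if_neg hA
  have hr : ∀ A, ComplexMeasure.re c A = (c A).re := fun _ => rfl
  have hi : ∀ A, ComplexMeasure.im c A = (c A).im := fun _ => rfl
  have hre : VectorMeasure.AbsolutelyContinuous (ComplexMeasure.re c) ν.toENNRealVectorMeasure :=
    fun A h =>
      (hr A).trans (congrArg Complex.re (hac A h))
  have him : VectorMeasure.AbsolutelyContinuous (ComplexMeasure.im c) ν.toENNRealVectorMeasure :=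
    fun A h =>
      (hi A).trans (congrArg Complex.im (hac A h))
  have e1 := SignedMeasure.withDensityᵥ_rnDeriv_eq _ ν hre
  have e2 := SignedMeasure.withDensityᵥ_rnDeriv_eq _ ν him
  set a := (ComplexMeasure.re c).rnDeriv ν with ha
  set b := (ComplexMeasure.im c).rnDeriv ν with hb
  have ia : Integrable a ν := SignedMeasure.integrable_rnDeriv _ _
  have ib : Integrable b ν := SignedMeasure.integrable_rnDeriv _ _
  have ih : Integrable (fun x => (a x : ℂ) + (b x : ℂ) * Complex.I) ν :=
    ia.ofReal.add (ib.ofReal.mul_const _)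
  refine ⟨fun x => (a x : ℂ) + (b x : ℂ) * Complex.I, ?_, ih, fun A hA => ?_⟩
  · have h1 : Measurable a := SignedMeasure.measurable_rnDeriv _ _
    have h2 : Measurable b := SignedMeasure.measurable_rnDeriv _ _
    fun_prop
  · have f1 : (c A).re = ∫ x in A, a x ∂ν := by
      rw [← withDensityᵥ_apply ia hA, e1, hr]
    have f2 : (c A).im = ∫ x in A, b x ∂ν := by
      rw [← withDensityᵥ_apply ib hA, e2, hi]
    rw [← hc A hA, integral_add (f := fun x => (a x : ℂ)) (g := fun x => (b x : ℂ) * Complex.I)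
      ia.ofReal.integrableOn (ib.ofReal.mul_const _).integrableOn, integral_mul_const,
      integral_complex_ofReal, integral_complex_ofReal, ← f1, ← f2, Complex.re_add_im]

variable {ω : ℂ → ℝ} {ν : Measure Disc} {p q : ℝ≥0∞}

lemma tentENorm_ne_top_of_lintegral [IsFiniteMeasure (weightMeasure ω)] (hp1 : 1 ≤ p) (hq1 : 1 ≤ q)
    (hp : p ≠ ∞) (hq : q ≠ ∞) {f : Disc → ℂ} (hf : ∫⁻ z, ‖f z‖ₑ ^ q.toReal ∂ν ≠ ∞) :
    tentENorm ν ω p q f ≠ ∞ := by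
  have hp0 : p ≠ 0 := (zero_lt_one.trans_le hp1).ne'
  have hq0 : q ≠ 0 := (zero_lt_one.trans_le hq1).ne'
  have hpr : 0 < p.toReal := ENNReal.toReal_pos hp0 hp
  have hqr : 0 < q.toReal := ENNReal.toReal_pos hq0 hq
  rw [tentENorm_eq_lintegral ν ω hp0 hp hq0 hq]
  refine ENNReal.rpow_ne_top_of_nonneg (by positivity) ?_
  refine ne_top_of_le_ne_top ?_ (lintegral_mono fun ζ => ENNReal.rpow_le_rpow
    (lintegral_mono' Measure.restrict_le_self le_rfl) (by positivity))
  rw [lintegral_const]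
  exact ENNReal.mul_ne_top (ENNReal.rpow_ne_top_of_nonneg (by positivity) hf) (measure_ne_top _ _)

lemma tentENorm_mono (hp : p ≠ ∞) {f g : Disc → ℂ} (h : ∀ z, ‖f z‖ₑ ≤ ‖g z‖ₑ) :
    tentENorm ν ω p q f ≤ tentENorm ν ω p q g := by
  rw [tentENorm, tentENorm, if_neg fun h => hp h.1, if_neg fun h => hp h.1]
  refine eLpNorm_mono_enorm fun ζ => ?_
  simp only [enorm_eq_self]
  exact eLpNorm_mono_enorm h

variable [SFinite ν]

/-- Dominated convergence in the tent norm. -/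
lemma tendsto_tentENorm_sub (hp1 : 1 ≤ p) (hq1 : 1 ≤ q) (hp : p ≠ ∞) (hq : q ≠ ∞)
    {ι : Type*} {l : Filter ι} [l.IsCountablyGenerated] {F : ι → Disc → ℂ} {f : Disc → ℂ}
    (hF : ∀ i, Measurable (F i)) (hf : Measurable f) (hft : tentENorm ν ω p q f ≠ ∞)
    (hle : ∀ i z, ‖F i z - f z‖ₑ ≤ 3 * ‖f z‖ₑ)
    (hlim : ∀ z, Tendsto (fun i => F i z) l (𝓝 (f z))) :
    Tendsto (fun i => tentENorm ν ω p q (F i - f)) l (𝓝 0) := by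
  have hp0 : p ≠ 0 := (zero_lt_one.trans_le hp1).ne'
  have hq0 : q ≠ 0 := (zero_lt_one.trans_le hq1).ne'
  have hpr : 0 < p.toReal := ENNReal.toReal_pos hp0 hp
  have hqr : 0 < q.toReal := ENNReal.toReal_pos hq0 hq
  simp only [tentENorm_eq_lintegral ν ω hp0 hp hq0 hq] at hft ⊢
  set a := p.toReal
  set b := q.toReal
  have hab : 0 < a / b := div_pos hpr hqr
  have hinner : Measurable fun ζ => ∫⁻ z in lens ζ, ‖f z‖ₑ ^ b ∂ν :=
    measurable_lintegral_lens (F := fun x => ‖f x.2‖ₑ ^ b)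
      ((hf.comp measurable_snd).enorm.pow_const b)
  have hft' : ∫⁻ ζ, (∫⁻ z in lens ζ, ‖f z‖ₑ ^ b ∂ν) ^ (a / b) ∂weightMeasure ω ≠ ∞ := by
    intro h
    rw [h, ENNReal.top_rpow_of_pos (by positivity)] at hft
    exact hft rfl
  have h3 : (3 : ℝ≥0∞) ^ b ≠ ∞ := ENNReal.rpow_ne_top_of_nonneg hqr.le (by simp)
  have hdom : ∀ i ζ, ∫⁻ z in lens ζ, ‖(F i - f) z‖ₑ ^ b ∂ν
      ≤ 3 ^ b * ∫⁻ z in lens ζ, ‖f z‖ₑ ^ b ∂ν := by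
    intro i ζ
    rw [← lintegral_const_mul' _ _ h3]
    refine lintegral_mono fun z => ?_
    rw [← ENNReal.mul_rpow_of_nonneg _ _ hqr.le]
    exact ENNReal.rpow_le_rpow (hle i z) hqr.le
  have key : Tendsto (fun i => ∫⁻ ζ, (∫⁻ z in lens ζ, ‖(F i - f) z‖ₑ ^ b ∂ν) ^ (a / b)
      ∂weightMeasure ω) l (𝓝 (∫⁻ _, 0 ∂weightMeasure ω)) := by
    -- Dominated convergence is used over the disc and, for almost every ζ (where the lens integral
    -- of f is finite), over the lens.
    refine tendsto_lintegral_filter_of_dominated_convergence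
      (fun ζ => (3 ^ b * ∫⁻ z in lens ζ, ‖f z‖ₑ ^ b ∂ν) ^ (a / b)) ?_ ?_ ?_ ?_
    · refine Eventually.of_forall fun i => ?_
      exact (measurable_lintegral_lens (F := fun x => ‖(F i - f) x.2‖ₑ ^ b)
        ((((hF i).sub hf).comp measurable_snd).enorm.pow_const b)).pow_const _
    · exact Eventually.of_forall fun i => Eventually.of_forall fun ζ =>
        ENNReal.rpow_le_rpow (hdom i ζ) hab.le
    · simp only [ENNReal.mul_rpow_of_nonneg _ _ hab.le]
      rw [lintegral_const_mul _ (hinner.pow_const _)]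
      exact ENNReal.mul_ne_top (ENNReal.rpow_ne_top_of_nonneg hab.le h3) hft'
    · filter_upwards [ae_lt_top (hinner.pow_const (a / b)) hft'] with ζ hζ
      have hζ' : ∫⁻ z in lens ζ, ‖f z‖ₑ ^ b ∂ν ≠ ∞ := by
        intro h
        rw [h, ENNReal.top_rpow_of_pos hab] at hζ
        exact lt_irrefl _ hζ
      have hin : Tendsto (fun i => ∫⁻ z in lens ζ, ‖(F i - f) z‖ₑ ^ b ∂ν) l
          (𝓝 (∫⁻ z in lens ζ, 0 ∂ν)) := by
        refine tendsto_lintegral_filter_of_dominated_convergence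
          (fun z => 3 ^ b * ‖f z‖ₑ ^ b) ?_ ?_ ?_ ?_
        · exact Eventually.of_forall fun i => ((hF i).sub hf).enorm.pow_const b
        · refine Eventually.of_forall fun i => Eventually.of_forall fun z => ?_
          rw [← ENNReal.mul_rpow_of_nonneg _ _ hqr.le]
          exact ENNReal.rpow_le_rpow (hle i z) hqr.le
        · rw [lintegral_const_mul' _ _ h3]
          exact ENNReal.mul_ne_top h3 hζ'
        · refine Eventually.of_forall fun z => ?_
          have h1 : Tendsto (fun i => ‖(F i - f) z‖ₑ) l (𝓝 0) := by
            have := ((hlim z).sub_const (f z)).enorm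
            simpa using this
          have h2 := (ENNReal.continuous_rpow_const (y := b)).tendsto 0 |>.comp h1
          rwa [ENNReal.zero_rpow_of_pos hqr] at h2
      rw [lintegral_zero] at hin
      have h2 := (ENNReal.continuous_rpow_const (y := a / b)).tendsto 0 |>.comp hin
      rwa [ENNReal.zero_rpow_of_pos hab] at h2
  rw [lintegral_zero] at key
  have h2 := (ENNReal.continuous_rpow_const (y := 1 / a)).tendsto 0 |>.comp key
  rwa [ENNReal.zero_rpow_of_pos (by positivity)] at h2

/-- The element of the tent space given by a measurable function of finite norm. -/
noncomputable def TentSpace.of [Fact (1 ≤ p)] [Fact (1 ≤ q)] (f : Disc → ℂ) (hf : Measurable f)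
    (hft : tentENorm ν ω p q f ≠ ∞) : TentSpace ν ω p q :=
  ⟨AEEqFun.mk f hf.aestronglyMeasurable, by
    change tentENorm ν ω p q _ < ∞
    rw [tentENorm_congr ω p q (AEEqFun.coeFn_mk f _)]
    exact hft.lt_top⟩

section Of

variable [Fact (1 ≤ p)] [Fact (1 ≤ q)]

lemma TentSpace.coeFn_of {f : Disc → ℂ} (hf : Measurable f)
    (hft : tentENorm ν ω p q f ≠ ∞) :
    ((TentSpace.of f hf hft : TentSpace ν ω p q) : Disc →ₘ[ν] ℂ) =ᵐ[ν] f :=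
  AEEqFun.coeFn_mk f _

lemma TentSpace.norm_of {f : Disc → ℂ} (hf : Measurable f) (hft : tentENorm ν ω p q f ≠ ∞) :
    ‖(TentSpace.of f hf hft : TentSpace ν ω p q)‖ = (tentENorm ν ω p q f).toReal := by
  rw [TentSpace.norm_def, tentENorm_congr ω p q (TentSpace.coeFn_of hf hft)]

lemma TentSpace.ext_ae {f g : TentSpace ν ω p q}
    (h : (f : Disc →ₘ[ν] ℂ) =ᵐ[ν] (g : Disc →ₘ[ν] ℂ)) : f = g :=
  Subtype.ext (AEEqFun.ext h)

lemma TentSpace.of_coeFn (f : TentSpace ν ω p q) :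
    TentSpace.of (f : Disc →ₘ[ν] ℂ) (AEEqFun.measurable _) (ne_of_lt f.2) = f :=
  TentSpace.ext_ae (TentSpace.coeFn_of _ _)

lemma TentSpace.of_add {f g : Disc → ℂ} (hf : Measurable f) (hg : Measurable g)
    (hft : tentENorm ν ω p q f ≠ ∞) (hgt : tentENorm ν ω p q g ≠ ∞)
    (hfg : tentENorm ν ω p q (f + g) ≠ ∞) :
    TentSpace.of (f + g) (hf.add hg) hfg
      = (TentSpace.of f hf hft + TentSpace.of g hg hgt : TentSpace ν ω p q) := by
  refine TentSpace.ext_ae ?_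
  rw [Submodule.coe_add]
  filter_upwards [TentSpace.coeFn_of (hf.add hg) hfg, TentSpace.coeFn_of hf hft,
    TentSpace.coeFn_of hg hgt, AEEqFun.coeFn_add
      ((TentSpace.of f hf hft : TentSpace ν ω p q) : Disc →ₘ[ν] ℂ)
      ((TentSpace.of g hg hgt : TentSpace ν ω p q) : Disc →ₘ[ν] ℂ)] with z h1 h2 h3 h4
  rw [h1, h4, Pi.add_apply, Pi.add_apply, h2, h3]

lemma TentSpace.of_smul (c : ℂ) {f : Disc → ℂ} (hf : Measurable f)
    (hft : tentENorm ν ω p q f ≠ ∞) (hcf : tentENorm ν ω p q (c • f) ≠ ∞) :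
    TentSpace.of (c • f) (hf.const_smul c) hcf
      = (c • TentSpace.of f hf hft : TentSpace ν ω p q) := by
  refine TentSpace.ext_ae ?_
  rw [Submodule.coe_smul]
  filter_upwards [TentSpace.coeFn_of (hf.const_smul c) hcf, TentSpace.coeFn_of hf hft,
    AEEqFun.coeFn_smul c ((TentSpace.of f hf hft : TentSpace ν ω p q) : Disc →ₘ[ν] ℂ)]
    with z h1 h2 h3
  rw [h1, h3, Pi.smul_apply, Pi.smul_apply, h2]

lemma TentSpace.tendsto_of (hp : p ≠ ∞) (hq : q ≠ ∞)
    {ι : Type*} {l : Filter ι} [l.IsCountablyGenerated] {F : ι → Disc → ℂ} {f : Disc → ℂ}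
    (hF : ∀ i, Measurable (F i)) (hf : Measurable f)
    (hFt : ∀ i, tentENorm ν ω p q (F i) ≠ ∞) (hft : tentENorm ν ω p q f ≠ ∞)
    (hle : ∀ i z, ‖F i z - f z‖ₑ ≤ 3 * ‖f z‖ₑ)
    (hlim : ∀ z, Tendsto (fun i => F i z) l (𝓝 (f z))) :
    Tendsto (fun i => (TentSpace.of (F i) (hF i) (hFt i) : TentSpace ν ω p q)) l
      (𝓝 (TentSpace.of f hf hft)) := by
  have h := tendsto_tentENorm_sub Fact.out Fact.out hp hq hF hf hft hle hlim
  rw [tendsto_iff_norm_sub_tendsto_zero]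
  have h' := (ENNReal.tendsto_toReal ENNReal.zero_ne_top).comp h
  refine h'.congr fun i => ?_
  rw [TentSpace.norm_def, Function.comp_apply]
  congr 1
  refine tentENorm_congr ω p q ?_
  rw [Submodule.coe_sub]
  filter_upwards [TentSpace.coeFn_of (hF i) (hFt i), TentSpace.coeFn_of hf hft,
    AEEqFun.coeFn_sub ((TentSpace.of (F i) (hF i) (hFt i) : TentSpace ν ω p q) : Disc →ₘ[ν] ℂ)
      ((TentSpace.of f hf hft : TentSpace ν ω p q) : Disc →ₘ[ν] ℂ)] with z h1 h2 h3
  rw [h3, Pi.sub_apply, Pi.sub_apply, h1, h2]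

end Of

end TentDuality

/-! ### Densities of continuous functionals -/

namespace TentDuality

/-- A `σ`-finite measure admits a positive function of finite tent norm. -/
lemma exists_pos_tentENorm_ne_top (ν : Measure Disc) [SigmaFinite ν] (ω : ℂ → ℝ)
    [IsFiniteMeasure (weightMeasure ω)] {p q : ℝ≥0∞} (hp1 : 1 ≤ p) (hq1 : 1 ≤ q)
    (hp : p ≠ ∞) (hq : q ≠ ∞) :
    ∃ w : Disc → ℝ, Measurable w ∧ (∀ z, 0 < w z) ∧
      tentENorm ν ω p q (fun z => (w z : ℂ)) ≠ ∞ := by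
  have hqr : 0 < q.toReal := ENNReal.toReal_pos (zero_lt_one.trans_le hq1).ne' hq
  obtain ⟨g, hg0, hgm, hg⟩ := exists_pos_lintegral_lt_of_sigmaFinite ν one_ne_zero
  refine ⟨fun z => (g z : ℝ) ^ (1 / q.toReal), hgm.coe_nnreal_real.pow_const _,
    fun z => Real.rpow_pos_of_pos (hg0 z) _,
    tentENorm_ne_top_of_lintegral hp1 hq1 hp hq (ne_top_of_lt (b := 1) ?_)⟩
  refine lt_of_eq_of_lt (lintegral_congr fun z => ?_) hg
  rw [← ofReal_norm, Complex.norm_real, Real.norm_of_nonneg (by positivity),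
    ENNReal.ofReal_rpow_of_nonneg (by positivity) hqr.le, ← Real.rpow_mul (by positivity),
    one_div_mul_cancel hqr.ne', Real.rpow_one, ENNReal.ofReal_coe_nnreal]

variable {ω : ℂ → ℝ} {ν : Measure Disc} {p q : ℝ≥0∞}

lemma tentENorm_simpleFunc_mul_ne_top (hp : p ≠ ∞) (hq1 : 1 ≤ q) {W : Disc → ℂ}
    (hW : tentENorm ν ω p q W ≠ ∞) (φ : SimpleFunc Disc ℂ) :
    tentENorm ν ω p q (fun z => φ z * W z) ≠ ∞ := by
  obtain ⟨c, hc⟩ := φ.exists_forall_norm_le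
  refine ne_top_of_le_ne_top (ENNReal.mul_ne_top (enorm_ne_top (x := (c : ℂ))) hW)
    ((tentENorm_mono hp fun z => ?_).trans (tentENorm_smul_le ν ω p hq1 (c : ℂ) W))
  rw [Pi.smul_apply, smul_eq_mul, enorm_mul, enorm_mul]
  gcongr
  rw [enorm_le_iff_norm_le, Complex.norm_real]
  exact (hc z).trans (le_abs_self c)

section Of

variable [SFinite ν] [Fact (1 ≤ p)] [Fact (1 ≤ q)]

lemma TentSpace.of_congr {f g : Disc → ℂ} (hf : Measurable f) (hg : Measurable g)
    (hft : tentENorm ν ω p q f ≠ ∞) (hgt : tentENorm ν ω p q g ≠ ∞) (h : f =ᵐ[ν] g) :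
    (TentSpace.of f hf hft : TentSpace ν ω p q) = TentSpace.of g hg hgt :=
  TentSpace.ext_ae ((TentSpace.coeFn_of hf hft).trans (h.trans (TentSpace.coeFn_of hg hgt).symm))

end Of

variable [SigmaFinite ν] [Fact (1 ≤ p)] [Fact (1 ≤ q)]

/-- The set function `A ↦ L (χ_A W)` has a density. -/
lemma exists_density_indicator (hp : p ≠ ∞) (hq : q ≠ ∞) {W : Disc → ℂ} (hWm : Measurable W)
    (hWt : ∀ A : Set Disc, tentENorm ν ω p q (A.indicator W) ≠ ∞)
    (L : StrongDual ℂ (TentSpace ν ω p q)) :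
    ∃ h : Disc → ℂ, Measurable h ∧ Integrable h ν ∧
      ∀ A (hA : MeasurableSet A),
        L (TentSpace.of (A.indicator W) (hWm.indicator hA) (hWt A)) = ∫ x in A, h x ∂ν := by
  classical
  let m : Set Disc → ℂ := fun A => if hA : MeasurableSet A then
    L (TentSpace.of (A.indicator W) (hWm.indicator hA) (hWt A)) else 0
  have hm : ∀ A (hA : MeasurableSet A),
      m A = L (TentSpace.of (A.indicator W) (hWm.indicator hA) (hWt A)) := fun A hA => dif_pos hA
  suffices H : ∃ h : Disc → ℂ, Measurable h ∧ Integrable h ν ∧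
      ∀ A, MeasurableSet A → m A = ∫ x in A, h x ∂ν by
    obtain ⟨h, h1, h2, h3⟩ := H
    exact ⟨h, h1, h2, fun A hA => by rw [← hm A hA, h3 A hA]⟩
  -- Countable additivity is continuity of L: the indicators of finite unions, multiplied by W,
  -- converge in tent norm by dominated convergence. The factor W keeps every indicator in the
  -- space.
  refine exists_integrable_of_hasSum ν m ?_ ?_
  · intro A hA hd
    have hU : ∀ s : Finset ℕ, MeasurableSet (⋃ i ∈ s, A i) :=
      fun s => s.measurableSet_biUnion fun i _ => hA i
    have hsum : ∀ s : Finset ℕ, ∑ i ∈ s, m (A i) = m (⋃ i ∈ s, A i) := by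
      intro s
      induction s using Finset.induction_on with
      | empty =>
        rw [Finset.sum_empty, hm _ (hU ∅)]
        rw [show (TentSpace.of ((⋃ i ∈ (∅ : Finset ℕ), A i).indicator W)
          (hWm.indicator (hU ∅)) (hWt _) : TentSpace ν ω p q) = 0 from ?_, map_zero]
        refine TentSpace.ext_ae ((TentSpace.coeFn_of _ _).trans ?_)
        simp only [Finset.notMem_empty, Set.iUnion_of_empty, Set.iUnion_empty,
          Set.indicator_empty]
        exact AEEqFun.coeFn_zero.symm
      | insert j s hj ih =>
        rw [Finset.sum_insert hj, ih, hm _ (hA j), hm _ (hU s), hm _ (hU _), ← map_add]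
        congr 1
        have hdj : Disjoint (A j) (⋃ i ∈ s, A i) := by
          simp only [Set.disjoint_iUnion_right]
          exact fun i hi => hd fun h => hj (h ▸ hi)
        have e : (⋃ i ∈ insert j s, A i).indicator W
            = (A j).indicator W + (⋃ i ∈ s, A i).indicator W := by
          rw [Finset.set_biUnion_insert, Set.indicator_union_of_disjoint hdj]
          rfl
        rw [← TentSpace.of_add (hWm.indicator (hA j)) (hWm.indicator (hU s)) (hWt _) (hWt _)
          (by rw [← e]; exact hWt _)]
        exact TentSpace.of_congr _ _ _ _ (Eventually.of_forall fun z => by rw [e])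
    unfold HasSum
    simp only [hsum, SummationFilter.unconditional_filter]
    simp only [hm _ (hU _), hm _ (MeasurableSet.iUnion hA)]
    refine (L.continuous.tendsto _).comp (TentSpace.tendsto_of hp hq _ _ _ _ ?_ ?_)
    · intro s z
      by_cases h1 : z ∈ ⋃ i, A i
      · rw [Set.indicator_of_mem h1]
        by_cases h2 : z ∈ ⋃ i ∈ s, A i
        · rw [Set.indicator_of_mem h2]; simp
        · rw [Set.indicator_of_notMem h2, zero_sub, enorm_neg]
          exact le_mul_of_one_le_left' (by norm_num)
      · have h2 : z ∉ ⋃ i ∈ s, A i := fun h => h1 (Set.iUnion₂_subset_iUnion _ _ h)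
        rw [Set.indicator_of_notMem h1, Set.indicator_of_notMem h2]; simp
    · intro z
      exact (tendsto_indicator_biUnion_finset A W z).mono_right (pure_le_nhds _)
  · intro A hA h0
    rw [hm A hA]
    rw [show (TentSpace.of (A.indicator W) (hWm.indicator hA) (hWt A) : TentSpace ν ω p q) = 0
      from ?_, map_zero]
    refine TentSpace.ext_ae ((TentSpace.coeFn_of _ _).trans ?_)
    exact (indicator_meas_zero h0).trans AEEqFun.coeFn_zero.symm

/-- Every continuous linear functional on the tent space is integration against a function. -/
lemma exists_density (hp : p ≠ ∞) (hq : q ≠ ∞) {w : Disc → ℝ} (hwm : Measurable w)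
    (hw0 : ∀ z, 0 < w z) (hwt : tentENorm ν ω p q (fun z => (w z : ℂ)) ≠ ∞)
    (L : StrongDual ℂ (TentSpace ν ω p q)) :
    ∃ k : Disc → ℂ, Measurable k ∧ Integrable (fun z => w z * k z) ν ∧
      ∀ f (hf : Measurable f) (hft : tentENorm ν ω p q f ≠ ∞),
        Integrable (fun z => f z * k z) ν → L (TentSpace.of f hf hft) = ∫ z, f z * k z ∂ν := by
  have hq1 : 1 ≤ q := Fact.out
  set W : Disc → ℂ := fun z => (w z : ℂ) with hW
  have hWm : Measurable W := by fun_prop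
  have hW0 : ∀ z, W z ≠ 0 := fun z => Complex.ofReal_ne_zero.2 (hw0 z).ne'
  obtain ⟨h, hhm, hhi, hh⟩ := exists_density_indicator hp hq hWm (fun A =>
    ne_top_of_le_ne_top hwt (tentENorm_mono hp fun z => enorm_indicator_le_enorm_self W z)) L
  have hφm : ∀ φ : SimpleFunc Disc ℂ, Measurable fun z => φ z * W z :=
    fun φ => φ.measurable.mul hWm
  have hφt := tentENorm_simpleFunc_mul_ne_top (ν := ν) hp hq1 hwt
  have hint : ∀ φ : SimpleFunc Disc ℂ, Integrable (fun z => φ z * h z) ν := by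
    intro φ
    obtain ⟨c, hc⟩ := φ.exists_forall_norm_le
    exact hhi.bdd_mul φ.measurable.aestronglyMeasurable (Eventually.of_forall hc)
  have hsimple : ∀ φ : SimpleFunc Disc ℂ,
      L (TentSpace.of _ (hφm φ) (hφt φ)) = ∫ z, φ z * h z ∂ν := by
    intro φ
    induction φ using SimpleFunc.induction with
    | const c hs =>
      rename_i s
      have hst := ne_top_of_le_ne_top hwt (tentENorm_mono (ν := ν) (ω := ω) (q := q) hp
        fun z => enorm_indicator_le_enorm_self (s := s) W z)
      have hcst : tentENorm ν ω p q (c • s.indicator W) ≠ ∞ :=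
        ne_top_of_le_ne_top (ENNReal.mul_ne_top enorm_ne_top hst) (tentENorm_smul_le ν ω p hq1 _ _)
      have e : TentSpace.of _ (hφm _) (hφt (SimpleFunc.piecewise s hs (SimpleFunc.const Disc c)
          (SimpleFunc.const Disc 0)))
          = (c • TentSpace.of (s.indicator W) (hWm.indicator hs) hst : TentSpace ν ω p q) := by
        rw [← TentSpace.of_smul c _ _ hcst]
        refine TentSpace.of_congr _ _ _ _ (Eventually.of_forall fun z => ?_)
        by_cases hz : z ∈ s <;> simp [hz]
      rw [e, map_smul, hh s hs, smul_eq_mul, ← integral_const_mul, ← integral_indicator hs]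
      congr 1
      funext z
      by_cases hz : z ∈ s <;> simp [hz]
    | add hd hφ hψ =>
      rename_i φ ψ
      have e : TentSpace.of _ (hφm _) (hφt (φ + ψ)) = (TentSpace.of _ (hφm _) (hφt φ)
          + TentSpace.of _ (hφm _) (hφt ψ) : TentSpace ν ω p q) := by
        have e' : (fun z => (φ + ψ) z * W z) = (fun z => φ z * W z) + fun z => ψ z * W z := by
          funext z; simp [add_mul]
        rw [← TentSpace.of_add (hφm φ) (hφm ψ) (hφt φ) (hφt ψ) (by rw [← e']; exact hφt _)]
        exact TentSpace.of_congr _ _ _ _ (Eventually.of_forall fun z => by rw [e'])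
      rw [e, map_add, hφ, hψ, ← integral_add (hint φ) (hint ψ)]
      simp [add_mul]
  refine ⟨fun z => h z / W z, hhm.div hWm, ?_, fun f hf hft hfi => ?_⟩
  · refine hhi.congr (Eventually.of_forall fun z => ?_)
    exact (mul_div_cancel₀ (h z) (hW0 z)).symm
  · have hu : Measurable fun z => f z / W z := hf.div hWm
    -- Simple functions approximate f / W with modulus at most 2|f / W|, so φ_n W - f is dominated
    -- by 3|f|; this is the 3 in `tendsto_tentENorm_sub`.
    let φ : ℕ → SimpleFunc Disc ℂ :=
      SimpleFunc.approxOn (fun z => f z / W z) hu Set.univ 0 (Set.mem_univ _)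
    have hφlim : ∀ z, Tendsto (fun n => φ n z) atTop (𝓝 (f z / W z)) := fun z =>
      SimpleFunc.tendsto_approxOn hu (Set.mem_univ _) (by simp)
    have hφle : ∀ n z, ‖φ n z‖ ≤ 2 * ‖f z / W z‖ := fun n z =>
      (SimpleFunc.norm_approxOn_zero_le hu (Set.mem_univ _) z n).trans_eq (two_mul _).symm
    have t1 : Tendsto (fun n => L (TentSpace.of _ (hφm (φ n)) (hφt (φ n)))) atTop
        (𝓝 (L (TentSpace.of f hf hft))) := by
      refine (L.continuous.tendsto _).comp (TentSpace.tendsto_of hp hq _ _ _ _ ?_ ?_)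
      · intro n z
        have h3 : ‖φ n z * W z - f z‖ ≤ 3 * ‖f z‖ := by
          have hn := mul_le_mul_of_nonneg_right (hφle n z) (norm_nonneg (W z))
          rw [norm_div, mul_assoc, div_mul_cancel₀ _ (norm_ne_zero_iff.2 (hW0 z)),
            ← norm_mul] at hn
          linarith [norm_sub_le (φ n z * W z) (f z)]
        rw [show (3 : ℝ≥0∞) = ENNReal.ofReal 3 by simp, ← ofReal_norm,
          ← ofReal_norm, ← ENNReal.ofReal_mul (by norm_num)]
        exact ENNReal.ofReal_le_ofReal h3
      · intro z
        have := (hφlim z).mul_const (W z)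
        rwa [div_mul_cancel₀ _ (hW0 z)] at this
    have t2 : Tendsto (fun n => ∫ z, φ n z * h z ∂ν) atTop
        (𝓝 (∫ z, f z * (h z / W z) ∂ν)) := by
      refine tendsto_integral_of_dominated_convergence (fun z => 2 * ‖f z * (h z / W z)‖)
        (fun n => (hint (φ n)).aestronglyMeasurable) (hfi.norm.const_mul 2) ?_ ?_
      · refine fun n => Eventually.of_forall fun z => ?_
        rw [norm_mul]
        refine (mul_le_mul_of_nonneg_right (hφle n z) (norm_nonneg _)).trans_eq ?_
        rw [mul_assoc, ← norm_mul, div_mul_eq_mul_div, mul_div_assoc]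
      · refine Eventually.of_forall fun z => ?_
        have := (hφlim z).mul_const (h z)
        rwa [div_mul_eq_mul_div, mul_div_assoc] at this
    simp only [hsimple] at t1
    exact tendsto_nhds_unique t1 t2

/-- A function representing a functional `L` satisfies the test bound with constant `‖L‖`. -/
lemma testBound_of_representation (hp : p ≠ ∞) (hq : q ≠ ∞) {w : Disc → ℝ} (hwm : Measurable w)
    (hw0 : ∀ z, 0 < w z) (hwt : tentENorm ν ω p q (fun z => (w z : ℂ)) ≠ ∞)
    (hmass : ∀ z, tentMass ω z ≠ ∞) (L : StrongDual ℂ (TentSpace ν ω p q)) {g : Disc → ℂ}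
    (hg : Measurable g)
    (hwg : Integrable (fun z => w z * (‖g z‖ * (tentMass ω z).toReal)) ν)
    (hL : ∀ f (hf : Measurable f) (hft : tentENorm ν ω p q f ≠ ∞),
      Integrable (fun z => f z * conj (g z) * ((tentMass ω z).toReal : ℂ)) ν →
      L (TentSpace.of f hf hft) = ∫ z, f z * conj (g z) * ((tentMass ω z).toReal : ℂ) ∂ν) :
    TestBound ν ω p.toReal q.toReal ‖L‖ₑ (fun z => ‖g z‖ₑ) := by
  have hp0 : p ≠ 0 := (zero_lt_one.trans_le Fact.out).ne'
  have hq0 : q ≠ 0 := (zero_lt_one.trans_le Fact.out).ne'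
  have hq1 : 1 ≤ q := Fact.out
  have hpr : 0 < p.toReal := ENNReal.toReal_pos hp0 hp
  have hqr : 0 < q.toReal := ENNReal.toReal_pos hq0 hq
  intro F hF
  -- The representation is available only for integrable products. Capping by n w secures this,
  -- since w g tentMass is integrable, and keeps the tent norm finite.
  let G : ℕ → Disc → ℝ≥0∞ := fun n z => min (F z) (n * ENNReal.ofReal (w z))
  have hGm : ∀ n, Measurable (G n) := fun n => hF.min (hwm.ennreal_ofReal.const_mul _)
  have hGt : ∀ n z, G n z ≠ ∞ := fun n z => ne_top_of_le_ne_top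
    (ENNReal.mul_ne_top (ENNReal.natCast_ne_top n) ENNReal.ofReal_ne_top) (min_le_right _ _)
  have hmm := measurable_tentMass ω
  have hlim : Tendsto (fun n => ∫⁻ z, G n z * ‖g z‖ₑ * tentMass ω z ∂ν) atTop
      (𝓝 (∫⁻ z, F z * ‖g z‖ₑ * tentMass ω z ∂ν)) := by
    refine lintegral_tendsto_of_tendsto_of_monotone
      (fun n => (((hGm n).mul hg.enorm).mul hmm).aemeasurable) ?_ ?_
    · refine Eventually.of_forall fun z m n hmn => ?_
      have : (m : ℝ≥0∞) ≤ n := by exact_mod_cast hmn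
      dsimp only [G]
      gcongr
    · refine Eventually.of_forall fun z => ?_
      have h1 : Tendsto (fun n : ℕ => (n : ℝ≥0∞) * ENNReal.ofReal (w z)) atTop (𝓝 ∞) := by
        have := ENNReal.Tendsto.mul_const (b := ENNReal.ofReal (w z)) ENNReal.tendsto_nat_nhds_top
          (Or.inr ENNReal.ofReal_ne_top)
        rwa [ENNReal.top_mul (ENNReal.ofReal_pos.2 (hw0 z)).ne'] at this
      have h2 : Tendsto (fun n => G n z) atTop (𝓝 (F z)) := by
        have := (tendsto_const_nhds (x := F z)).min h1
        rwa [min_eq_left le_top] at this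
      exact ENNReal.Tendsto.mul_const (ENNReal.Tendsto.mul_const h2 (Or.inr enorm_ne_top))
        (Or.inr (hmass z))
  refine le_of_tendsto' hlim fun n => ?_
  -- The phase of g makes the pairing positive. Where g = 0 the quotient is 0 by convention, and the
  -- integrand vanishes there anyway.
  let f : Disc → ℂ := fun z => ((G n z).toReal : ℂ) * (g z / (‖g z‖ : ℂ))
  have hf : Measurable f := by
    have h1 := (hGm n).ennreal_toReal
    have h2 := hg.norm
    exact (Complex.measurable_ofReal.comp h1).mul (hg.div (Complex.measurable_ofReal.comp h2))
  have hfn : ∀ z, ‖f z‖ ≤ (G n z).toReal := by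
    intro z
    simp only [f, norm_mul, norm_div, Complex.norm_real, norm_norm,
      Real.norm_of_nonneg ENNReal.toReal_nonneg]
    exact mul_le_of_le_one_right ENNReal.toReal_nonneg (div_self_le_one _)
  have hfe : ∀ z, ‖f z‖ₑ ≤ G n z := by
    intro z
    rw [← ofReal_norm]
    exact ENNReal.ofReal_le_of_le_toReal (hfn z)
  have hGw : ∀ z, (G n z).toReal ≤ n * w z := by
    intro z
    refine ENNReal.toReal_le_of_le_ofReal (mul_nonneg n.cast_nonneg (hw0 z).le) ?_
    rw [ENNReal.ofReal_mul n.cast_nonneg, ENNReal.ofReal_natCast]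
    exact min_le_right _ _
  have hft : tentENorm ν ω p q f ≠ ∞ := by
    refine ne_top_of_le_ne_top (ENNReal.mul_ne_top (enorm_ne_top (x := (n : ℂ))) hwt)
      ((tentENorm_mono hp fun z => ?_).trans (tentENorm_smul_le ν ω p hq1 (n : ℂ) _))
    rw [Pi.smul_apply, smul_eq_mul, enorm_le_iff_norm_le, norm_mul (n : ℂ), Complex.norm_real,
      Real.norm_of_nonneg (hw0 z).le, Complex.norm_natCast]
    exact (hfn z).trans (hGw z)
  have hphase : ∀ z, f z * conj (g z) * ((tentMass ω z).toReal : ℂ)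
      = (((G n z).toReal * ‖g z‖ * (tentMass ω z).toReal : ℝ) : ℂ) := by
    intro z
    have : g z / (‖g z‖ : ℂ) * conj (g z) = ‖g z‖ := by
      rw [div_mul_eq_mul_div, Complex.mul_conj, Complex.normSq_eq_norm_sq]
      push_cast
      rw [pow_two, mul_self_div_self]
    simp only [f]
    rw [mul_assoc ((G n z).toReal : ℂ), this]
    push_cast
    rfl
  have hreal : Integrable (fun z => (G n z).toReal * ‖g z‖ * (tentMass ω z).toReal) ν := by
    refine (hwg.const_mul (n : ℝ)).mono'
      (((hGm n).ennreal_toReal.mul hg.norm).mul hmm.ennreal_toReal).aestronglyMeasurable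
      (Eventually.of_forall fun z => ?_)
    rw [Real.norm_of_nonneg (by positivity), ← mul_assoc, mul_assoc ((G n z).toReal)]
    exact mul_le_mul_of_nonneg_right (hGw z) (by positivity)
  have hval := hL f hf hft (by simp only [hphase]; exact hreal.ofReal)
  simp only [hphase] at hval
  rw [integral_complex_ofReal] at hval
  have hI : ∫⁻ z, G n z * ‖g z‖ₑ * tentMass ω z ∂ν = ‖L (TentSpace.of f hf hft)‖ₑ := by
    rw [hval, ← ofReal_norm, Complex.norm_real, Real.norm_of_nonneg
      (integral_nonneg fun z => by positivity), ofReal_integral_eq_lintegral_ofReal hreal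
      (Eventually.of_forall fun z => by positivity)]
    refine lintegral_congr fun z => ?_
    rw [ENNReal.ofReal_mul (by positivity), ENNReal.ofReal_mul (by positivity),
      ENNReal.ofReal_toReal (hGt n z), ENNReal.ofReal_toReal (hmass z), ofReal_norm]
  rw [hI]
  refine (L.le_opENorm _).trans (mul_le_mul_right ?_ _)
  rw [← ofReal_norm, TentSpace.norm_of, ENNReal.ofReal_toReal hft,
    tentENorm_eq_lintegral ν ω hp0 hp hq0 hq]
  gcongr with ζ z
  exact (hfe z).trans (min_le_left _ _)

end TentDuality

namespace TentDuality

/-! ### The pairing -/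

lemma enorm_pairing {ω : ℂ → ℝ} {z : Disc} (hz : tentMass ω z ≠ ∞) (a b : ℂ) :
    ‖a * conj b * ((tentMass ω z).toReal : ℂ)‖ₑ = ‖a‖ₑ * ‖b‖ₑ * tentMass ω z := by
  rw [enorm_mul, enorm_mul, RCLike.enorm_conj, ← ofReal_norm ((tentMass ω z).toReal : ℂ),
    Complex.norm_real, Real.norm_of_nonneg ENNReal.toReal_nonneg, ENNReal.ofReal_toReal hz]

lemma integrable_pairing {ω : ℂ → ℝ} {ν : Measure Disc} (hmass : ∀ z, tentMass ω z ≠ ∞)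
    {f g : Disc → ℂ} (hf : Measurable f) (hg : Measurable g)
    (h : ∫⁻ z, ‖f z‖ₑ * ‖g z‖ₑ * tentMass ω z ∂ν ≠ ∞) :
    Integrable (fun z => f z * conj (g z) * ((tentMass ω z).toReal : ℂ)) ν := by
  refine ⟨((hf.mul (Complex.continuous_conj.measurable.comp hg)).mul (Complex.measurable_ofReal.comp
    (measurable_tentMass ω).ennreal_toReal)).aestronglyMeasurable, ?_⟩
  rw [hasFiniteIntegral_iff_enorm]
  simpa only [enorm_pairing (hmass _)] using h.lt_top

variable {ω : ℂ → ℝ} {ν : Measure Disc} [SFinite ν] {p q p' q' : ℝ≥0∞}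
  [Fact (1 ≤ p)] [Fact (1 ≤ q)] [Fact (1 ≤ p')] [Fact (1 ≤ q')]

/-- The map sending `g` to the functional `⟨·, g⟩`. -/
lemma exists_pairingMap (hmass : ∀ z, tentMass ω z ≠ ∞) {K : ℝ≥0}
    (hK : ∀ f g : Disc → ℂ, Measurable f → Measurable g → tentENorm ν ω p' q' g ≠ ∞ →
      ∫⁻ z, ‖f z‖ₑ * ‖g z‖ₑ * tentMass ω z ∂ν
        ≤ K * (tentENorm ν ω p q f * tentENorm ν ω p' q' g)) :
    ∃ Φ : TentSpace ν ω p' q' →ₛₗ[starRingEnd ℂ] StrongDual ℂ (TentSpace ν ω p q),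
      (∀ (g : TentSpace ν ω p' q') (f : TentSpace ν ω p q),
        Integrable (fun z => (f : Disc →ₘ[ν] ℂ) z * conj ((g : Disc →ₘ[ν] ℂ) z) *
          ((tentMass ω z).toReal : ℂ)) ν ∧
        Φ g f = ∫ z, (f : Disc →ₘ[ν] ℂ) z * conj ((g : Disc →ₘ[ν] ℂ) z) *
          ((tentMass ω z).toReal : ℂ) ∂ν) ∧
      ∀ g, ‖Φ g‖ ≤ K * ‖g‖ := by
  have hle := fun (g : TentSpace ν ω p' q') (f : TentSpace ν ω p q) =>
    hK f g (AEEqFun.measurable _) (AEEqFun.measurable _) (ne_of_lt g.2)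
  have htop : ∀ (g : TentSpace ν ω p' q') (f : TentSpace ν ω p q),
      K * (tentENorm ν ω p q (f : Disc →ₘ[ν] ℂ) * tentENorm ν ω p' q' (g : Disc →ₘ[ν] ℂ)) ≠ ∞ :=
    fun g f => ENNReal.mul_ne_top ENNReal.coe_ne_top
      (ENNReal.mul_ne_top (ne_of_lt f.2) (ne_of_lt g.2))
  have hint := fun (g : TentSpace ν ω p' q') (f : TentSpace ν ω p q) =>
    integrable_pairing hmass (AEEqFun.measurable _) (AEEqFun.measurable _)
      (ne_top_of_le_ne_top (htop g f) (hle g f))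
  let B : TentSpace ν ω p' q' →ₛₗ[starRingEnd ℂ] TentSpace ν ω p q →ₗ[ℂ] ℂ :=
    LinearMap.mk₂'ₛₗ (starRingEnd ℂ) (RingHom.id ℂ)
      (fun g f => ∫ z, (f : Disc →ₘ[ν] ℂ) z * conj ((g : Disc →ₘ[ν] ℂ) z) *
        ((tentMass ω z).toReal : ℂ) ∂ν)
      (fun g₁ g₂ f => by
        rw [← integral_add (hint g₁ f) (hint g₂ f)]
        refine integral_congr_ae ?_
        rw [Submodule.coe_add]
        filter_upwards [AEEqFun.coeFn_add (g₁ : Disc →ₘ[ν] ℂ) (g₂ : Disc →ₘ[ν] ℂ)] with z hz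
        rw [hz, Pi.add_apply, map_add]
        ring)
      (fun c g f => by
        rw [smul_eq_mul, ← integral_const_mul]
        refine integral_congr_ae ?_
        rw [Submodule.coe_smul]
        filter_upwards [AEEqFun.coeFn_smul c (g : Disc →ₘ[ν] ℂ)] with z hz
        rw [hz, Pi.smul_apply, smul_eq_mul, map_mul]
        ring)
      (fun g f₁ f₂ => by
        rw [← integral_add (hint g f₁) (hint g f₂)]
        refine integral_congr_ae ?_
        rw [Submodule.coe_add]
        filter_upwards [AEEqFun.coeFn_add (f₁ : Disc →ₘ[ν] ℂ) (f₂ : Disc →ₘ[ν] ℂ)] with z hz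
        rw [hz, Pi.add_apply]
        ring)
      (fun c g f => by
        rw [RingHom.id_apply, smul_eq_mul, ← integral_const_mul]
        refine integral_congr_ae ?_
        rw [Submodule.coe_smul]
        filter_upwards [AEEqFun.coeFn_smul c (f : Disc →ₘ[ν] ℂ)] with z hz
        rw [hz, Pi.smul_apply, smul_eq_mul]
        ring)
  have hB : ∀ g f, ‖B g f‖ ≤ K * ‖g‖ * ‖f‖ := by
    intro g f
    have h1 : ‖B g f‖ₑ ≤ K * (tentENorm ν ω p q (f : Disc →ₘ[ν] ℂ) *
        tentENorm ν ω p' q' (g : Disc →ₘ[ν] ℂ)) := by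
      refine (enorm_integral_le_lintegral_enorm _).trans (le_trans (le_of_eq ?_) (hle g f))
      exact lintegral_congr fun z => enorm_pairing (hmass z) _ _
    have h2 := ENNReal.toReal_mono (htop g f) h1
    rw [toReal_enorm, ENNReal.toReal_mul, ENNReal.toReal_mul, ENNReal.coe_toReal] at h2
    rw [TentSpace.norm_def, TentSpace.norm_def]
    linarith
  let Ψ := B.mkContinuous₂ K hB
  refine ⟨Ψ.toLinearMap, fun g f => ⟨hint g f, rfl⟩, fun g => ?_⟩
  exact (Ψ.le_opNorm g).trans (mul_le_mul_of_nonneg_right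
    (LinearMap.mkContinuous₂_norm_le B K.2 hB) (norm_nonneg _))

end TentDuality

/-! ### The duality theorem -/

open TentDuality in
theorem mainTheorem3 (p q p' q' : ℝ≥0∞) [Fact (1 ≤ p)] [Fact (1 ≤ q)] [Fact (1 ≤ p')]
    [Fact (1 ≤ q')] (hp : p ≠ ∞) (hq : q ≠ ∞) (hpq : p + q ≠ 2)
    (hpp' : p.HolderConjugate p') (hqq' : q.HolderConjugate q')
    (ω : ℂ → ℝ) (hω : DoublingRadialWeight ω)
    (ν : Measure Disc) [IsFiniteMeasureOnCompacts ν] :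
    ∃ Φ : TentSpace ν ω p' q' ≃ₛₗ[starRingEnd ℂ] StrongDual ℂ (TentSpace ν ω p q),
      (∀ (g : TentSpace ν ω p' q') (f : TentSpace ν ω p q),
        Integrable (fun z => (f : Disc →ₘ[ν] ℂ) z * conj ((g : Disc →ₘ[ν] ℂ) z) *
          ((tentMass ω z).toReal : ℂ)) ν ∧
        Φ g f = ∫ z, (f : Disc →ₘ[ν] ℂ) z * conj ((g : Disc →ₘ[ν] ℂ) z) *
          ((tentMass ω z).toReal : ℂ) ∂ν) ∧
      ∃ c C : ℝ, 0 < c ∧ 0 < C ∧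
        ∀ g : TentSpace ν ω p' q', c * ‖g‖ ≤ ‖Φ g‖ ∧ ‖Φ g‖ ≤ C * ‖g‖ := by
  obtain ⟨D, H⟩ := hω.exists_tentControl
  have hfin := H.finite
  have hmass := H.mass_ne_top
  have hp1 : 1 ≤ p := Fact.out
  have hq1 : 1 ≤ q := Fact.out
  obtain ⟨K₁, hK₁⟩ := H.exists_tentENorm_le p q p' q' hp1 hq1 hp hq hpq hpp' hqq'
  obtain ⟨K₂, hK₂⟩ := H.exists_pairing_le p q p' q' hp1 hq1 Fact.out hp hq hpq hpp' hqq'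
  obtain ⟨Φ, hΦ, hΦle⟩ := exists_pairingMap (ν := ν) (p := p) (q := q) hmass (hK₂ ν)
  obtain ⟨w, hwm, hw0, hwt⟩ := exists_pos_tentENorm_ne_top ν ω hp1 hq1 hp hq
  have htest : ∀ g : TentSpace ν ω p' q',
      TestBound ν ω p.toReal q.toReal ‖Φ g‖ₑ (fun z => ‖(g : Disc →ₘ[ν] ℂ) z‖ₑ) := by
    intro g
    refine testBound_of_representation hp hq hwm hw0 hwt hmass (Φ g) (AEEqFun.measurable _) ?_ ?_
    · have hWm : Measurable fun z => (w z : ℂ) := Complex.measurable_ofReal.comp hwm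
      have hi := (integrable_pairing hmass hWm (AEEqFun.measurable (g : Disc →ₘ[ν] ℂ))
        (ne_top_of_le_ne_top (ENNReal.mul_ne_top ENNReal.coe_ne_top
          (ENNReal.mul_ne_top hwt (ne_of_lt g.2)))
          (hK₂ ν _ _ hWm (AEEqFun.measurable _) (ne_of_lt g.2)))).norm
      refine hi.congr (Eventually.of_forall fun z => ?_)
      simp only [norm_mul, Complex.norm_real, RCLike.norm_conj, Real.norm_of_nonneg (hw0 z).le,
        Real.norm_of_nonneg ENNReal.toReal_nonneg, mul_assoc]
    · intro f hf hft _
      rw [(hΦ g _).2]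
      refine integral_congr_ae ?_
      filter_upwards [TentSpace.coeFn_of (ν := ν) hf hft] with z hz
      rw [hz]
  have hlow : ∀ g, ‖g‖ ≤ K₁ * ‖Φ g‖ := by
    intro g
    have h := hK₁ ν _ _ (AEEqFun.measurable _) (htest g)
    have h2 := ENNReal.toReal_mono (ENNReal.mul_ne_top ENNReal.coe_ne_top enorm_ne_top) h
    rwa [ENNReal.toReal_mul, toReal_enorm, ENNReal.coe_toReal] at h2
  have hinj : Function.Injective Φ := by
    refine (injective_iff_map_eq_zero Φ).2 fun g hg => ?_
    -- The constant 1 may have infinite tent norm, but with Φ g = 0 the bound reads 0 · ∞ = 0. The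
    -- tent space is only seminormed here, so injectivity comes from this test rather than from the
    -- lower norm estimate.
    have h := htest g (fun _ => 1) measurable_const
    rw [hg, ← ofReal_norm, norm_zero, ENNReal.ofReal_zero, zero_mul, nonpos_iff_eq_zero] at h
    have hgm : Measurable fun z => 1 * ‖(g : Disc →ₘ[ν] ℂ) z‖ₑ * tentMass ω z :=
      (measurable_const.mul (AEEqFun.measurable _).enorm).mul (measurable_tentMass ω)
    replace h := (lintegral_eq_zero_iff hgm).1 h
    refine Subtype.ext (AEEqFun.ext ?_)
    refine EventuallyEq.trans ?_ AEEqFun.coeFn_zero.symm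
    filter_upwards [h] with z hz
    simpa [H.mass_ne_zero z] using hz
  have hsurj : Function.Surjective Φ := by
    intro L
    obtain ⟨k, hkm, hki, hk⟩ := exists_density hp hq hwm hw0 hwt L
    have hm0 : ∀ z, (tentMass ω z).toReal ≠ 0 := fun z =>
      (ENNReal.toReal_pos (H.mass_ne_zero z) (hmass z)).ne'
    -- The candidate has the density k after conjugation and multiplication by tentMass; that it
    -- lies in the dual tent space follows from the test bound.
    let g : Disc → ℂ := fun z => conj (k z / ((tentMass ω z).toReal : ℂ))
    have hgk : ∀ z, conj (g z) * ((tentMass ω z).toReal : ℂ) = k z := by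
      intro z
      rw [Complex.conj_conj, div_mul_cancel₀ _ (Complex.ofReal_ne_zero.2 (hm0 z))]
    have hgm : Measurable g := Complex.continuous_conj.measurable.comp
      (hkm.div (Complex.measurable_ofReal.comp (measurable_tentMass ω).ennreal_toReal))
    have hgt : tentENorm ν ω p' q' g ≠ ∞ := by
      refine ne_top_of_le_ne_top (ENNReal.mul_ne_top ENNReal.coe_ne_top enorm_ne_top)
        (hK₁ ν _ g hgm (testBound_of_representation hp hq hwm hw0 hwt hmass L hgm ?_ ?_))
      · refine hki.norm.congr (Eventually.of_forall fun z => ?_)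
        simp only [← hgk z, norm_mul, Complex.norm_real, RCLike.norm_conj,
          Real.norm_of_nonneg (hw0 z).le, Real.norm_of_nonneg ENNReal.toReal_nonneg]
      · intro f hf hft hi
        simp only [mul_assoc, hgk] at hi ⊢
        exact hk f hf hft hi
    refine ⟨TentSpace.of g hgm hgt, ContinuousLinearMap.ext fun f => ?_⟩
    have hae : (fun z => (f : Disc →ₘ[ν] ℂ) z * conj
        (((TentSpace.of g hgm hgt : TentSpace ν ω p' q') : Disc →ₘ[ν] ℂ) z) *
          ((tentMass ω z).toReal : ℂ)) =ᵐ[ν] fun z => (f : Disc →ₘ[ν] ℂ) z * k z := by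
      filter_upwards [TentSpace.coeFn_of (ν := ν) hgm hgt] with z hz
      rw [hz, mul_assoc, hgk]
    obtain ⟨hi, he⟩ := hΦ (TentSpace.of g hgm hgt) f
    rw [he, integral_congr_ae hae, ← hk _ (AEEqFun.measurable _) (ne_of_lt f.2) (hi.congr hae),
      TentSpace.of_coeFn]
  -- The constants from the two estimates may vanish; adding 1 keeps c and C positive and c finite.
  refine ⟨LinearEquiv.ofBijective Φ ⟨hinj, hsurj⟩, hΦ, 1 / (K₁ + 1), K₂ + 1, by positivity,
    by positivity, fun g => ⟨?_, ?_⟩⟩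
  · change 1 / ((K₁ : ℝ) + 1) * ‖g‖ ≤ ‖Φ g‖
    rw [one_div_mul_eq_div, div_le_iff₀ (by positivity)]
    linarith [hlow g, norm_nonneg (Φ g)]
  · change ‖Φ g‖ ≤ (K₂ + 1) * ‖g‖
    linarith [hΦle g, norm_nonneg g]
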